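/- **Graphs.** Let $-\infty\le A<B\le\infty$. A time-like graph (TLG) $\mathcal G=(\mathcal V,\mathcal E)$ from $A$ to $B$ is considered together with a representation in $\mathbb R\times\mathbb R^2$, whose first coordinate is time. Its vertices are points of $\mathbb R\times\mathbb R^2$ with time in $[A,B]$; there is exactly one vertex $t_0$ with time $A$ and exactly one vertex $t_N$ with time $B$ (if $A=-\infty$ or $B=\infty$, this vertex is an ideal one and is not a point of $\mathbb R\times\mathbb R^2$). Every edge is the graph of a continuous function from a time interval to $\mathbb R^2$ that joins an earlier vertex to a later one; several edges may join the same two vertices; edges meet only at vertices and contain no vertex in their interior; every vertex with time in $(A,B)$ has an incoming and an outgoing edge; and every compact set meets only finitely many edges. $R(\mathcal G)\subset\mathbb R\times\mathbb R^2$ denotes the union of the edges. A time-path is a curve, monotone in time, that runs along edges from a vertex to a later vertex; it is a full time-path if it goes from $t_0$ to $t_N$; $P_{0\to1}(\mathcal G)$ is the set of full time-paths. A simple cell is a pair of time-paths with the same two end vertices and no other common point, such that no time-path leads from an interior vertex of one of them to an interior vertex of the other. A TLG$^*$-tower is a sequence $\mathcal G_0,\mathcal G_1,\mathcal G_2,\dots$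 of finite TLGs from $A$ to $B$ such that $\mathcal G_0$ is minimal (the vertices $t_0,t_N$ and one edge) and each $\mathcal G_{l+1}$ arises from $\mathcal G_l$ either by adding a vertex in the interior of an edge, which is cut in two by it, or by adding a new edge between two vertices that are joined by a time-path in $\mathcal G_l$. If $A=-\infty$, then each $\mathcal G_l$ has only one edge at $t_0$, and these initial edges decrease with $l$; likewise at $t_N$ if $B=\infty$. The tower constructs $\mathcal G$ if $\bigcup_l\mathcal V_l=\mathcal V$ and $\bigcup_lR(\mathcal G_l)=R(\mathcal G)$. A TLG with infinitely many vertices is a TLG$^*$ if some TLG$^*$-tower constructs it. **Families of distributions.** Let $\mathcal M=\{\mu_\sigma:\sigma\in P_{0\to1}(\mathcal G)\}$, where $\mu_\sigma$ is the distribution of a real-valued process, indexed by the real times in $[A,B]$, with right-continuous paths that have left limits (in particular, it may be continuous). Suppose that $\mathcal M$ is consistent, i.e. $\mu_{\sigma_1}$ and $\mu_{\sigma_2}$ have the same restriction to the set of times at which $\sigma_1$ and $\sigma_2$ pass through the same point; and suppose that for every simple cell $(\pi_1,\pi_2)$ from a vertex at time $t_*\in\mathbb R$ to a vertex at time $t^*\in\mathbb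 R$ and every full time-path $\sigma$ containing $\pi_1$ or $\pi_2$, a $\mu_\sigma$-distributed process $Y$ has the property that $(Y(t):t\in[A,t_*]\cup[t^*,B])$ and $(Y(t):t\in[t_*,t^*])$ are independent given $(Y(t_*),Y(t^*))$. **Processes.** A process $X=(X(p):p\in R(\mathcal G))$ is an $\mathcal M$-process constructed using the tower $(\mathcal G_l)$ if $X$ on $R(\mathcal G_0)$ has the distribution $\mu_{\sigma_0}$, where $\sigma_0$ is the full time-path $R(\mathcal G_0)$, and the following holds whenever $\mathcal G_{l+1}$ arises from $\mathcal G_l$ by adding an edge $E^*$ from a vertex $v$ at time $t_j$ to a vertex $w$ at time $t_k$: for some full time-path $\sigma$ containing $E^*$, if $\mu_*(\cdot\mid x,y)$ denotes the conditional distribution of $(Y(t):t\in[t_j,t_k])$ given $Y(t_j)=x$ and $Y(t_k)=y$ for a $\mu_\sigma$-distributed $Y$, then $\mu_*(\cdot\mid X(v),X(w))$ is the conditional distribution of $X$ along $E^*$ given all of $(X(p):p\in R(\mathcal G_l))$. **Theorem.** Let $\mathcal G$ be a TLG$^*$ with infinitely many vertices (planar or not), and let $\mathcal M$ be a family on $P_{0\to1}(\mathcal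 G)$ as above. Let $X^1$ and $X^2$ be two $\mathcal M$-processes on $\mathcal G$, constructed using two TLG$^*$-towers $(\mathcal G^1_n)$ and $(\mathcal G^2_n)$ that both construct $\mathcal G$. Then $X^1$ and $X^2$ have the same distribution. -/

import Mathlib

open Set Filter Topology MeasureTheory ProbabilityTheory

/-! ### Time-like graphs, given together with a representation in `ℝ × ℝ²` -/

/-- The real times `t` with `a ≤ t ≤ b`; the bounds may be infinite. -/
def timeDom (a b : EReal) : Set ℝ := {t : ℝ | a ≤ (t : EReal) ∧ (t : EReal) ≤ b}

/-- Points of the space `ℝ × ℝ²`; the first coordinate is the time of the point. -/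
abbrev Point : Type := ℝ × ℝ × ℝ

/-- A continuous curve in `ℝ²`, parametrised by the real times between `a` and `b`. -/
abbrev Curve (a b : EReal) : Type := C(timeDom a b, ℝ × ℝ)

/-- The point `(t, γ t)` of `ℝ × ℝ²`. -/
def Curve.pt {a b : EReal} (γ : Curve a b) (t : timeDom a b) : Point := ((t : ℝ), γ t)

/-- The set of all points `(t, γ t)`. -/
def Curve.graph {a b : EReal} (γ : Curve a b) : Set Point := range (Curve.pt γ)

/-- The points `(t, γ t)` with `a < t < b`. -/
def Curve.inner {a b : EReal} (γ : Curve a b) : Set Point :=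
  {p | p ∈ Curve.graph γ ∧ a < (p.1 : EReal) ∧ (p.1 : EReal) < b}

/-- `t` is one of the two extreme times `a`, `b` (this never holds at an infinite extreme time). -/
def IsEndTime {a b : EReal} (t : timeDom a b) : Prop :=
  ((t : ℝ) : EReal) = a ∨ ((t : ℝ) : EReal) = b

/-- Two curves over the same times begin at the same point and end at the same point. An infinite
extreme time stands for a single vertex, so that there is nothing to ask there. -/
def Coterminal {a b : EReal} (γ γ' : Curve a b) : Prop :=
  ∀ t : timeDom a b, IsEndTime t → γ t = γ' t

/-- An edge, identified with its representation. -/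
structure Edge where
  lo : EReal
  hi : EReal
  lo_lt_hi : lo < hi
  curve : Curve lo hi

/-- A time-like graph with initial time `A` and terminal time `B`, finite or infinite, together
with a representation. The set `verts` holds the vertices of finite time; if `A = -∞`
(`B = ∞`), then there is in addition the initial (terminal) vertex at infinite time, which is not
a point of `ℝ × ℝ²`. -/
structure TimeLikeGraph (A B : EReal) where
  verts : Set Point
  edges : Set Edge
  verts_time : ∀ v ∈ verts, v.1 ∈ timeDom A B
  existsUnique_initial : ∀ a : ℝ, A = (a : EReal) → ∃! v : Point, v ∈ verts ∧ v.1 = a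
  existsUnique_terminal : ∀ b : ℝ, B = (b : EReal) → ∃! v : Point, v ∈ verts ∧ v.1 = b
  edge_time : ∀ e ∈ edges, A ≤ e.lo ∧ e.hi ≤ B
  edge_ends : ∀ e ∈ edges, ∀ t : timeDom e.lo e.hi, IsEndTime t → Curve.pt e.curve t ∈ verts
  edges_disjoint : ∀ e ∈ edges, ∀ e' ∈ edges, e ≠ e' →
    Disjoint (Curve.inner e.curve) (Curve.inner e'.curve)
  verts_not_inner : ∀ e ∈ edges, ∀ v ∈ verts, v ∉ Curve.inner e.curve
  exists_in_out : ∀ v ∈ verts, A < (v.1 : EReal) → (v.1 : EReal) < B →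
    (∃ e ∈ edges, e.hi = (v.1 : EReal) ∧ v ∈ Curve.graph e.curve) ∧
    (∃ e ∈ edges, e.lo = (v.1 : EReal) ∧ v ∈ Curve.graph e.curve)
  locallyFinite : ∀ K : Set Point, IsCompact K →
    {e ∈ edges | (Curve.graph e.curve ∩ K).Nonempty}.Finite

namespace TimeLikeGraph

variable {A B : EReal}

/-- The representation `R(G)`: all points (of finite time) of the graph. -/
def points (G : TimeLikeGraph A B) : Set Point := ⋃ e ∈ G.edges, Curve.graph e.curve

/-- A time-path: a curve, monotone in time, that runs along the edges of the graph and that begins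
and ends at vertices. -/
def IsTimePath (G : TimeLikeGraph A B) {a b : EReal} (γ : Curve a b) : Prop :=
  a < b ∧ Curve.graph γ ⊆ G.points ∧ ∀ t : timeDom a b, IsEndTime t → Curve.pt γ t ∈ G.verts

/-- The full time-paths: those from the initial to the terminal vertex. -/
structure FullPath (G : TimeLikeGraph A B) where
  curve : Curve A B
  isTimePath : G.IsTimePath curve

/-- The point of a full time-path at time `t`, as a point of the graph. -/
def FullPath.point {G : TimeLikeGraph A B} (σ : G.FullPath) (t : timeDom A B) : G.points :=
  ⟨Curve.pt σ.curve t, σ.isTimePath.2.1 (mem_range_self t)⟩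

/-- A cell: two co-terminal time-paths that do not meet in between. It is simple if no time-path
leads from an interior vertex of one of them to an interior vertex of the other one. -/
def IsSimpleCell (G : TimeLikeGraph A B) {a b : EReal} (π₁ π₂ : Curve a b) : Prop :=
  G.IsTimePath π₁ ∧ G.IsTimePath π₂ ∧ Coterminal π₁ π₂ ∧
  Disjoint (Curve.inner π₁) (Curve.inner π₂) ∧
  ∀ (c d : EReal) (ρ : Curve c d), G.IsTimePath ρ → ∀ x y : timeDom c d,
    ((x : ℝ) : EReal) = c → ((y : ℝ) : EReal) = d →
      ¬ (Curve.pt ρ x ∈ Curve.inner π₁ ∧ Curve.pt ρ y ∈ Curve.inner π₂) ∧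
      ¬ (Curve.pt ρ x ∈ Curve.inner π₂ ∧ Curve.pt ρ y ∈ Curve.inner π₁)

/-! ### Towers -/

/-- The minimal graph: one edge from the initial to the terminal vertex, no other vertex. -/
def IsMinimal (G : TimeLikeGraph A B) : Prop :=
  ∃ e : Edge, G.edges = {e} ∧ e.lo = A ∧ e.hi = B ∧
    G.verts = {p | p ∈ Curve.graph e.curve ∧ ((p.1 : EReal) = A ∨ (p.1 : EReal) = B)}

/-- `G'` arises from `G` by adding a vertex `v` in the interior of an edge `e`, which is thereby
cut into the edges `e₁` and `e₂`. -/
def AddVertex (G G' : TimeLikeGraph A B) : Prop :=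
  ∃ e ∈ G.edges, ∃ v ∈ Curve.inner e.curve, ∃ e₁ e₂ : Edge,
    e₁.lo = e.lo ∧ e₁.hi = (v.1 : EReal) ∧ e₂.lo = (v.1 : EReal) ∧ e₂.hi = e.hi ∧
    Curve.graph e₁.curve ∪ Curve.graph e₂.curve = Curve.graph e.curve ∧
    G'.verts = insert v G.verts ∧ G'.edges = (G.edges \ {e}) ∪ {e₁, e₂}

/-- `G'` arises from `G` by adding the new edge `e` between two vertices of `G` that are connected
in `G` by a time-path. -/
def AddEdge (G G' : TimeLikeGraph A B) (e : Edge) : Prop :=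
  (∃ ρ : Curve e.lo e.hi, G.IsTimePath ρ ∧ Coterminal ρ e.curve) ∧
  e ∉ G.edges ∧ G'.verts = G.verts ∧ G'.edges = insert e G.edges

/-- `T 0, T 1, T 2, …` is a TLG*-tower (in a consistent representation) that starts with the
minimal graph and constructs the graph `G`. At an infinite time there is a single initial
(terminal) edge in each `T n`, and these edges decrease. -/
structure IsTower (T : ℕ → TimeLikeGraph A B) (G : TimeLikeGraph A B) : Prop where
  minimal : (T 0).IsMinimal
  step : ∀ n, (T n).AddVertex (T (n + 1)) ∨ ∃ e, (T n).AddEdge (T (n + 1)) e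
  verts_eq : ⋃ n, (T n).verts = G.verts
  points_eq : ⋃ n, (T n).points = G.points
  initial_decreasing : ∀ m n, m < n → ∀ e ∈ (T m).edges, ∀ e' ∈ (T n).edges,
    e.lo = ⊥ → e'.lo = ⊥ → Curve.inner e'.curve ⊆ Curve.inner e.curve
  terminal_decreasing : ∀ m n, m < n → ∀ e ∈ (T m).edges, ∀ e' ∈ (T n).edges,
    e.hi = ⊤ → e'.hi = ⊤ → Curve.inner e'.curve ⊆ Curve.inner e.curve

end TimeLikeGraph

/-! ### Conditional independence and conditional distributions -/

/-- The σ-algebra generated by the random element `Z`. -/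
abbrev sigmaOf {Ω 𝓩 : Type*} [MeasurableSpace 𝓩] (Z : Ω → 𝓩) : MeasurableSpace Ω :=
  MeasurableSpace.comap Z inferInstance

/-- The random elements `U` and `W` are conditionally independent given `Z`. -/
def CondIndepGiven {Ω 𝓤 𝓦 𝓩 : Type*} [MeasurableSpace Ω] [MeasurableSpace 𝓤] [MeasurableSpace 𝓦]
    [MeasurableSpace 𝓩] (P : Measure Ω) (U : Ω → 𝓤) (W : Ω → 𝓦) (Z : Ω → 𝓩) : Prop :=
  ∀ (C : Set 𝓤) (D : Set 𝓦), MeasurableSet C → MeasurableSet D →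
    P⟦(U ⁻¹' C) ∩ (W ⁻¹' D) | sigmaOf Z⟧ =ᵐ[P]
      fun ω => (P⟦U ⁻¹' C | sigmaOf Z⟧) ω * (P⟦W ⁻¹' D | sigmaOf Z⟧) ω

/-- The random measure `ω ↦ κ ω` is a conditional distribution of `W` given `Z`. -/
def IsCondDistribGiven {Ω 𝓦 𝓩 : Type*} [MeasurableSpace Ω] [MeasurableSpace 𝓦]
    [MeasurableSpace 𝓩] (P : Measure Ω) (W : Ω → 𝓦) (Z : Ω → 𝓩) (κ : Ω → Measure 𝓦) : Prop :=
  ∀ D : Set 𝓦, MeasurableSet D → P⟦W ⁻¹' D | sigmaOf Z⟧ =ᵐ[P] fun ω => (κ ω).real D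

/-! ### Families of distributions along full time-paths -/

/-- Right-continuous with left limits. -/
def IsRCLL {A B : EReal} (y : timeDom A B → ℝ) : Prop :=
  ∀ t, ContinuousWithinAt y (Ici t) t ∧ ∃ l : ℝ, Tendsto y (𝓝[<] t) (𝓝 l)

/-- `ν` is the distribution of a process with RCLL paths. -/
def IsRCLLLaw {A B : EReal} (ν : Measure (timeDom A B → ℝ)) : Prop :=
  ∃ ρ : Measure {y : timeDom A B → ℝ // IsRCLL y},
    IsProbabilityMeasure ρ ∧ ρ.map Subtype.val = ν

namespace TimeLikeGraph

variable {A B : EReal}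

/-- The conditions on a family of distributions `μ σ` along the full time-paths `σ` of `G`: each of
them is the distribution of an RCLL process, `μ σ₁` and `μ σ₂` agree on the common part of `σ₁` and
`σ₂`, and for each simple cell from time `a` to time `b`, along each full time-path that contains
one of the two sides of the cell, what happens during `[a, b]` and what happens outside of it are
independent given the values at `a` and at `b`. -/
structure IsThreeTFamily (G : TimeLikeGraph A B)
    (μ : G.FullPath → Measure (timeDom A B → ℝ)) : Prop where
  rcll : ∀ σ, IsRCLLLaw (μ σ)
  consistent : ∀ σ₁ σ₂ : G.FullPath,
    (μ σ₁).map ({t | σ₁.curve t = σ₂.curve t} : Set (timeDom A B)).domRestrict =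
      (μ σ₂).map ({t | σ₁.curve t = σ₂.curve t} : Set (timeDom A B)).domRestrict
  cell : ∀ (a b : timeDom A B) (π₁ π₂ : Curve ((a : ℝ) : EReal) ((b : ℝ) : EReal)),
    G.IsSimpleCell π₁ π₂ → ∀ σ : G.FullPath,
      (Curve.graph π₁ ⊆ Curve.graph σ.curve ∨ Curve.graph π₂ ⊆ Curve.graph σ.curve) →
        CondIndepGiven (μ σ) (Iic a ∪ Ici b).domRestrict (Icc a b).domRestrict (fun y => (y a, y b))

/-- The process `X` along the full time-path `σ`. -/
def alongPath {G : TimeLikeGraph A B} {Ω : Type*} (X : G.points → Ω → ℝ) (σ : G.FullPath) :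
    Ω → timeDom A B → ℝ :=
  fun ω t => X (σ.point t) ω

/-- The restriction of the process `X` on `G` to the representation of another graph `H`. -/
def restrictTo {G : TimeLikeGraph A B} {Ω : Type*} (X : G.points → Ω → ℝ)
    (H : TimeLikeGraph A B) : Ω → {p : G.points | (p : Point) ∈ H.points} → ℝ :=
  fun ω p => X p.1 ω

/-- `X` is an `M`-process on `G`, for the family `M = (μ σ)`, constructed using the tower `T`:
its restriction to the minimal graph `T 0` has the distribution that `M` prescribes; whenever
`T (l + 1)` arises from `T l` by adding an edge `e`, from time `a` to time `b`, the conditional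
distribution of `X` along `e`, given all of `X` on `T l`, is `κ (·)` evaluated at the values of `X`
at the two ends of `e`, where `κ` is the conditional distribution, given the values at times `a`
and `b`, of a process with distribution `μ σ` on `[a, b]`, for a full time-path `σ` containing `e`.
(Adding a vertex changes neither the representation nor the process.) -/
structure IsConstructedOn (G : TimeLikeGraph A B) (T : ℕ → TimeLikeGraph A B)
    (μ : G.FullPath → Measure (timeDom A B → ℝ)) {Ω : Type*} [MeasurableSpace Ω] (P : Measure Ω)
    (X : G.points → Ω → ℝ) : Prop where
  measurable : ∀ p, Measurable (X p)
  base : ∃ σ : G.FullPath, Curve.graph σ.curve = (T 0).points ∧ P.map (alongPath X σ) = μ σ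
  edge : ∀ (l : ℕ) (e : Edge), (T l).AddEdge (T (l + 1)) e → ∀ a b : timeDom A B,
    e.lo = ((a : ℝ) : EReal) → e.hi = ((b : ℝ) : EReal) →
      ∃ σ : G.FullPath, Curve.graph e.curve ⊆ Curve.graph σ.curve ∧
        ∃ κ : Kernel (ℝ × ℝ) (Icc a b → ℝ), IsMarkovKernel κ ∧
          IsCondDistribGiven (μ σ) (Icc a b).domRestrict (fun y => (y a, y b))
            (fun y => κ (y a, y b)) ∧
          IsCondDistribGiven P (fun ω => (Icc a b).domRestrict (alongPath X σ ω))
            (restrictTo X (T l)) (fun ω => κ (alongPath X σ ω a, alongPath X σ ω b))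

end TimeLikeGraph

/-! ### Paths in subsets of `ℝ × ℝ²` -/

/-! The proof adds the edges of the second tower one by one and shows that the process of the first
tower has, along each of them, the conditional distribution prescribed for the second process. The
laws then agree on every finite stage of the second tower, hence on all finite sets of points. A
path over unbounded times need not lie in any finite stage of the other tower, so stages are
compared over a compact time window `[s₀, s₁]` outside of which the given stage `T' l` is only its
base path.

The graphs are treated as closed sets of points that grow by ears: paths that leave the set and
return, with ends already joined by a parallel path. Sliding an ear onto the parallel path is a
continuous retraction that preserves time. Therefore each stage of a tower retracts to all earlier
ones. Over the window, a late stage `T M` of the first tower contains the stages of the second tower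
up to `l` and is itself contained in a still later one, which retracts to each of them. Hence these
stages, extended by a full path `τ`, are time retracts of `T M` (`IsTimeRetract.inter_union_seg`).

The central statement is the Markov property `IsEarSeq.strandMarkov`: in a time retract `L` of a
stage, each unbranched piece (strand) lies on a full path in `L` such that, given the process on the
rest of that path, the strand is independent of the rest of `L`. The induction runs over the stages,
for all retracts at once. If `L` contains the last ear, the ear is replaced by a path `π` of the
previous stage, which gives a retract of that stage (`Replacement.isTimeRetract`). The independence
found there is carried back to `L` by the rules of conditional independence, using that a new ear
depends on the past through its two end values only.

A new edge of the second tower and a parallel path form a simple cell of `G`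
(`IsTower.isSimpleCell`), again because a connecting path could be retracted to the stage in which
the edge has just been added. Since the process has law `μ σ` along each full path of a stage
(`IsConstructedOn.map_alongPath`), the cell condition makes the edge independent of the rest of the
path given the end values. With the Markov property, it is independent of the whole earlier stage of
the second tower over the window (`IsConstructedOn.hasKernel_onSet`). By consistency the kernel is
the same for both processes, and the induction in `map_onSet_window_eq` closes. -/

/-- The part over the times in `J` of the graph of `f`. -/
def seg (f : ℝ → ℝ × ℝ) (J : Set ℝ) : Set Point := {p | p.1 ∈ J ∧ p.2 = f p.1}

theorem mk_mem_seg {f : ℝ → ℝ × ℝ} {J : Set ℝ} {t : ℝ} (ht : t ∈ J) : (t, f t) ∈ seg f J :=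
  ⟨ht, rfl⟩

theorem seg_mono {f : ℝ → ℝ × ℝ} {J J' : Set ℝ} (h : J ⊆ J') : seg f J ⊆ seg f J' :=
  fun _ hp => ⟨h hp.1, hp.2⟩

theorem seg_congr {f g : ℝ → ℝ × ℝ} {J : Set ℝ} (h : EqOn f g J) : seg f J = seg g J := by
  ext p
  constructor
  · rintro ⟨h1, h2⟩
    exact ⟨h1, h2.trans (h h1)⟩
  · rintro ⟨h1, h2⟩
    exact ⟨h1, h2.trans (h h1).symm⟩

theorem isClosed_seg {f : ℝ → ℝ × ℝ} {J : Set ℝ} (hJ : IsClosed J) (hf : ContinuousOn f J) :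
    IsClosed (seg f J) := by
  have h1 : IsClosed (Prod.fst ⁻¹' J : Set Point) := hJ.preimage continuous_fst
  have h2 : ContinuousOn (fun p : Point => (p.2, f p.1)) (Prod.fst ⁻¹' J) :=
    continuous_snd.continuousOn.prodMk
      (hf.comp continuous_fst.continuousOn (fun p hp => hp))
  have h3 := h2.preimage_isClosed_of_isClosed h1 (isClosed_diagonal (X := ℝ × ℝ))
  exact h3

/-- Over the times in `I`, the function `f` is continuous and its graph runs in `S`. -/
structure PathIn (S : Set Point) (I : Set ℝ) (f : ℝ → ℝ × ℝ) : Prop where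
  cont : ContinuousOn f I
  mem : ∀ t ∈ I, (t, f t) ∈ S

theorem PathIn.mono {S S' : Set Point} {I I' : Set ℝ} {f : ℝ → ℝ × ℝ} (h : PathIn S I f)
    (hS : S ⊆ S') (hI : I' ⊆ I) : PathIn S' I' f :=
  ⟨h.cont.mono hI, fun t ht => hS (h.mem t (hI ht))⟩

theorem PathIn.congr {S : Set Point} {I : Set ℝ} {f g : ℝ → ℝ × ℝ} (h : PathIn S I f)
    (hg : EqOn g f I) : PathIn S I g :=
  ⟨h.cont.congr hg, fun t ht => by rw [hg ht]; exact h.mem t ht⟩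

theorem PathIn.seg_subset {S : Set Point} {I : Set ℝ} {f : ℝ → ℝ × ℝ} (h : PathIn S I f) :
    seg f I ⊆ S := by
  rintro ⟨t, x⟩ ⟨h1, h2⟩
  have h3 : x = f t := h2
  rw [h3]; exact h.mem t h1

theorem pathIn_seg {I : Set ℝ} {f : ℝ → ℝ × ℝ} (h : ContinuousOn f I) : PathIn (seg f I) I f :=
  ⟨h, fun _ ht => mk_mem_seg ht⟩

/-- `f` up to time `c`, and `g` afterwards. -/
noncomputable def glue (c : ℝ) (f g : ℝ → ℝ × ℝ) : ℝ → ℝ × ℝ := fun t => if t ≤ c then f t else g t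

theorem glue_le {c t : ℝ} (f g : ℝ → ℝ × ℝ) (h : t ≤ c) : glue c f g t = f t := if_pos h

theorem glue_ge {c t : ℝ} {f g : ℝ → ℝ × ℝ} (hfg : f c = g c) (h : c ≤ t) : glue c f g t = g t := by
  unfold glue
  split_ifs with h1
  · have : t = c := le_antisymm h1 h
    rw [this, hfg]
  · rfl

theorem PathIn.glue {S : Set Point} {I : Set ℝ} {c : ℝ} {f g : ℝ → ℝ × ℝ}
    (hf : PathIn S (I ∩ Iic c) f) (hg : PathIn S (I ∩ Ici c) g) (h : f c = g c) :
    PathIn S I (glue c f g) := by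
  constructor
  · have h1 : closure {t : ℝ | t ≤ c} = Iic c := isClosed_Iic.closure_eq
    have h2 : closure {t : ℝ | ¬ t ≤ c} = Ici c := by
      have : {t : ℝ | ¬ t ≤ c} = Ioi c := by ext; simp
      rw [this, closure_Ioi]
    unfold _root_.glue
    refine ContinuousOn.if ?_ (by rw [h1]; exact hf.cont) (by rw [h2]; exact hg.cont)
    rintro t ⟨_, ht⟩
    have : t = c := by
      have h3 : frontier {t : ℝ | t ≤ c} = {c} := frontier_Iic
      rw [h3] at ht; exact ht
    rw [this, h]
  · intro t ht
    rcases le_total t c with h1 | h1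
    · rw [glue_le f g h1]; exact hf.mem t ⟨ht, h1⟩
    · rw [glue_ge h h1]; exact hg.mem t ⟨ht, h1⟩

/-- The set of agreement is closed by continuity, open by hypothesis and contains `t₀`;
connectedness does the rest. -/
theorem eqOn_of_eventually {J : Set ℝ} (hJ : IsPreconnected J) {f e : ℝ → ℝ × ℝ}
    (hf : ContinuousOn f J) (he : ContinuousOn e J) {t₀ : ℝ} (ht₀ : t₀ ∈ J) (h₀ : f t₀ = e t₀)
    (h : ∀ t ∈ J, f t = e t → ∀ᶠ s in 𝓝[J] t, f s = e s) : EqOn f e J := by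
  have : PreconnectedSpace J := Subtype.preconnectedSpace hJ
  have hc : IsClopen {t : J | f t = e t} := by
    constructor
    · exact isClosed_eq hf.domRestrict he.domRestrict
    · rw [isOpen_iff_eventually]
      intro t ht
      have := h t t.2 ht
      rw [nhdsWithin_eq_map_subtype_coe t.2] at this
      exact this
  rcases isClopen_iff.1 hc with h1 | h1
  · have : (⟨t₀, ht₀⟩ : J) ∈ {t : J | f t = e t} := h₀
    rw [h1] at this; exact this.elim
  · intro t ht
    have : (⟨t, ht⟩ : J) ∈ {t : J | f t = e t} := by rw [h1]; trivial
    exact this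

/-- The open interval between `t` and `t₀` lies in `I ∩ Ioo v w`. This lets agreement at interior
times pass to the end times by continuity. -/
theorem inter_Icc_subset_closure {I : Set ℝ} (hI : I.OrdConnected) {v w t₀ : ℝ} (h1 : t₀ ∈ I)
    (h2 : t₀ ∈ Ioo v w) : I ∩ Icc v w ⊆ closure (I ∩ Ioo v w) := by
  rintro t ⟨htI, htv, htw⟩
  rcases lt_trichotomy t t₀ with h | h | h
  · have h3 : Ioo t t₀ ⊆ I ∩ Ioo v w := fun s hs =>
      ⟨hI.out htI h1 ⟨hs.1.le, hs.2.le⟩, lt_of_le_of_lt htv hs.1, hs.2.trans h2.2⟩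
    refine closure_mono h3 ?_
    rw [closure_Ioo h.ne]; exact ⟨le_rfl, h.le⟩
  · subst h; exact subset_closure ⟨h1, h2⟩
  · have h3 : Ioo t₀ t ⊆ I ∩ Ioo v w := fun s hs =>
      ⟨hI.out h1 htI ⟨hs.1.le, hs.2.le⟩, h2.1.trans hs.1, lt_of_lt_of_le hs.2 htw⟩
    refine closure_mono h3 ?_
    rw [closure_Ioo h.ne]; exact ⟨h.le, le_rfl⟩

/-- `E` is a path in `L` over `[v, w]`, and no path in `L` can leave it at a time in `(v, w)`. -/
structure IsStrand (L : Set Point) (v w : ℝ) (E : ℝ → ℝ × ℝ) : Prop where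
  lt : v < w
  path : PathIn L (Icc v w) E
  eventually_eq : ∀ (I : Set ℝ) (γ : ℝ → ℝ × ℝ), I.OrdConnected → PathIn L I γ →
    ∀ t ∈ I, t ∈ Ioo v w → γ t = E t → ∀ᶠ s in 𝓝[I] t, γ s = E s

/-- Rigidity of strands: agreement spreads along the open interval by connectedness and reaches the
ends by continuity. Nearly all later identifications of paths rest on this. -/
theorem IsStrand.eqOn {L : Set Point} {v w : ℝ} {E : ℝ → ℝ × ℝ} (h : IsStrand L v w E)
    {I : Set ℝ} {γ : ℝ → ℝ × ℝ} (hI : I.OrdConnected) (hγ : PathIn L I γ) {t₀ : ℝ} (h1 : t₀ ∈ I)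
    (h2 : t₀ ∈ Ioo v w) (h3 : γ t₀ = E t₀) : EqOn γ E (I ∩ Icc v w) := by
  have hJ : (I ∩ Ioo v w).OrdConnected := hI.inter ordConnected_Ioo
  have hsub : I ∩ Ioo v w ⊆ I ∩ Icc v w := inter_subset_inter_right _ Ioo_subset_Icc_self
  have hγc : ContinuousOn γ (I ∩ Icc v w) := hγ.cont.mono inter_subset_left
  have hEc : ContinuousOn E (I ∩ Icc v w) := h.path.cont.mono inter_subset_right
  refine EqOn.of_subset_closure ?_ hγc hEc hsub (inter_Icc_subset_closure hI h1 h2)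
  refine eqOn_of_eventually hJ.isPreconnected (hγc.mono hsub) (hEc.mono hsub) ⟨h1, h2⟩ h3 ?_
  rintro t ⟨ht1, ht2⟩ ht3
  exact (h.eventually_eq I γ hI hγ t ht1 ht2 ht3).filter_mono (nhdsWithin_mono _ inter_subset_left)

/-- A path `e` over `[a, b]` that leaves `S` at time `a`, returns at time `b`, and whose two end
points are joined by a path in `S`. -/
structure IsEar (S : Set Point) (a b : ℝ) (e : ℝ → ℝ × ℝ) : Prop where
  lt : a < b
  cont : ContinuousOn e (Icc a b)
  left_mem : (a, e a) ∈ S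
  right_mem : (b, e b) ∈ S
  not_mem : ∀ t ∈ Ioo a b, (t, e t) ∉ S
  joined : ∃ ρ, PathIn S (Icc a b) ρ ∧ ρ a = e a ∧ ρ b = e b

/-- At interior times the ear lies in the open complement of `S`, so a continuous path in `S ∪ e`
that is on the ear cannot move into `S` at once. -/
theorem IsEar.isStrand {S : Set Point} (hS : IsClosed S) {a b : ℝ} {e : ℝ → ℝ × ℝ}
    (h : IsEar S a b e) : IsStrand (S ∪ seg e (Icc a b)) a b e := by
  refine ⟨h.lt, ⟨h.cont, fun t ht => Or.inr (mk_mem_seg ht)⟩, ?_⟩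
  intro I γ _ hγ t htI hta hte
  have hc : Tendsto (fun s => (s, γ s)) (𝓝[I] t) (𝓝 (t, γ t)) :=
    (continuousWithinAt_id.prodMk (hγ.cont t htI))
  have hn : (t, γ t) ∈ Sᶜ := by rw [hte]; exact h.not_mem t hta
  filter_upwards [hc (hS.isOpen_compl.mem_nhds hn), self_mem_nhdsWithin] with s hs hsI
  rcases hγ.mem s hsI with h1 | h1
  · exact (hs h1).elim
  · exact h1.2

/-- `L` is a retract of `S` by a map that preserves the times. -/
def IsTimeRetract (S L : Set Point) : Prop :=
  L ⊆ S ∧ ∃ r : Point → Point, ContinuousOn r S ∧ (∀ p ∈ S, r p ∈ L) ∧ (∀ p ∈ S, (r p).1 = p.1) ∧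
    ∀ p ∈ L, r p = p

theorem IsTimeRetract.refl (S : Set Point) : IsTimeRetract S S :=
  ⟨Subset.rfl, id, continuousOn_id, fun _ h => h, fun _ _ => rfl, fun _ _ => rfl⟩

theorem IsTimeRetract.trans {S L K : Set Point} (h : IsTimeRetract S L) (h' : IsTimeRetract L K) :
    IsTimeRetract S K := by
  obtain ⟨hs, r, h1, h2, h3, h4⟩ := h
  obtain ⟨hs', r', h1', h2', h3', h4'⟩ := h'
  refine ⟨hs'.trans hs, r' ∘ r, h1'.comp h1 h2, fun p hp => h2' _ (h2 p hp), fun p hp => ?_,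
    fun p hp => ?_⟩
  · exact (h3' _ (h2 p hp)).trans (h3 p hp)
  · simp only [Function.comp]
    rw [h4 p (hs' hp), h4' p hp]

theorem IsTimeRetract.subset_left {S S' L : Set Point} (h : IsTimeRetract S L) (h1 : S' ⊆ S)
    (h2 : L ⊆ S') : IsTimeRetract S' L := by
  obtain ⟨_, r, a, b, c, d⟩ := h
  exact ⟨h2, r, a.mono h1, fun p hp => b p (h1 hp), fun p hp => c p (h1 hp), d⟩

theorem PathIn.map {S L : Set Point} {r : Point → Point} (hr : ContinuousOn r S)
    (hm : ∀ p ∈ S, r p ∈ L) (ht : ∀ p ∈ S, (r p).1 = p.1) {I : Set ℝ} {f : ℝ → ℝ × ℝ}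
    (hf : PathIn S I f) : PathIn L I (fun t => (r (t, f t)).2) := by
  refine ⟨?_, fun t h => ?_⟩
  · exact continuous_snd.comp_continuousOn
      (hr.comp (continuousOn_id.prodMk hf.cont) (fun t h => hf.mem t h))
  · have h1 := hm _ (hf.mem t h)
    have h2 := ht _ (hf.mem t h)
    have h3 : (t, (r (t, f t)).2) = r (t, f t) := Prod.ext h2.symm rfl
    rw [h3]; exact h1

/-- A retract is the set of fixed points of its retraction. -/
theorem IsTimeRetract.isClosed {S L : Set Point} (h : IsTimeRetract S L) (hS : IsClosed S) :
    IsClosed L := by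
  obtain ⟨hs, r, h1, h2, h3, h4⟩ := h
  have : L = S ∩ (fun p => (r p, p)) ⁻¹' diagonal Point := by
    ext p
    constructor
    · intro hp; exact ⟨hs hp, h4 p hp⟩
    · rintro ⟨hp, hq⟩
      have : r p = p := hq
      rw [← this]; exact h2 p hp
  rw [this]
  exact (h1.prodMk continuousOn_id).preimage_isClosed_of_isClosed hS isClosed_diagonal

open Classical in
/-- The map that moves the points of the graph of `g` over `J` to the graph of `π`. -/
noncomputable def shift (J : Set ℝ) (g π : ℝ → ℝ × ℝ) (p : Point) : Point :=
  if p ∈ seg g J then (p.1, π p.1) else p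

theorem shift_fst (J : Set ℝ) (g π : ℝ → ℝ × ℝ) (p : Point) : (shift J g π p).1 = p.1 := by
  unfold shift; split_ifs <;> rfl

theorem shift_of_mem {J : Set ℝ} {g : ℝ → ℝ × ℝ} (π : ℝ → ℝ × ℝ) {p : Point} (h : p ∈ seg g J) :
    shift J g π p = (p.1, π p.1) := if_pos h

theorem shift_of_mem_of_not_mem {S : Set Point} {a b : ℝ} {g π : ℝ → ℝ × ℝ}
    (hn : ∀ t ∈ Ioo a b, (t, g t) ∉ S) (ha : π a = g a) (hb : π b = g b) {p : Point} (hp : p ∈ S) :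
    shift (Icc a b) g π p = p := by
  unfold shift
  split_ifs with h
  · obtain ⟨t, x⟩ := p
    obtain ⟨⟨h1, h2⟩, h3⟩ := h
    simp only at h1 h2 h3
    subst h3
    rcases h1.eq_or_lt with h4 | h4
    · subst h4; simp [ha]
    rcases h2.eq_or_lt with h5 | h5
    · subst h5; simp [hb]
    exact (hn t ⟨h4, h5⟩ hp).elim
  · rfl

/-- The map is the identity on `S` and depends on the time alone on the graph of `g`. These are two
closed sets that meet at most at the ends of `g`, where `π` and `g` agree. -/
theorem continuousOn_shift {S : Set Point} (hS : IsClosed S) {a b : ℝ} {g π : ℝ → ℝ × ℝ}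
    (hn : ∀ t ∈ Ioo a b, (t, g t) ∉ S) (ha : π a = g a) (hb : π b = g b)
    (hg : ContinuousOn g (Icc a b)) (hπ : ContinuousOn π (Icc a b)) :
    ContinuousOn (shift (Icc a b) g π) (S ∪ seg g (Icc a b)) := by
  refine ContinuousOn.union_of_isClosed ?_ ?_ hS (isClosed_seg isClosed_Icc hg)
  · exact continuousOn_id.congr fun p hp => shift_of_mem_of_not_mem hn ha hb hp
  · have h1 : ContinuousOn (fun p : Point => (p.1, π p.1)) (seg g (Icc a b)) :=
      continuous_fst.continuousOn.prodMk
        (hπ.comp continuous_fst.continuousOn (fun p hp => hp.1))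
    exact h1.congr fun p hp => shift_of_mem π hp

/-- The ear slides, at constant times, onto the path that joins its ends in `S`. -/
theorem IsEar.isTimeRetract {S : Set Point} (hS : IsClosed S) {a b : ℝ} {e : ℝ → ℝ × ℝ}
    (h : IsEar S a b e) : IsTimeRetract (S ∪ seg e (Icc a b)) S := by
  obtain ⟨ρ, h1, h2, h3⟩ := h.joined
  refine ⟨subset_union_left, shift (Icc a b) e ρ, continuousOn_shift hS h.not_mem h2 h3 h.cont h1.cont,
    ?_, fun p _ => shift_fst _ _ _ _, fun p hp => shift_of_mem_of_not_mem h.not_mem h2 h3 hp⟩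
  rintro p (hp | hp)
  · rw [shift_of_mem_of_not_mem h.not_mem h2 h3 hp]; exact hp
  · rw [shift_of_mem ρ hp]; exact h1.mem _ hp.1

/-! ### Sequences of sets that grow by ears -/

/-- `S 0` is the graph of a continuous function over `D`, and each further set arises from the one
before by adding at most one ear. -/
structure IsEarSeq (D : Set ℝ) (S : ℕ → Set Point) : Prop where
  closed : IsClosed D
  ordConnected : D.OrdConnected
  base : ∃ σ, ContinuousOn σ D ∧ S 0 = seg σ D
  step : ∀ n, S (n + 1) = S n ∨ ∃ a b e, a ∈ D ∧ b ∈ D ∧ IsEar (S n) a b e ∧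
    S (n + 1) = S n ∪ seg e (Icc a b)

namespace IsEarSeq

variable {D : Set ℝ} {S : ℕ → Set Point}

theorem subset_succ (h : IsEarSeq D S) (n : ℕ) : S n ⊆ S (n + 1) := by
  rcases h.step n with h1 | ⟨a, b, e, _, _, _, h1⟩ <;> rw [h1]
  exact subset_union_left

theorem mono (h : IsEarSeq D S) : Monotone S := monotone_nat_of_le_succ h.subset_succ

theorem isClosed (h : IsEarSeq D S) (n : ℕ) : IsClosed (S n) := by
  induction n with
  | zero => obtain ⟨σ, h1, h2⟩ := h.base; rw [h2]; exact isClosed_seg h.closed h1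
  | succ n ih =>
    rcases h.step n with h1 | ⟨a, b, e, _, _, he, h1⟩ <;> rw [h1]
    · exact ih
    · exact ih.union (isClosed_seg isClosed_Icc he.cont)

theorem isTimeRetract_succ (h : IsEarSeq D S) (n : ℕ) : IsTimeRetract (S (n + 1)) (S n) := by
  rcases h.step n with h1 | ⟨a, b, e, _, _, he, h1⟩ <;> rw [h1]
  · exact .refl _
  · exact he.isTimeRetract (h.isClosed n)

theorem isTimeRetract (h : IsEarSeq D S) {m n : ℕ} (hmn : m ≤ n) : IsTimeRetract (S n) (S m) := by
  induction n, hmn using Nat.le_induction with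
  | base => exact .refl _
  | succ n _ ih => exact (h.isTimeRetract_succ n).trans ih

/-- For a point of a new ear: follow an old full path to the left end, then the ear, then an old
full path from the right end on. -/
theorem exists_path (h : IsEarSeq D S) (n : ℕ) {p : Point} (hp : p ∈ S n) :
    p.1 ∈ D ∧ ∃ σ, PathIn (S n) D σ ∧ σ p.1 = p.2 := by
  induction n generalizing p with
  | zero =>
    obtain ⟨σ, h1, h2⟩ := h.base
    rw [h2] at hp ⊢
    exact ⟨hp.1, σ, pathIn_seg h1, hp.2.symm⟩
  | succ n ih =>
    rcases h.step n with h1 | ⟨a, b, e, haD, hbD, he, h1⟩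
    · rw [h1] at hp ⊢; exact ih hp
    rw [h1] at hp ⊢
    rcases hp with hp | hp
    · obtain ⟨h2, σ, h3, h4⟩ := ih hp
      exact ⟨h2, σ, h3.mono subset_union_left Subset.rfl, h4⟩
    obtain ⟨_, σa, ha, ha'⟩ := ih he.left_mem
    obtain ⟨_, σb, hb, hb'⟩ := ih he.right_mem
    refine ⟨h.ordConnected.out haD hbD hp.1, glue a σa (glue b e σb), ?_, ?_⟩
    · refine PathIn.glue (ha.mono subset_union_left inter_subset_left) ?_ ?_
      · refine PathIn.glue ⟨he.cont.mono ?_, fun t ht => ?_⟩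
          (hb.mono subset_union_left (fun t ht => ht.1.1)) hb'.symm
        · rintro t ⟨⟨_, h1⟩, h2⟩; exact ⟨h1, h2⟩
        · exact Or.inr (mk_mem_seg ⟨ht.1.2, ht.2⟩)
      · rw [glue_le _ _ he.lt.le]; exact ha'
    · rw [glue_ge (by rw [glue_le _ _ he.lt.le]; exact ha') hp.1.1, glue_le _ _ hp.1.2]
      exact hp.2.symm

end IsEarSeq

/-! ### Conditional independence of σ-algebras -/

section CondIndepOf

variable {Ω : Type*}

theorem sup_eq_generateFrom_inter (m₁ m₂ : MeasurableSpace Ω) :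
    m₁ ⊔ m₂ = MeasurableSpace.generateFrom
      {u | ∃ s t, MeasurableSet[m₁] s ∧ MeasurableSet[m₂] t ∧ u = s ∩ t} := by
  apply le_antisymm
  · refine sup_le (fun s hs => ?_) (fun t ht => ?_)
    · exact MeasurableSpace.measurableSet_generateFrom ⟨s, univ, hs, MeasurableSet.univ, by simp⟩
    · exact MeasurableSpace.measurableSet_generateFrom ⟨univ, t, MeasurableSet.univ, ht, by simp⟩
  · refine MeasurableSpace.generateFrom_le ?_
    rintro u ⟨s, t, hs, ht, rfl⟩
    have h1 : MeasurableSet[m₁ ⊔ m₂] s := (le_sup_left : m₁ ≤ m₁ ⊔ m₂) s hs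
    have h2 : MeasurableSet[m₁ ⊔ m₂] t := (le_sup_right : m₂ ≤ m₁ ⊔ m₂) t ht
    exact h1.inter h2

/-- The sets `s ∩ t` form a π-system that generates the join, so equality of integrals extends from
them to the whole join. -/
theorem ae_eq_condExp_sup {m₁ m₂ : MeasurableSpace Ω} {m0 : MeasurableSpace Ω} {P : Measure Ω}
    [IsFiniteMeasure P] (h₁ : m₁ ≤ m0) (h₂ : m₂ ≤ m0) {f g : Ω → ℝ} (hf : Integrable f P)
    (hg : Integrable g P) (hgm : AEStronglyMeasurable[m₁ ⊔ m₂] g P)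
    (h : ∀ s t, MeasurableSet[m₁] s → MeasurableSet[m₂] t →
      ∫ ω in s ∩ t, g ω ∂P = ∫ ω in s ∩ t, f ω ∂P) :
    g =ᵐ[P] P[f | m₁ ⊔ m₂] := by
  have hle : m₁ ⊔ m₂ ≤ m0 := sup_le h₁ h₂
  refine ae_eq_condExp_of_forall_setIntegral_eq hle hf (fun s _ _ => hg.integrableOn) ?_ hgm
  intro s hs _
  induction s, hs using MeasurableSpace.induction_on_inter (sup_eq_generateFrom_inter m₁ m₂) with
  | h_inter =>
    rintro _ ⟨s, t, hs, ht, rfl⟩ _ ⟨s', t', hs', ht', rfl⟩ _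
    exact ⟨s ∩ s', t ∩ t', hs.inter hs', ht.inter ht', inter_inter_inter_comm s t s' t'⟩
  | empty => simp
  | basic u hu =>
    obtain ⟨s, t, hs, ht, rfl⟩ := hu
    exact h s t hs ht
  | compl u hu ih =>
    have ih := ih (measure_lt_top _ _)
    -- The whole space is one of the sets `s ∩ t`; equality of the total integrals is what handles
    -- complements.
    have h0 := h univ univ MeasurableSet.univ MeasurableSet.univ
    simp only [inter_self, setIntegral_univ] at h0
    have e1 := integral_add_compl (hle u hu) hf
    have e2 := integral_add_compl (hle u hu) hg
    linarith
  | iUnion u hd hu ih =>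
    rw [integral_iUnion (fun i => hle _ (hu i)) hd hg.integrableOn,
      integral_iUnion (fun i => hle _ (hu i)) hd hf.integrableOn]
    exact tsum_congr fun i => ih i (measure_lt_top _ _)

/-- The σ-algebras `m₁` and `m₂` are conditionally independent given `m`: the conditional
probabilities of the events in `m₁` given `m` do not change if `m₂` is given as well. -/
def CondIndepOf {m0 : MeasurableSpace Ω} (P : Measure Ω) (m₁ m₂ m : MeasurableSpace Ω) : Prop :=
  ∀ C, MeasurableSet[m₁] C → P⟦C | m ⊔ m₂⟧ =ᵐ[P] P⟦C | m⟧

theorem integrable_indicator_one {m0 : MeasurableSpace Ω} (P : Measure Ω) [IsFiniteMeasure P]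
    {C : Set Ω} (hC : MeasurableSet C) : Integrable (C.indicator fun _ => (1 : ℝ)) P :=
  (integrable_const 1).indicator hC

theorem indicator_inter_one (C D : Set Ω) : (C ∩ D).indicator (fun _ => (1 : ℝ)) =
    C.indicator (fun _ => (1 : ℝ)) * D.indicator (fun _ => (1 : ℝ)) := by
  ext ω
  by_cases h1 : ω ∈ C <;> by_cases h2 : ω ∈ D <;> simp [h1, h2]

theorem setIntegral_inter_eq {m0 : MeasurableSpace Ω} (P : Measure Ω) {s t : Set Ω}
    (ht : MeasurableSet t) (f : Ω → ℝ) :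
    ∫ ω in s ∩ t, f ω ∂P = ∫ ω in s, (t.indicator (fun _ => (1 : ℝ)) * f) ω ∂P := by
  have : (t.indicator (fun _ => (1 : ℝ)) * f) = t.indicator f := by
    ext ω; by_cases h : ω ∈ t <;> simp [h]
  rw [this, setIntegral_indicator ht]

theorem integrable_indicator_one_mul {m0 : MeasurableSpace Ω} {P : Measure Ω} {f : Ω → ℝ}
    (hf : Integrable f P) {C : Set Ω} (hC : MeasurableSet C) :
    Integrable (C.indicator (fun _ => (1 : ℝ)) * f) P := by
  have : (C.indicator (fun _ => (1 : ℝ)) * f) = C.indicator f := by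
    ext ω; by_cases h : ω ∈ C <;> simp [h]
  rw [this]; exact hf.indicator hC

/-- By `ae_eq_condExp_sup` it suffices to integrate `P⟦C | m⟧` over `Z ∩ D` with `Z` in `m` and `D`
in `m₂`. Conditioning on `m` turns the indicator of `D` into `P⟦D | m⟧`, and the product formula
applies. -/
theorem CondIndepOf.of_mul {m₁ m₂ m m0 : MeasurableSpace Ω} {P : Measure Ω} [IsFiniteMeasure P]
    (h₁ : m₁ ≤ m0) (h₂ : m₂ ≤ m0) (hm : m ≤ m0)
    (h : ∀ C D, MeasurableSet[m₁] C → MeasurableSet[m₂] D →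
      P⟦C ∩ D | m⟧ =ᵐ[P] P⟦C | m⟧ * P⟦D | m⟧) : CondIndepOf P m₁ m₂ m := by
  intro C hC
  symm
  have iC := integrable_indicator_one P (h₁ C hC)
  refine ae_eq_condExp_sup (g := P⟦C | m⟧) hm h₂ iC integrable_condExp ?_ ?_
  · have hs : StronglyMeasurable[m ⊔ m₂] (P⟦C | m⟧) := stronglyMeasurable_condExp.mono le_sup_left
    exact hs.aestronglyMeasurable
  intro Z D hZ hD
  have iD := integrable_indicator_one P (h₂ D hD)
  have i1 : Integrable (D.indicator (fun _ => (1 : ℝ)) * P⟦C | m⟧) P :=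
    integrable_indicator_one_mul integrable_condExp (h₂ D hD)
  rw [setIntegral_inter_eq P (h₂ D hD), setIntegral_inter_eq P (h₂ D hD),
    ← indicator_inter_one, ← setIntegral_condExp hm i1 hZ,
    ← setIntegral_condExp hm (integrable_indicator_one P ((h₂ D hD).inter (h₁ C hC))) hZ]
  refine setIntegral_congr_ae (hm Z hZ) ?_
  have e1 := condExp_mul_of_stronglyMeasurable_right (stronglyMeasurable_condExp (μ := P)
    (f := C.indicator fun _ => (1 : ℝ)) (m := m)) i1 iD
  have e2 := h C D hC hD
  rw [inter_comm] at e2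
  filter_upwards [e1, e2] with ω h1 h2 _
  rw [h1, h2, mul_comm]

/-- Condition first on `m ⊔ m₂`, where the indicator of `D` factors out, and then on `m`. -/
theorem CondIndepOf.mul {m₁ m₂ m m0 : MeasurableSpace Ω} {P : Measure Ω} [IsFiniteMeasure P]
    (h₁ : m₁ ≤ m0) (h₂ : m₂ ≤ m0) (hm : m ≤ m0) (h : CondIndepOf P m₁ m₂ m) {C D : Set Ω}
    (hC : MeasurableSet[m₁] C) (hD : MeasurableSet[m₂] D) :
    P⟦C ∩ D | m⟧ =ᵐ[P] P⟦C | m⟧ * P⟦D | m⟧ := by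
  have hle : m ⊔ m₂ ≤ m0 := sup_le hm h₂
  have iC := integrable_indicator_one P (h₁ C hC)
  have iD := integrable_indicator_one P (h₂ D hD)
  have sD : StronglyMeasurable[m ⊔ m₂] (D.indicator fun _ => (1 : ℝ)) :=
    (stronglyMeasurable_const.indicator ((le_sup_right : m₂ ≤ m ⊔ m₂) D hD))
  have e1 : P⟦C ∩ D | m ⊔ m₂⟧ =ᵐ[P] D.indicator (fun _ => (1 : ℝ)) * P⟦C | m ⊔ m₂⟧ := by
    rw [inter_comm, indicator_inter_one]
    exact condExp_mul_of_stronglyMeasurable_left sD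
      (integrable_indicator_one_mul iC (h₂ D hD)) iC
  have e2 : P⟦C ∩ D | m ⊔ m₂⟧ =ᵐ[P] D.indicator (fun _ => (1 : ℝ)) * P⟦C | m⟧ := by
    filter_upwards [e1, h C hC] with ω a b
    rw [a, Pi.mul_apply, Pi.mul_apply, b]
  have e3 := (condExp_condExp_of_le (μ := P) (f := (C ∩ D).indicator fun _ => (1 : ℝ))
    (le_sup_left : m ≤ m ⊔ m₂) hle).symm.trans (condExp_congr_ae (m := m) e2)
  have e4 := condExp_mul_of_stronglyMeasurable_right (stronglyMeasurable_condExp (μ := P)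
    (f := C.indicator fun _ => (1 : ℝ)) (m := m))
    (integrable_indicator_one_mul integrable_condExp (h₂ D hD)) iD
  filter_upwards [e3, e4] with ω a b
  rw [a, b, Pi.mul_apply, Pi.mul_apply, mul_comm]

/-- The definition is one-sided, but the equivalent product formula is symmetric. -/
theorem CondIndepOf.symm {m₁ m₂ m m0 : MeasurableSpace Ω} {P : Measure Ω} [IsFiniteMeasure P]
    (h₁ : m₁ ≤ m0) (h₂ : m₂ ≤ m0) (hm : m ≤ m0) (h : CondIndepOf P m₁ m₂ m) :
    CondIndepOf P m₂ m₁ m := by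
  refine .of_mul h₂ h₁ hm fun D C hD hC => ?_
  have := h.mul h₁ h₂ hm hC hD
  rw [inter_comm, mul_comm]
  exact this

/-- By the tower property, since `P⟦C | m⟧` is already measurable for every `n` between `m` and `m ⊔
m₂`. -/
theorem CondIndepOf.condExp_eq {m₁ m₂ m m0 : MeasurableSpace Ω} {P : Measure Ω} [IsFiniteMeasure P]
    (h₂ : m₂ ≤ m0) (hm : m ≤ m0) (h : CondIndepOf P m₁ m₂ m)
    {n : MeasurableSpace Ω} (hn : m ≤ n) (hn' : n ≤ m ⊔ m₂) {C : Set Ω} (hC : MeasurableSet[m₁] C) :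
    P⟦C | n⟧ =ᵐ[P] P⟦C | m⟧ := by
  have hle : m ⊔ m₂ ≤ m0 := sup_le hm h₂
  have e1 := (condExp_condExp_of_le (μ := P) (f := C.indicator fun _ => (1 : ℝ)) hn' hle).symm
  refine e1.trans ((condExp_congr_ae (h C hC)).trans ?_)
  rw [condExp_of_stronglyMeasurable (hn'.trans hle) (stronglyMeasurable_condExp.mono hn)
    integrable_condExp]

theorem CondIndepOf.of_le {m₁ m₂ m m0 : MeasurableSpace Ω} {P : Measure Ω} [IsFiniteMeasure P]
    (h₂ : m₂ ≤ m0) (hm : m ≤ m0) (h : CondIndepOf P m₁ m₂ m)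
    {n n₂ : MeasurableSpace Ω} (hn : m ≤ n) (hn' : n ≤ m ⊔ m₂) (hn₂ : n₂ ≤ m ⊔ m₂) :
    CondIndepOf P m₁ n₂ n := fun _ hC =>
  (h.condExp_eq h₂ hm (hn.trans le_sup_left) (sup_le hn' hn₂) hC).trans
    (h.condExp_eq h₂ hm hn hn' hC).symm

/-- Both sides are reached in two steps, through `m ⊔ m₂`. Together with `of_le` and `symm` this is
the whole calculus of independence that is used below. -/
theorem CondIndepOf.contraction {m₁ m₂ m₃ m m0 : MeasurableSpace Ω} {P : Measure Ω}
    (h : CondIndepOf P m₁ m₂ m) (h' : CondIndepOf P m₁ m₃ (m ⊔ m₂)) :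
    CondIndepOf P m₁ (m₂ ⊔ m₃) m := by
  intro C hC
  have := h' C hC
  rw [sup_assoc] at this
  exact this.trans (h C hC)

end CondIndepOf

/-! ### Conditional independence of the parts of a process -/

section Ind

variable {Ω : Type*}

/-- The σ-algebra generated by the variables `Y p` for `p ∈ S`. -/
abbrev sigmaOn (Y : Point → Ω → ℝ) (S : Set Point) : MeasurableSpace Ω :=
  ⨆ p ∈ S, MeasurableSpace.comap (Y p) inferInstance

theorem sigmaOn_mono (Y : Point → Ω → ℝ) {S T : Set Point} (h : S ⊆ T) :
    sigmaOn Y S ≤ sigmaOn Y T :=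
  biSup_mono h

theorem sigmaOn_union (Y : Point → Ω → ℝ) (S T : Set Point) :
    sigmaOn Y (S ∪ T) = sigmaOn Y S ⊔ sigmaOn Y T := iSup_union

theorem sigmaOn_le [m0 : MeasurableSpace Ω] {Y : Point → Ω → ℝ} (hY : ∀ p, Measurable (Y p))
    (S : Set Point) : sigmaOn Y S ≤ m0 :=
  iSup₂_le fun p _ => (hY p).comap_le

/-- The parts of the process `Y` on `A` and on `B` are conditionally independent given the part
on `Z`. -/
def Ind [MeasurableSpace Ω] (P : Measure Ω) (Y : Point → Ω → ℝ) (A B Z : Set Point) : Prop :=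
  CondIndepOf P (sigmaOn Y A) (sigmaOn Y B) (sigmaOn Y Z)

variable [MeasurableSpace Ω] {P : Measure Ω} {Y : Point → Ω → ℝ}
  {A B C Z Z' A' B' : Set Point}

theorem Ind.symm [IsFiniteMeasure P] (hY : ∀ p, Measurable (Y p)) (h : Ind P Y A B Z) : Ind P Y B A Z :=
  CondIndepOf.symm (sigmaOn_le hY _) (sigmaOn_le hY _) (sigmaOn_le hY _) h

/-- Weak union and decomposition in one rule: a part of `B` may be moved into the condition, and any
part of what remains may be dropped or shared with the condition. -/
theorem Ind.right [IsFiniteMeasure P] (hY : ∀ p, Measurable (Y p)) (h : Ind P Y A B Z) (h1 : Z ⊆ Z')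
    (h2 : Z' ⊆ Z ∪ B) (h3 : B' ⊆ Z ∪ B) : Ind P Y A B' Z' := by
  refine CondIndepOf.of_le (sigmaOn_le hY _) (sigmaOn_le hY _) h (sigmaOn_mono Y h1) ?_ ?_
  · rw [← sigmaOn_union]; exact sigmaOn_mono Y h2
  · rw [← sigmaOn_union]; exact sigmaOn_mono Y h3

theorem Ind.left [IsFiniteMeasure P] (hY : ∀ p, Measurable (Y p)) (h : Ind P Y A B Z) (h1 : Z ⊆ Z')
    (h2 : Z' ⊆ Z ∪ A) (h3 : A' ⊆ Z ∪ A) : Ind P Y A' B Z' :=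
  ((h.symm hY).right hY h1 h2 h3).symm hY

theorem Ind.contraction (h : Ind P Y A B Z) (h' : Ind P Y A C (Z ∪ B)) :
    Ind P Y A (B ∪ C) Z := by
  unfold Ind at h' ⊢
  rw [sigmaOn_union] at h' ⊢
  exact CondIndepOf.contraction h h'

theorem ind_of_subset (h : B ⊆ Z) : Ind P Y A B Z := by
  intro C _
  rw [sup_of_le_left (sigmaOn_mono Y h)]

end Ind

/-! ### Replacing an ear in a time retract -/

/-- `r` maps `S` to `L`, preserves the times, and fixes the points of `L`. -/
structure IsTimeRetraction (r : Point → Point) (S L : Set Point) : Prop where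
  subset : L ⊆ S
  cont : ContinuousOn r S
  mem : ∀ p ∈ S, r p ∈ L
  fst : ∀ p ∈ S, (r p).1 = p.1
  eq : ∀ p ∈ L, r p = p

theorem IsTimeRetract.exists_retraction {S L : Set Point} (h : IsTimeRetract S L) :
    ∃ r, IsTimeRetraction r S L :=
  let ⟨h0, r, h1, h2, h3, h4⟩ := h
  ⟨r, h0, h1, h2, h3, h4⟩

/-- The image of the path `f` under the time-preserving map `r`. -/
def mapPath (r : Point → Point) (f : ℝ → ℝ × ℝ) : ℝ → ℝ × ℝ := fun t => (r (t, f t)).2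

theorem IsTimeRetraction.mk_mapPath {r : Point → Point} {S L : Set Point}
    (h : IsTimeRetraction r S L) {f : ℝ → ℝ × ℝ} {t : ℝ} (ht : (t, f t) ∈ S) :
    (t, mapPath r f t) = r (t, f t) :=
  Prod.ext (h.fst _ ht).symm rfl

theorem IsTimeRetraction.mapPath_eq {r : Point → Point} {S L : Set Point}
    (h : IsTimeRetraction r S L) {f : ℝ → ℝ × ℝ} {t : ℝ} (ht : (t, f t) ∈ L) :
    mapPath r f t = f t := by
  unfold mapPath; rw [h.eq _ ht]

theorem IsTimeRetraction.pathIn {r : Point → Point} {S L : Set Point}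
    (h : IsTimeRetraction r S L) {I : Set ℝ} {f : ℝ → ℝ × ℝ} (hf : PathIn S I f) :
    PathIn L I (mapPath r f) :=
  hf.map h.cont h.mem h.fst

theorem mem_Ioo_of_not_mem {S : Set Point} {a b : ℝ} {g : ℝ → ℝ × ℝ} (hg : IsEar S a b g) {t : ℝ}
    (ht : t ∈ Icc a b) (hn : (t, g t) ∉ S) : t ∈ Ioo a b := by
  refine ⟨lt_of_le_of_ne ht.1 ?_, lt_of_le_of_ne ht.2 ?_⟩
  · rintro rfl; exact hn hg.left_mem
  · rintro rfl; exact hn hg.right_mem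

/-- The ear `g`, attached to `S`, of a retract `L` of `S ∪ g` can be replaced by a path `π` in `S`,
which either runs in `L` or is mapped to `g` by the retraction. -/
theorem exists_replacement {S L : Set Point} (hS : IsClosed S) {a b : ℝ} {g : ℝ → ℝ × ℝ}
    (hg : IsEar S a b g) {r : Point → Point} (hr : IsTimeRetraction r (S ∪ seg g (Icc a b)) L)
    (ha : (a, g a) ∈ L) (hb : (b, g b) ∈ L) :
    ∃ π, PathIn S (Icc a b) π ∧ π a = g a ∧ π b = g b ∧
      ((∀ t ∈ Icc a b, (t, π t) ∈ L) ∨ ∀ t ∈ Icc a b, r (t, π t) = (t, g t)) := by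
  obtain ⟨π, h1, h2, h3⟩ := hg.joined
  have hsub : S ⊆ S ∪ seg g (Icc a b) := subset_union_left
  have hπ' := hr.pathIn (h1.mono hsub Subset.rfl)
  -- The joining path is projected to `L`. If the image stays in `S`, it is the replacement.
  -- Otherwise it meets the ear at an interior time, and by rigidity the image is the entire ear.
  by_cases h : ∀ t ∈ Icc a b, (t, mapPath r π t) ∈ S
  · refine ⟨mapPath r π, ⟨hπ'.cont, h⟩, ?_, ?_, Or.inl hπ'.mem⟩
    · rw [hr.mapPath_eq (by rw [h2]; exact ha), h2]
    · rw [hr.mapPath_eq (by rw [h3]; exact hb), h3]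
  · push Not at h
    obtain ⟨t, ht, hn⟩ := h
    refine ⟨π, h1, h2, h3, Or.inr fun s hs => ?_⟩
    have h4 : (t, mapPath r π t) ∈ seg g (Icc a b) := by
      rcases hr.subset (hπ'.mem t ht) with h | h
      · exact (hn h).elim
      · exact h
    have h5 : mapPath r π t = g t := h4.2
    have h6 := (hg.isStrand hS).eqOn ordConnected_Icc (hπ'.mono hr.subset Subset.rfl) ht
      (mem_Ioo_of_not_mem hg ht (by rw [← h5]; exact hn)) h5
    rw [← hr.mk_mapPath (hsub (h1.mem s hs)), h6 ⟨hs, hs⟩]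

/-- The data of an ear `g` of `S`, of a retraction `r` of `S ∪ g` onto a set `L` that contains the
ear, and of a path `π` in `S` that replaces the ear. -/
structure Replacement (S L : Set Point) (a b : ℝ) (g π : ℝ → ℝ × ℝ) (r : Point → Point) :
    Prop where
  closed : IsClosed S
  ear : IsEar S a b g
  retraction : IsTimeRetraction r (S ∪ seg g (Icc a b)) L
  seg_subset : seg g (Icc a b) ⊆ L
  path : PathIn S (Icc a b) π
  left : π a = g a
  right : π b = g b
  cases : (∀ t ∈ Icc a b, (t, π t) ∈ L) ∨ ∀ t ∈ Icc a b, r (t, π t) = (t, g t)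

namespace Replacement

variable {S L : Set Point} {a b : ℝ} {g π : ℝ → ℝ × ℝ} {r : Point → Point}

theorem shift_eq (h : Replacement S L a b g π r) {p : Point} (hp : p ∈ S) :
    shift (Icc a b) g π p = p :=
  shift_of_mem_of_not_mem h.ear.not_mem h.left h.right hp

theorem mem_seg_of_not_mem (h : Replacement S L a b g π r) {p : Point} (hp : p ∈ L) (hn : p ∉ S) :
    p.1 ∈ Ioo a b ∧ p.2 = g p.1 := by
  rcases h.retraction.subset hp with h1 | h1
  · exact (hn h1).elim
  · have h2 : p = (p.1, g p.1) := Prod.ext rfl h1.2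
    refine ⟨mem_Ioo_of_not_mem h.ear h1.1 ?_, h1.2⟩
    rw [← h2]; exact hn

theorem left_mem (h : Replacement S L a b g π r) : (a, g a) ∈ L :=
  h.seg_subset (mk_mem_seg ⟨le_rfl, h.ear.lt.le⟩)

theorem right_mem (h : Replacement S L a b g π r) : (b, g b) ∈ L :=
  h.seg_subset (mk_mem_seg ⟨h.ear.lt.le, le_rfl⟩)

theorem subset_union (h : Replacement S L a b g π r) : L ∩ S ∪ seg π (Icc a b) ⊆ S :=
  union_subset inter_subset_right h.path.seg_subset

/-- On `L ∩ S` both maps are the identity. If `π` is not in `L`, then `r` sends it to the ear and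
the shift sends it back. -/
theorem shift_retraction_eq (h : Replacement S L a b g π r) {p : Point}
    (hp : p ∈ L ∩ S ∪ seg π (Icc a b)) : shift (Icc a b) g π (r p) = p := by
  have hL : ∀ p ∈ L ∩ S, shift (Icc a b) g π (r p) = p := fun p hp => by
    rw [h.retraction.eq p hp.1, h.shift_eq hp.2]
  rcases hp with hp | hp
  · exact hL p hp
  · obtain ⟨t, x⟩ := p
    obtain ⟨h1, h2⟩ := hp
    simp only at h1 h2
    subst h2
    rcases h.cases with hc | hc
    · exact hL _ ⟨hc t h1, h.path.mem t h1⟩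
    · rw [hc t h1, shift_of_mem π (mk_mem_seg h1)]

/-- The retraction is `r`, followed by moving the ear to `π`. -/
theorem isTimeRetract (h : Replacement S L a b g π r) :
    IsTimeRetract S (L ∩ S ∪ seg π (Icc a b)) := by
  have hsub : S ⊆ S ∪ seg g (Icc a b) := subset_union_left
  refine ⟨h.subset_union, fun p => shift (Icc a b) g π (r p), ?_, fun p hp => ?_, fun p hp => ?_,
    fun p hp => h.shift_retraction_eq hp⟩
  · exact (continuousOn_shift h.closed h.ear.not_mem h.left h.right h.ear.cont h.path.cont).comp
      (h.retraction.cont.mono hsub) fun p hp => h.retraction.subset (h.retraction.mem p (hsub hp))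
  · have h1 := h.retraction.mem p (hsub hp)
    beta_reduce
    by_cases h2 : r p ∈ seg g (Icc a b)
    · rw [shift_of_mem π h2]; exact Or.inr (mk_mem_seg h2.1)
    · have h3 : r p ∈ S := (h.retraction.subset h1).resolve_right h2
      rw [h.shift_eq h3]; exact Or.inl ⟨h1, h3⟩
  · rw [shift_fst]; exact h.retraction.fst p (hsub hp)

/-- A strand of `L` that does not meet the ear is a strand of the modified set. -/
theorem isStrand (h : Replacement S L a b g π r) {v w : ℝ} {E : ℝ → ℝ × ℝ} (hE : IsStrand L v w E)
    (hES : ∀ t ∈ Icc v w, (t, E t) ∈ S) : IsStrand (L ∩ S ∪ seg π (Icc a b)) v w E := by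
  refine ⟨hE.lt, ⟨hE.path.cont, fun t ht => Or.inl ⟨hE.path.mem t ht, hES t ht⟩⟩, ?_⟩
  intro I γ hI hγ t htI ht hte
  have hγS : PathIn (S ∪ seg g (Icc a b)) I γ :=
    hγ.mono (h.subset_union.trans subset_union_left) Subset.rfl
  have h1 : mapPath r γ t = E t := by
    rw [h.retraction.mapPath_eq (by rw [hte]; exact hE.path.mem t (Ioo_subset_Icc_self ht)), hte]
  -- The image of `γ` is a path in `L`, so it follows `E` for a while; the shift recovers `γ` from
  -- its image and does not move `E`, which runs in `S`.
  have h2 := hE.eventually_eq I _ hI (h.retraction.pathIn hγS) t htI ht h1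
  filter_upwards [h2, self_mem_nhdsWithin, nhdsWithin_le_nhds (Ioo_mem_nhds ht.1 ht.2)]
    with s hs hsI hsv
  have h3 := h.shift_retraction_eq (hγ.mem s hsI)
  rw [← h.retraction.mk_mapPath (hγS.mem s hsI), hs,
    h.shift_eq (hES s (Ioo_subset_Icc_self hsv))] at h3
  exact (congrArg Prod.snd h3).symm

/-- The path `E`, with the ear `g` replaced by `π`. -/
noncomputable def patch (a b : ℝ) (π E : ℝ → ℝ × ℝ) (t : ℝ) : ℝ × ℝ :=
  open Classical in if t ∈ Icc a b then π t else E t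

theorem patch_of_mem {a b t : ℝ} (π E : ℝ → ℝ × ℝ) (h : t ∈ Icc a b) : patch a b π E t = π t :=
  if_pos h

theorem patch_of_not_mem {a b t : ℝ} (π E : ℝ → ℝ × ℝ) (h : t ∉ Icc a b) :
    patch a b π E t = E t := if_neg h

/-- If the strand `E` of `L` overlaps with the ear, and if `π` is mapped to the ear, then `π` takes
the place of the ear in the union of the two strands. -/
theorem isStrand_patch (h : Replacement S L a b g π r) (hc : ∀ t ∈ Icc a b, r (t, π t) = (t, g t))
    {v w : ℝ} {E : ℝ → ℝ × ℝ} (hE : IsStrand L v w E) {t₀ : ℝ} (ht₀ : t₀ ∈ Icc v w)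
    (ht₀' : t₀ ∈ Ioo a b) (hEg : EqOn E g (Icc v w ∩ Icc a b)) :
    IsStrand (L ∩ S ∪ seg π (Icc a b)) (min v a) (max w b) (patch a b π E) := by
  have hv := ht₀.1
  have hw := ht₀.2
  have ha := ht₀'.1
  have hb := ht₀'.2
  -- As `t₀` belongs to both intervals, their hull from `min v a` to `max w b` is their union. The
  -- same overlap gives `hin` for the open intervals.
  have hout : ∀ t ∈ Icc (min v a) (max w b), t ∉ Ioo a b → t ∈ Icc v w ∨ t = a ∨ t = b := by
    rintro t ⟨h1, h2⟩ h3
    by_cases h4 : a < t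
    · have h5 : b ≤ t := not_lt.1 fun h5 => h3 ⟨h4, h5⟩
      rcases h5.eq_or_lt with h6 | h6
      · exact Or.inr (Or.inr h6.symm)
      · rcases le_max_iff.1 h2 with h7 | h7
        · exact Or.inl ⟨by linarith, h7⟩
        · linarith
    · rcases (not_lt.1 h4).eq_or_lt with h6 | h6
      · exact Or.inr (Or.inl h6)
      · rcases min_le_iff.1 h1 with h7 | h7
        · exact Or.inl ⟨h7, by linarith⟩
        · linarith
  have hin : ∀ t ∈ Ioo (min v a) (max w b), t ∈ Ioo v w ∨ t ∈ Ioo a b := by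
    rintro t ⟨h1, h2⟩
    rcases min_lt_iff.1 h1 with h3 | h3 <;> rcases lt_max_iff.1 h2 with h4 | h4
    · exact Or.inl ⟨h3, h4⟩
    · by_cases h5 : a < t
      · exact Or.inr ⟨h5, h4⟩
      · exact Or.inl ⟨h3, by linarith⟩
    · by_cases h5 : v < t
      · exact Or.inl ⟨h5, h4⟩
      · exact Or.inr ⟨h3, by linarith⟩
    · exact Or.inr ⟨h3, h4⟩
  have hEL : ∀ t ∈ Icc v w, t ∉ Ioo a b → (t, E t) ∈ L ∩ S := by
    intro t ht hn
    refine ⟨hE.path.mem t ht, ?_⟩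
    by_contra hS
    exact hn (h.mem_seg_of_not_mem (hE.path.mem t ht) hS).1
  refine ⟨lt_of_le_of_lt (min_le_right _ _) (lt_of_lt_of_le h.ear.lt (le_max_right _ _)),
    ⟨?_, ?_⟩, ?_⟩
  · have h1 : ContinuousOn (patch a b π E) (Icc a b) :=
      h.path.cont.congr fun t ht => patch_of_mem π E ht
    have h2 : ContinuousOn (patch a b π E) (Icc v w ∩ (Ioo a b)ᶜ) := by
      refine (hE.path.cont.mono inter_subset_left).congr fun t ht => ?_
      by_cases h3 : t ∈ Icc a b
      · rw [patch_of_mem π E h3, hEg ⟨ht.1, h3⟩]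
        by_cases h4 : a < t
        · have h5 : t = b := le_antisymm h3.2 (not_lt.1 fun h5 => ht.2 ⟨h4, h5⟩)
          rw [h5, h.right]
        · have h5 : t = a := le_antisymm (not_lt.1 h4) h3.1
          rw [h5, h.left]
      · exact patch_of_not_mem π E h3
    refine (h1.union_of_isClosed h2 isClosed_Icc
      (isClosed_Icc.inter isOpen_Ioo.isClosed_compl)).mono ?_
    intro t ht
    by_cases h3 : t ∈ Icc a b
    · exact Or.inl h3
    · refine Or.inr ⟨?_, fun h4 => h3 (Ioo_subset_Icc_self h4)⟩
      rcases hout t ht (fun h4 => h3 (Ioo_subset_Icc_self h4)) with h4 | h4 | h4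
      · exact h4
      · exact (h3 ⟨h4.ge, by linarith⟩).elim
      · exact (h3 ⟨by linarith, h4.le⟩).elim
  · intro t ht
    by_cases h3 : t ∈ Icc a b
    · rw [patch_of_mem π E h3]; exact Or.inr (mk_mem_seg h3)
    · rw [patch_of_not_mem π E h3]
      have h5 : t ∉ Ioo a b := fun h4 => h3 (Ioo_subset_Icc_self h4)
      rcases hout t ht h5 with h4 | h4 | h4
      · exact Or.inl (hEL t h4 h5)
      · exact (h3 ⟨h4.ge, by linarith⟩).elim
      · exact (h3 ⟨by linarith, h4.le⟩).elim
  · intro I γ hI hγ t htI ht hte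
    have hγS : PathIn (S ∪ seg g (Icc a b)) I γ :=
      hγ.mono (h.subset_union.trans subset_union_left) Subset.rfl
    have hγ' := h.retraction.pathIn hγS
    -- The path `γ` is recovered from its image in `L`. That image is rigid at interior times of the
    -- strand `E` and at interior times of the ear, and each interior time of the hull is of one of
    -- these kinds.
    have hkey : ∀ s ∈ I, shift (Icc a b) g π (s, mapPath r γ s) = (s, γ s) := fun s hs => by
      rw [h.retraction.mk_mapPath (hγS.mem s hs)]
      exact h.shift_retraction_eq (hγ.mem s hs)
    have hg : t ∈ Icc a b → mapPath r γ t = g t := fun h1 => by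
      rw [patch_of_mem π E h1] at hte
      unfold mapPath
      rw [hte, hc t h1]
    rcases hin t ht with h1 | h1
    · have h2 : mapPath r γ t = E t := by
        by_cases h3 : t ∈ Icc a b
        · rw [hg h3, hEg ⟨Ioo_subset_Icc_self h1, h3⟩]
        · rw [patch_of_not_mem π E h3] at hte
          rw [h.retraction.mapPath_eq
            (by rw [hte]; exact hE.path.mem t (Ioo_subset_Icc_self h1)), hte]
      filter_upwards [hE.eventually_eq I _ hI hγ' t htI h1 h2, self_mem_nhdsWithin,
        nhdsWithin_le_nhds (Ioo_mem_nhds h1.1 h1.2)] with s hs hsI hsv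
      have h4 := hkey s hsI
      rw [hs] at h4
      have hsv' := Ioo_subset_Icc_self hsv
      by_cases h3 : s ∈ Icc a b
      · rw [shift_of_mem π (p := (s, E s)) ⟨h3, hEg ⟨hsv', h3⟩⟩] at h4
        rw [patch_of_mem π E h3]
        exact (congrArg Prod.snd h4).symm
      · rw [h.shift_eq (hEL s hsv' fun h5 => h3 (Ioo_subset_Icc_self h5)).2] at h4
        rw [patch_of_not_mem π E h3]
        exact (congrArg Prod.snd h4).symm
    · have h2 := (h.ear.isStrand h.closed).eventually_eq I _ hI
        (hγ'.mono h.retraction.subset Subset.rfl) t htI h1 (hg (Ioo_subset_Icc_self h1))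
      filter_upwards [h2, self_mem_nhdsWithin, nhdsWithin_le_nhds (Ioo_mem_nhds h1.1 h1.2)]
        with s hs hsI hsv
      have hsv' := Ioo_subset_Icc_self hsv
      have h4 := hkey s hsI
      rw [hs, shift_of_mem π (mk_mem_seg hsv')] at h4
      rw [patch_of_mem π E hsv']
      exact (congrArg Prod.snd h4).symm

end Replacement

/-! ### The Markov property of strands in time retracts -/

/-- Each strand of `L` lies on a full path in `L` such that the process on the strand is independent
of the process on the rest of `L` given the process on the rest of that path. -/
def StrandMarkov {Ω : Type*} [MeasurableSpace Ω] (P : Measure Ω) (Y : Point → Ω → ℝ) (D : Set ℝ)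
    (L : Set Point) : Prop :=
  ∀ v w E, v ∈ D → w ∈ D → IsStrand L v w E → ∃ σ, PathIn L D σ ∧ EqOn σ E (Icc v w) ∧
    Ind P Y (seg E (Icc v w)) (L \ seg E (Ioo v w)) (seg σ (D \ Ioo v w))

namespace Replacement

variable {Ω : Type*} [MeasurableSpace Ω] {P : Measure Ω} [IsFiniteMeasure P] {Y : Point → Ω → ℝ}
  {D : Set ℝ} {S L : Set Point} {a b : ℝ} {g π : ℝ → ℝ × ℝ} {r : Point → Point}

theorem subset_diff_union (h : Replacement S L a b g π r) (v w : ℝ) (E : ℝ → ℝ × ℝ) :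
    L \ seg E (Ioo v w) ⊆ ((L ∩ S ∪ seg π (Icc a b)) \ seg E (Ioo v w)) ∪ seg g (Icc a b) := by
  rintro p ⟨h1, h2⟩
  by_cases h3 : p ∈ S
  · exact Or.inl ⟨Or.inl ⟨h1, h3⟩, h2⟩
  · have h4 := h.mem_seg_of_not_mem h1 h3
    exact Or.inr ⟨Ioo_subset_Icc_self h4.1, h4.2⟩

theorem ends_subset (h : Replacement S L a b g π r) : {(a, g a), (b, g b)} ⊆ L ∩ S := by
  rintro p (rfl | rfl)
  · exact ⟨h.left_mem, h.ear.left_mem⟩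
  · exact ⟨h.right_mem, h.ear.right_mem⟩

/-- A strand that avoids the ear. -/
theorem exists_ind_of_avoid (h : Replacement S L a b g π r) (hD : D.OrdConnected)
    (haD : a ∈ D) (hbD : b ∈ D) (hY : ∀ p, Measurable (Y p))
    (hind : Ind P Y (seg g (Icc a b)) S {(a, g a), (b, g b)})
    (hcell : ∀ σ, PathIn S D σ → σ a = g a → σ b = g b →
      Ind P Y (seg σ (Icc a b)) (seg σ (D \ Ioo a b)) {(a, g a), (b, g b)})
    (ih : StrandMarkov P Y D (L ∩ S ∪ seg π (Icc a b))) {v w : ℝ} (hv : v ∈ D) (hw : w ∈ D)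
    {E : ℝ → ℝ × ℝ} (hE : IsStrand L v w E) (hES : ∀ t ∈ Icc v w, (t, E t) ∈ S) :
    ∃ σ, PathIn L D σ ∧ EqOn σ E (Icc v w) ∧
      Ind P Y (seg E (Icc v w)) (L \ seg E (Ioo v w)) (seg σ (D \ Ioo v w)) := by
  obtain ⟨σ, hσ, hσE, hI⟩ := ih v w E hv hw (h.isStrand hE hES)
  set L' := L ∩ S ∪ seg π (Icc a b) with hL'
  have hL'S : L' ⊆ S := h.subset_union
  have hgpath : PathIn L (Icc a b) g := ⟨h.ear.cont, fun t ht => h.seg_subset (mk_mem_seg ht)⟩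
  have hEsub : seg E (Icc v w) ⊆ S := by
    rintro ⟨t, x⟩ ⟨h1, h2⟩
    obtain rfl : x = E t := h2
    exact hES t h1
  -- the end points of the ear are not interior points of the strand
  have key : ∀ c ∈ Icc a b, c ∈ Ioo v w → g c ≠ E c := by
    intro c hc hcv heq
    have h1 := hE.eqOn ordConnected_Icc hgpath hc hcv heq
    -- A time next to `c` that is interior to the ear and within `[v, w]`, to the right of `c`
    -- unless `c = b`. There the ear would coincide with `E`, although it is outside `S` and `E` is
    -- not.
    obtain ⟨s, hs1, hs2⟩ : ∃ s, s ∈ Ioo a b ∧ s ∈ Icc v w := by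
      rcases hc.2.lt_or_eq with h2 | h2
      · refine ⟨(c + min b w) / 2, ⟨?_, ?_⟩, ?_, ?_⟩ <;>
        have h3 := min_le_left b w <;> have h4 := min_le_right b w <;>
        have h5 : c < min b w := lt_min h2 hcv.2 <;> have h6 := hc.1 <;> have h7 := hcv.1 <;>
        linarith
      · refine ⟨(c + max a v) / 2, ⟨?_, ?_⟩, ?_, ?_⟩ <;>
        have h3 := le_max_left a v <;> have h4 := le_max_right a v <;>
        have h5 : max a v < c := max_lt (by rw [h2]; exact h.ear.lt) hcv.1 <;>
        have h6 := hcv.2 <;> linarith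
    have h2 := h1 ⟨Ioo_subset_Icc_self hs1, hs2⟩
    exact h.ear.not_mem s hs1 (by rw [h2]; exact hES s hs2)
  have hends : {(a, g a), (b, g b)} ⊆ L' \ seg E (Ioo v w) := by
    rintro p hp
    refine ⟨Or.inl (h.ends_subset hp), ?_⟩
    rcases hp with rfl | rfl
    · exact fun hp => key a ⟨le_rfl, h.ear.lt.le⟩ hp.1 hp.2
    · exact fun hp => key b ⟨h.ear.lt.le, le_rfl⟩ hp.1 hp.2
  have hσsub : seg σ (D \ Ioo v w) ⊆ S := by
    rintro ⟨t, x⟩ ⟨h1, h2⟩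
    obtain rfl : x = σ t := h2
    exact hL'S (hσ.mem t h1.1)
  -- The ear is independent of all of `S` given its ends. Once the ends are among the points of `Z ∪
  -- B`, the ear may thus be added to the part of which `E` is independent.
  have hadd : ∀ {Z B : Set Point}, Z ⊆ S → B ⊆ S → {(a, g a), (b, g b)} ⊆ Z ∪ B →
      Ind P Y (seg E (Icc v w)) B Z →
      Ind P Y (seg E (Icc v w)) (B ∪ seg g (Icc a b)) Z := by
    intro Z B hZ hB hab h1
    refine h1.contraction ?_
    exact (hind.symm hY).left hY hab ((union_subset hZ hB).trans subset_union_right)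
      (hEsub.trans subset_union_right)
  have hdiffS : L' \ seg E (Ioo v w) ⊆ S := sdiff_subset.trans hL'S
  by_cases hc : ∀ t ∈ D, (t, σ t) ∈ L
  · refine ⟨σ, ⟨hσ.cont, hc⟩, hσE, ?_⟩
    refine (hadd hσsub hdiffS (hends.trans subset_union_right) hI).right hY
      Subset.rfl subset_union_left ?_
    exact (h.subset_diff_union v w E).trans subset_union_right
  -- The full path of `L'` leaves `L`, which it can do only along `π`; so `π` is of the kind that
  -- `r` maps to the ear. The image of `σ` under `r` then uses the ear in place of `π` and is the
  -- path to be taken in `L`.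
  · push Not at hc
    obtain ⟨t, htD, htn⟩ := hc
    have ht1 : (t, σ t) ∈ seg π (Icc a b) :=
      (hσ.mem t htD).resolve_left fun h1 => htn h1.1
    have htπ : σ t = π t := ht1.2
    have hcase : ∀ t ∈ Icc a b, r (t, π t) = (t, g t) := by
      refine h.cases.resolve_left fun h1 => htn ?_
      rw [htπ]; exact h1 t ht1.1
    have hπL : ∀ s ∈ Ioo a b, (s, π s) ∉ L := by
      intro s hs hsL
      have h1 := hcase s (Ioo_subset_Icc_self hs)
      rw [h.retraction.eq _ hsL] at h1
      have h2 := h.path.mem s (Ioo_subset_Icc_self hs)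
      rw [h1] at h2
      exact h.ear.not_mem s hs h2
    have htab : t ∈ Ioo a b := by
      refine ⟨lt_of_le_of_ne ht1.1.1 ?_, lt_of_le_of_ne ht1.1.2 ?_⟩
      · rintro rfl; rw [htπ, h.left] at htn; exact htn h.left_mem
      · rintro rfl; rw [htπ, h.right] at htn; exact htn h.right_mem
    have hσS : PathIn (S ∪ seg g (Icc a b)) D σ :=
      hσ.mono (hL'S.trans subset_union_left) Subset.rfl
    have hτ := h.retraction.pathIn hσS
    have habD : Icc a b ⊆ D := hD.out haD hbD
    have hτg : EqOn (mapPath r σ) g (Icc a b) := by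
      have h1 : mapPath r σ t = g t := by
        unfold mapPath
        rw [htπ, hcase t ht1.1]
      exact fun s hs => (h.ear.isStrand h.closed).eqOn hD (hτ.mono h.retraction.subset Subset.rfl)
        htD htab h1 ⟨habD hs, hs⟩
    have hσπ : EqOn σ π (Icc a b) := by
      intro s hs
      have h1 := h.shift_retraction_eq (hσ.mem s (habD hs))
      rw [← h.retraction.mk_mapPath (hσS.mem s (habD hs)), hτg hs,
        shift_of_mem π (mk_mem_seg hs)] at h1
      exact (congrArg Prod.snd h1).symm
    have hτσ : ∀ s ∈ D, s ∉ Ioo a b → mapPath r σ s = σ s := by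
      intro s hs hn
      refine h.retraction.mapPath_eq ?_
      rcases hσ.mem s hs with h1 | h1
      · exact h1.1
      · have h2 : s = a ∨ s = b := by
          rcases h1.1.1.lt_or_eq with h2 | h2
          · exact Or.inr (le_antisymm h1.1.2 (not_lt.1 fun h3 => hn ⟨h2, h3⟩))
          · exact Or.inl h2.symm
        rcases h2 with rfl | rfl
        · rw [hσπ h1.1, h.left]; exact h.left_mem
        · rw [hσπ h1.1, h.right]; exact h.right_mem
    -- Over `(a, b)` the path `σ` is `π`, which is outside `L`, while over `[v, w]` it is `E`, which
    -- is inside.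
    have hdisj : ∀ s ∈ Icc v w, s ∉ Ioo a b := by
      intro s hs hs'
      have h1 := hπL s hs'
      rw [← hσπ (Ioo_subset_Icc_self hs'), hσE hs] at h1
      exact h1 (hE.path.mem s hs)
    have hσa : σ a = g a := (hσπ ⟨le_rfl, h.ear.lt.le⟩).trans h.left
    have hσb : σ b = g b := (hσπ ⟨h.ear.lt.le, le_rfl⟩).trans h.right
    have hvwD : Icc v w ⊆ D := hD.out hv hw
    have hav : ∀ c ∈ Icc a b, c ∉ Ioo a b → c ∉ Ioo v w := by
      intro c hc hn hcv
      have h1 : c = a ∨ c = b := by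
        rcases hc.1.lt_or_eq with h2 | h2
        · exact Or.inr (le_antisymm hc.2 (not_lt.1 fun h3 => hn ⟨h2, h3⟩))
        · exact Or.inl h2.symm
      have h2 : g c = σ c := by rcases h1 with rfl | rfl <;> [exact hσa.symm; exact hσb.symm]
      exact key c hc hcv (h2.trans (hσE (Ioo_subset_Icc_self hcv)))
    refine ⟨mapPath r σ, hτ, fun s hs => ?_, ?_⟩
    · rw [hτσ s (hvwD hs) (hdisj s hs), hσE hs]
    -- The part of `σ` off both the strand and the ear times. The cell condition along `σ` makes `E`
    -- independent of the detour `π` given `Z`; by contraction with the induction hypothesis, `π` is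
    -- removed from the condition. Then `hadd` brings in the ear.
    set Z := seg σ ((D \ Ioo v w) \ Ioo a b) with hZ
    have hZσ : Z ⊆ seg σ (D \ Ioo v w) := seg_mono sdiff_subset
    have h3T := hcell σ (hσ.mono hL'S Subset.rfl) hσa hσb
    have hendsZ : {(a, g a), (b, g b)} ⊆ Z := by
      rintro p (rfl | rfl)
      · exact ⟨⟨⟨haD, hav a ⟨le_rfl, h.ear.lt.le⟩ (fun h => lt_irrefl _ h.1)⟩,
          fun h => lt_irrefl _ h.1⟩, hσa.symm⟩
      · exact ⟨⟨⟨hbD, hav b ⟨h.ear.lt.le, le_rfl⟩ (fun h => lt_irrefl _ h.2)⟩,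
          fun h => lt_irrefl _ h.2⟩, hσb.symm⟩
    have h1 : Ind P Y (seg E (Icc v w)) (seg σ (Icc a b)) Z := by
      refine (h3T.symm hY).left hY hendsZ ?_ ?_
      · exact (seg_mono (sdiff_subset_sdiff_left sdiff_subset)).trans subset_union_right
      · rintro p ⟨hp1, hp2⟩
        exact Or.inr ⟨⟨hvwD hp1, hdisj _ hp1⟩, hp2.trans (hσE hp1).symm⟩
    have h2 : Ind P Y (seg E (Icc v w)) (L' \ seg E (Ioo v w)) (Z ∪ seg σ (Icc a b)) := by
      refine hI.right hY ?_ ?_ subset_union_right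
      · rintro p ⟨hp1, hp2⟩
        by_cases h3 : p.1 ∈ Ioo a b
        · exact Or.inr ⟨Ioo_subset_Icc_self h3, hp2⟩
        · exact Or.inl ⟨⟨hp1, h3⟩, hp2⟩
      · refine union_subset (hZσ.trans subset_union_left) ?_
        rintro p ⟨hp1, hp2⟩
        refine Or.inl ⟨⟨habD hp1, fun h4 => ?_⟩, hp2⟩
        by_cases h3 : p.1 ∈ Ioo a b
        · exact hdisj _ (Ioo_subset_Icc_self h4) h3
        · exact hav _ hp1 h3 h4
    have hσabS : seg σ (Icc a b) ⊆ S := by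
      rintro ⟨s, x⟩ ⟨hs, h4⟩
      obtain rfl : x = σ s := h4
      exact hL'S (hσ.mem s (habD hs))
    have h3 := hadd (hZσ.trans hσsub) (union_subset hσabS hdiffS)
      (hendsZ.trans subset_union_left) (h1.contraction h2)
    -- Moving the points of the ear into the condition completes `Z` to the new path off the strand.
    refine h3.right hY ?_ ?_ ?_
    · rintro p ⟨hp1, hp2⟩
      exact ⟨hp1.1, hp2.trans (hτσ _ hp1.1.1 hp1.2).symm⟩
    · rintro p ⟨hp1, hp2⟩
      by_cases h4 : p.1 ∈ Ioo a b
      · have h5 := Ioo_subset_Icc_self h4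
        exact Or.inr (Or.inr ⟨h5, hp2.trans (hτg h5)⟩)
      · exact Or.inl ⟨⟨hp1, h4⟩, hp2.trans (hτσ _ hp1.1 h4)⟩
    · refine (h.subset_diff_union v w E).trans (union_subset ?_ ?_)
      · exact fun p hp => Or.inr (Or.inl (Or.inr hp))
      · exact fun p hp => Or.inr (Or.inr hp)

end Replacement

namespace Replacement

variable {Ω : Type*} [MeasurableSpace Ω] {P : Measure Ω} [IsFiniteMeasure P] {Y : Point → Ω → ℝ}
  {D : Set ℝ} {S L : Set Point} {a b : ℝ} {g π : ℝ → ℝ × ℝ} {r : Point → Point}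

/-- A strand that overlaps with the ear. -/
theorem exists_ind_of_overlap (h : Replacement S L a b g π r) (hD : D.OrdConnected)
    (haD : a ∈ D) (hbD : b ∈ D) (hY : ∀ p, Measurable (Y p))
    (hind : Ind P Y (seg g (Icc a b)) S {(a, g a), (b, g b)})
    {σg : ℝ → ℝ × ℝ} (hσg : PathIn L D σg) (hσgg : EqOn σg g (Icc a b))
    (ih : StrandMarkov P Y D (L ∩ S ∪ seg π (Icc a b))) {v w : ℝ} (hv : v ∈ D) (hw : w ∈ D)
    {E : ℝ → ℝ × ℝ} (hE : IsStrand L v w E) {t₀ : ℝ} (ht₀ : t₀ ∈ Icc v w)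
    (hn : (t₀, E t₀) ∉ S) :
    ∃ σ, PathIn L D σ ∧ EqOn σ E (Icc v w) ∧
      Ind P Y (seg E (Icc v w)) (L \ seg E (Ioo v w)) (seg σ (D \ Ioo v w)) := by
  have habD : Icc a b ⊆ D := hD.out haD hbD
  have hvwD : Icc v w ⊆ D := hD.out hv hw
  have hab := h.ear.lt
  obtain ⟨ht₀', ht₀E⟩ := h.mem_seg_of_not_mem (hE.path.mem t₀ ht₀) hn
  simp only at ht₀' ht₀E
  have hEg : EqOn E g (Icc v w ∩ Icc a b) :=
    (h.ear.isStrand h.closed).eqOn ordConnected_Icc (hE.path.mono h.retraction.subset Subset.rfl)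
      ht₀ ht₀' ht₀E
  rcases h.cases with hc | hc
  · -- the strand is a part of the ear
    -- Here `π` is a path in `L`. If it met the strand at an interior time, it would follow it up to
    -- `t₀`, where the strand is outside `S`. So the strand cannot extend past either end of the
    -- ear.
    have hnot : ∀ c ∈ Icc a b, π c = g c → c ∉ Ioo v w := by
      intro c hcab hcg hcv
      have h1 : π c = E c := by rw [hcg, hEg ⟨Ioo_subset_Icc_self hcv, hcab⟩]
      have h2 := hE.eqOn ordConnected_Icc ⟨h.path.cont, hc⟩ hcab hcv h1
        ⟨Ioo_subset_Icc_self ht₀', ht₀⟩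
      rw [← h2] at hn
      exact hn (h.path.mem t₀ (Ioo_subset_Icc_self ht₀'))
    have hanv := hnot a ⟨le_rfl, hab.le⟩ h.left
    have hbnv := hnot b ⟨hab.le, le_rfl⟩ h.right
    have hva : a ≤ v := not_lt.1 fun h1 => hanv ⟨h1, ht₀'.1.trans_le ht₀.2⟩
    have hwb : w ≤ b := not_lt.1 fun h1 => hbnv ⟨ht₀.1.trans_lt ht₀'.2, h1⟩
    have hsub : Icc v w ⊆ Icc a b := Icc_subset_Icc hva hwb
    refine ⟨σg, hσg, fun s hs => ?_, ?_⟩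
    · rw [hσgg (hsub hs), hEg ⟨hs, hsub hs⟩]
    -- The ends of the ear and the remainder of the ear off the strand: given the two ends, the
    -- whole ear is independent of `S`, so this remainder may be added to the condition.
    set Z : Set Point := {(a, g a), (b, g b)} ∪ seg g (Icc a b \ Ioo v w) with hZ
    have h1 : Ind P Y (seg E (Icc v w)) S Z := by
      refine hind.left hY subset_union_left (union_subset subset_union_left ?_) ?_
      · exact (seg_mono sdiff_subset).trans subset_union_right
      · rintro p ⟨hp1, hp2⟩
        exact Or.inr ⟨hsub hp1, hp2.trans (hEg ⟨hp1, hsub hp1⟩)⟩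
    have hLS : ∀ p ∈ L, p ∉ seg E (Ioo v w) → p ∈ Z ∪ S := by
      intro p hp hpE
      by_cases hpS : p ∈ S
      · exact Or.inr hpS
      obtain ⟨h2, h3⟩ := h.mem_seg_of_not_mem hp hpS
      have h4 := Ioo_subset_Icc_self h2
      refine Or.inl (Or.inr ⟨⟨h4, fun h5 => hpE ⟨h5, ?_⟩⟩, h3⟩)
      rw [h3, hEg ⟨Ioo_subset_Icc_self h5, h4⟩]
    refine h1.right hY ?_ ?_ ?_
    · refine union_subset ?_ ?_
      · rintro p (rfl | rfl)
        · exact ⟨⟨haD, hanv⟩, (hσgg ⟨le_rfl, hab.le⟩).symm⟩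
        · exact ⟨⟨hbD, hbnv⟩, (hσgg ⟨hab.le, le_rfl⟩).symm⟩
      · rintro p ⟨hp1, hp2⟩
        exact ⟨⟨habD hp1.1, hp1.2⟩, hp2.trans (hσgg hp1.1).symm⟩
    · rintro ⟨t, x⟩ ⟨hp1, hp2⟩
      obtain rfl : x = σg t := hp2
      exact hLS _ (hσg.mem t hp1.1) fun hp => hp1.2 hp.1
    · exact fun p hp => hLS p hp.1 hp.2
  · -- the path `π` takes the place of the ear
    have hπL : ∀ s ∈ Icc a b, (s, π s) ∈ L → π s = g s := by
      intro s hs hsL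
      have h1 := hc s hs
      rw [h.retraction.eq _ hsL] at h1
      exact congrArg Prod.snd h1
    have hminD : min v a ∈ D := by rcases min_choice v a with h1 | h1 <;> rw [h1] <;> assumption
    have hmaxD : max w b ∈ D := by rcases max_choice w b with h1 | h1 <;> rw [h1] <;> assumption
    obtain ⟨σ, hσ, hσF, hI⟩ := ih _ _ _ hminD hmaxD (h.isStrand_patch hc hE ht₀ ht₀' hEg)
    set L' := L ∩ S ∪ seg π (Icc a b) with hL'
    set F := patch a b π E with hF
    have hL'S : L' ⊆ S := h.subset_union
    have hσS : PathIn (S ∪ seg g (Icc a b)) D σ :=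
      hσ.mono (hL'S.trans subset_union_left) Subset.rfl
    have hτ := h.retraction.pathIn hσS
    have hvwF : Icc v w ⊆ Icc (min v a) (max w b) :=
      Icc_subset_Icc (min_le_left _ _) (le_max_left _ _)
    have habF : Icc a b ⊆ Icc (min v a) (max w b) :=
      Icc_subset_Icc (min_le_right _ _) (le_max_right _ _)
    have hvwF' : Ioo v w ⊆ Ioo (min v a) (max w b) :=
      Ioo_subset_Ioo (min_le_left _ _) (le_max_left _ _)
    have habF' : Ioo a b ⊆ Ioo (min v a) (max w b) :=
      Ioo_subset_Ioo (min_le_right _ _) (le_max_right _ _)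
    have hσπ : ∀ s ∈ Icc a b, σ s = π s := fun s hs => by
      rw [hσF (habF hs), hF, patch_of_mem π E hs]
    have hτg : ∀ s ∈ Icc a b, mapPath r σ s = g s := fun s hs => by
      unfold mapPath
      rw [hσπ s hs, hc s hs]
    have hτσ : ∀ s ∈ D, s ∉ Icc a b → mapPath r σ s = σ s := fun s hs hn => by
      refine h.retraction.mapPath_eq ?_
      rcases hσ.mem s hs with h1 | h1
      · exact h1.1
      · exact (hn h1.1).elim
    have hFE : ∀ s, s ∉ Icc a b → F s = E s := fun s hs => patch_of_not_mem π E hs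
    have hFsub : seg F (Icc (min v a) (max w b)) ⊆ S := by
      rintro ⟨t, x⟩ ⟨h1, h2⟩
      obtain rfl : x = F t := h2
      change t ∈ Icc _ _ at h1
      rw [← hσF h1]
      exact hL'S (hσ.mem t (hD.out hminD hmaxD h1))
    have hσsub : seg σ (D \ Ioo (min v a) (max w b)) ⊆ S := by
      rintro ⟨t, x⟩ ⟨h1, h2⟩
      obtain rfl : x = σ t := h2
      exact hL'S (hσ.mem t h1.1)
    refine ⟨mapPath r σ, hτ, fun s hs => ?_, ?_⟩
    · by_cases h1 : s ∈ Icc a b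
      · rw [hτg s h1, hEg ⟨hs, h1⟩]
      · rw [hτσ s (hvwD hs) h1, hσF (hvwF hs), hFE s h1]
    set Z := seg σ (D \ Ioo (min v a) (max w b)) with hZ
    set B := L' \ seg F (Ioo (min v a) (max w b)) with hB
    have hBS : B ⊆ S := sdiff_subset.trans hL'S
    -- The ends of the ear lie on `F`, so given `F` the ear is independent of everything else in
    -- `S`. By contraction, `F` and the ear together are independent of `B` given `Z`; the strand
    -- and the missing part of the new path are both taken from that pair.
    have h1 : Ind P Y B (seg g (Icc a b)) (Z ∪ seg F (Icc (min v a) (max w b))) := by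
      refine (hind.right hY ?_ ?_ (hBS.trans subset_union_right)).symm hY
      · rintro p (rfl | rfl)
        · refine Or.inr ⟨habF ⟨le_rfl, hab.le⟩, ?_⟩
          rw [hF, patch_of_mem π E ⟨le_rfl, hab.le⟩, h.left]
        · refine Or.inr ⟨habF ⟨hab.le, le_rfl⟩, ?_⟩
          rw [hF, patch_of_mem π E ⟨hab.le, le_rfl⟩, h.right]
      · exact (union_subset hσsub hFsub).trans subset_union_right
    have h2 := ((hI.symm hY).contraction h1).symm hY
    have h3 : Ind P Y (seg E (Icc v w)) B (seg (mapPath r σ) (D \ Ioo v w)) := by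
      refine h2.left hY ?_ ?_ ?_
      · rintro p ⟨hp1, hp2⟩
        refine ⟨⟨hp1.1, fun h4 => hp1.2 (hvwF' h4)⟩, ?_⟩
        by_cases h4 : p.1 ∈ Icc a b
        · have h5 : p.1 = a ∨ p.1 = b := by
            rcases h4.1.lt_or_eq with h6 | h6
            · exact Or.inr (le_antisymm h4.2 (not_lt.1 fun h7 => hp1.2 (habF' ⟨h6, h7⟩)))
            · exact Or.inl h6.symm
          rw [hp2, hσπ _ h4, hτg _ h4]
          rcases h5 with h5 | h5 <;> rw [h5]
          · exact h.left
          · exact h.right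
        · rw [hτσ _ hp1.1 h4]; exact hp2
      · rintro p ⟨hp1, hp2⟩
        by_cases h4 : p.1 ∈ Icc a b
        · exact Or.inr (Or.inr ⟨h4, hp2.trans (hτg _ h4)⟩)
        · rw [hτσ _ hp1.1 h4] at hp2
          by_cases h5 : p.1 ∈ Ioo (min v a) (max w b)
          · have h6 := Ioo_subset_Icc_self h5
            exact Or.inr (Or.inl ⟨h6, hp2.trans (hσF h6)⟩)
          · exact Or.inl ⟨⟨hp1.1, h5⟩, hp2⟩
      · rintro p ⟨hp1, hp2⟩
        by_cases h4 : p.1 ∈ Icc a b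
        · exact Or.inr (Or.inr ⟨h4, hp2.trans (hEg ⟨hp1, h4⟩)⟩)
        · exact Or.inr (Or.inl ⟨hvwF hp1, hp2.trans (hFE _ h4).symm⟩)
    refine h3.right hY Subset.rfl subset_union_left ?_
    rintro ⟨t, x⟩ ⟨hp, hpE⟩
    -- Points of the ear off the strand are on the new path, hence in the condition. A point of `L`
    -- on `π` is also of this kind, because `r` fixes it and maps `π` to the ear.
    have hgZ : t ∈ Icc a b → x = g t → (t, x) ∈ seg (mapPath r σ) (D \ Ioo v w) := by
      intro h4 h5
      refine ⟨⟨habD h4, fun h6 => hpE ⟨h6, ?_⟩⟩, h5.trans (hτg t h4).symm⟩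
      exact h5.trans (hEg ⟨Ioo_subset_Icc_self h6, h4⟩).symm
    by_cases hpS : (t, x) ∈ S
    · by_cases hpF : (t, x) ∈ seg F (Ioo (min v a) (max w b))
      · obtain ⟨h4, h5⟩ := hpF
        change t ∈ Ioo _ _ at h4
        change x = F t at h5
        by_cases h6 : t ∈ Icc a b
        · rw [hF, patch_of_mem π E h6] at h5
          subst h5
          exact Or.inl (hgZ h6 (hπL t h6 hp))
        · rw [hFE t h6] at h5
          refine (hpE ⟨?_, h5⟩).elim
          change t ∈ Ioo v w
          have h7 := ht₀.1
          have h8 := ht₀.2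
          have h9 := ht₀'.1
          have h10 := ht₀'.2
          rw [mem_Icc, not_and_or, not_le, not_le] at h6
          rcases h6 with h6 | h6
          · refine ⟨?_, by linarith⟩
            rcases min_lt_iff.1 h4.1 with h11 | h11 <;> linarith
          · refine ⟨by linarith, ?_⟩
            rcases lt_max_iff.1 h4.2 with h11 | h11 <;> linarith
      · exact Or.inr ⟨Or.inl ⟨hp, hpS⟩, hpF⟩
    · obtain ⟨h4, h5⟩ := h.mem_seg_of_not_mem hp hpS
      exact Or.inl (hgZ (Ioo_subset_Icc_self h4) h5)

end Replacement

/-- The Markov property of strands holds in all time retracts of the sets of a sequence that grows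
by ears, if the process on an ear, given the process so far, depends on the values at the ends of
the ear only, and if the same holds for the paths that run parallel to the ear, along full paths. -/
theorem IsEarSeq.strandMarkov {Ω : Type*} [MeasurableSpace Ω] {P : Measure Ω} [IsFiniteMeasure P]
    {Y : Point → Ω → ℝ} {D : Set ℝ} {S : ℕ → Set Point} (h : IsEarSeq D S)
    (hY : ∀ p, Measurable (Y p))
    (hstep : ∀ n, S (n + 1) = S n ∨ ∃ a b g, a ∈ D ∧ b ∈ D ∧ IsEar (S n) a b g ∧
      S (n + 1) = S n ∪ seg g (Icc a b) ∧
      Ind P Y (seg g (Icc a b)) (S n) {(a, g a), (b, g b)} ∧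
      ∀ σ, PathIn (S n) D σ → σ a = g a → σ b = g b →
        Ind P Y (seg σ (Icc a b)) (seg σ (D \ Ioo a b)) {(a, g a), (b, g b)})
    (n : ℕ) {L : Set Point} (hL : IsTimeRetract (S n) L) : StrandMarkov P Y D L := by
  induction n generalizing L with
  | zero =>
    intro v w E hv hw hE
    obtain ⟨σ, hσ, hS⟩ := h.base
    obtain ⟨r, hr⟩ := hL.exists_retraction
    have hLσ : ∀ p ∈ L, p.2 = σ p.1 := fun p hp => by
      have := hr.subset hp
      rw [hS] at this
      exact this.2
    have hp : PathIn L D (mapPath r σ) := hr.pathIn (by rw [hS]; exact pathIn_seg hσ)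
    have hp' : PathIn L D σ := hp.congr fun t ht => (hLσ _ (hp.mem t ht)).symm
    -- All of `L` is on the single path `σ`, so what remains of `L` beside the strand is in the
    -- condition.
    refine ⟨σ, hp', fun t ht => (hLσ _ (hE.path.mem t ht)).symm, ind_of_subset ?_⟩
    rintro p ⟨hp1, hp2⟩
    have h1 : p.1 ∈ D := by
      have := hr.subset hp1
      rw [hS] at this
      exact this.1
    refine ⟨⟨h1, fun h2 => hp2 ⟨h2, ?_⟩⟩, hLσ p hp1⟩
    have h3 := hLσ _ (hE.path.mem _ (Ioo_subset_Icc_self h2))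
    exact (hLσ p hp1).trans h3.symm
  | succ n ih =>
    by_cases hLS : L ⊆ S n
    · exact ih (hL.subset_left (h.subset_succ n) hLS)
    rcases hstep n with h1 | ⟨a, b, g, ha, hb, hg, h1, h2, h3⟩
    · exact (hLS (h1 ▸ hL.1)).elim
    obtain ⟨p, hpL, hpS⟩ := not_subset.1 hLS
    obtain ⟨r, hr⟩ := hL.exists_retraction
    -- The retraction fixes `p`, so the image in `L` of a full path through `p` still passes through
    -- the interior of the ear. By rigidity it contains the entire ear, which therefore lies in `L`.
    obtain ⟨_, σ₀, hσ₀, hσ₀p⟩ := h.exists_path (n + 1) (hr.subset hpL)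
    rw [h1] at hr hσ₀
    have hσL := hr.pathIn hσ₀
    have hpg : p ∈ seg g (Icc a b) := (hr.subset hpL).resolve_left hpS
    have hpab : p.1 ∈ Ioo a b := mem_Ioo_of_not_mem hg hpg.1 (by
      have : (p.1, g p.1) = p := Prod.ext rfl hpg.2.symm
      rw [this]; exact hpS)
    have habD : Icc a b ⊆ D := h.ordConnected.out ha hb
    have hpp : (p.1, σ₀ p.1) = p := Prod.ext rfl hσ₀p
    have h4 : mapPath r σ₀ p.1 = g p.1 := by
      rw [hr.mapPath_eq (by rw [hpp]; exact hpL), hσ₀p, hpg.2]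
    have hσg : EqOn (mapPath r σ₀) g (Icc a b) := fun s hs =>
      (hg.isStrand (h.isClosed n)).eqOn h.ordConnected (hσL.mono hr.subset Subset.rfl)
        (habD hpg.1) hpab h4 ⟨habD hs, hs⟩
    have hsub : seg g (Icc a b) ⊆ L := by
      rintro ⟨t, x⟩ ⟨ht, hx⟩
      obtain rfl : x = g t := hx
      rw [← hσg ht]; exact hσL.mem t (habD ht)
    obtain ⟨π, hπ, hπa, hπb, hc⟩ := exists_replacement (h.isClosed n) hg hr
      (hsub (mk_mem_seg ⟨le_rfl, hg.lt.le⟩)) (hsub (mk_mem_seg ⟨hg.lt.le, le_rfl⟩))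
    have R : Replacement (S n) L a b g π r := ⟨h.isClosed n, hg, hr, hsub, hπ, hπa, hπb, hc⟩
    intro v w E hv hw hE
    by_cases hES : ∀ t ∈ Icc v w, (t, E t) ∈ S n
    · exact R.exists_ind_of_avoid h.ordConnected ha hb hY h2 h3 (ih R.isTimeRetract) hv hw hE hES
    · push Not at hES
      obtain ⟨t₀, ht₀, hn⟩ := hES
      exact R.exists_ind_of_overlap h.ordConnected ha hb hY h2 hσL hσg (ih R.isTimeRetract) hv hw hE
        ht₀ hn

/-! ### Curves as functions on the real line -/

theorem isClosed_timeDom (a b : EReal) : IsClosed (timeDom a b) :=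
  isClosed_Icc.preimage continuous_coe_real_ereal

theorem ordConnected_timeDom (a b : EReal) : (timeDom a b).OrdConnected :=
  ⟨fun _ hx _ hy _ hz => ⟨hx.1.trans (EReal.coe_le_coe_iff.2 hz.1),
    (EReal.coe_le_coe_iff.2 hz.2).trans hy.2⟩⟩

theorem timeDom_coe (a b : ℝ) : timeDom (a : EReal) (b : EReal) = Icc a b := by
  ext t; simp [timeDom]

open Classical in
/-- The curve `γ` as a function of all real times. -/
noncomputable def Curve.fn {a b : EReal} (γ : Curve a b) (t : ℝ) : ℝ × ℝ :=
  if h : t ∈ timeDom a b then γ ⟨t, h⟩ else 0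

theorem Curve.fn_coe {a b : EReal} (γ : Curve a b) (t : timeDom a b) : γ.fn t = γ t :=
  dif_pos t.2

theorem Curve.fn_mk {a b : EReal} (γ : Curve a b) {t : ℝ} (h : t ∈ timeDom a b) :
    γ.fn t = γ ⟨t, h⟩ :=
  dif_pos h

theorem Curve.continuousOn_fn {a b : EReal} (γ : Curve a b) : ContinuousOn γ.fn (timeDom a b) := by
  rw [continuousOn_iff_continuous_domRestrict]
  have : (timeDom a b).domRestrict γ.fn = γ := funext fun t => γ.fn_coe t
  rw [this]
  exact γ.continuous

theorem Curve.graph_eq {a b : EReal} (γ : Curve a b) : Curve.graph γ = seg γ.fn (timeDom a b) := by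
  ext p
  constructor
  · rintro ⟨t, rfl⟩
    exact ⟨t.2, (γ.fn_coe t).symm⟩
  · rintro ⟨h1, h2⟩
    exact ⟨⟨p.1, h1⟩, Prod.ext rfl ((γ.fn_mk h1).symm.trans h2.symm)⟩

theorem Curve.inner_eq {a b : EReal} (γ : Curve a b) :
    Curve.inner γ = seg γ.fn {t : ℝ | a < (t : EReal) ∧ (t : EReal) < b} := by
  ext p
  unfold Curve.inner
  rw [Curve.graph_eq]
  constructor
  · rintro ⟨h1, h2⟩; exact ⟨h2, h1.2⟩
  · rintro ⟨h1, h2⟩; exact ⟨⟨⟨h1.1.le, h1.2.le⟩, h2⟩, h1⟩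

/-- The curve given by a continuous function. -/
def Curve.ofFn {a b : EReal} (f : ℝ → ℝ × ℝ) (hf : ContinuousOn f (timeDom a b)) : Curve a b :=
  ⟨(timeDom a b).domRestrict f, hf.domRestrict⟩

theorem Curve.fn_ofFn {a b : EReal} (f : ℝ → ℝ × ℝ) (hf : ContinuousOn f (timeDom a b)) :
    EqOn (Curve.ofFn f hf).fn f (timeDom a b) := fun _ ht => Curve.fn_mk _ ht

theorem Curve.graph_subset_iff {a b c d : EReal} {γ : Curve a b} {γ' : Curve c d} :
    Curve.graph γ ⊆ Curve.graph γ' ↔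
      timeDom a b ⊆ timeDom c d ∧ EqOn γ.fn γ'.fn (timeDom a b) := by
  rw [Curve.graph_eq, Curve.graph_eq]
  constructor
  · intro h
    have h1 : ∀ t ∈ timeDom a b, (t, γ.fn t) ∈ seg γ'.fn (timeDom c d) := fun t ht =>
      h (mk_mem_seg ht)
    exact ⟨fun t ht => (h1 t ht).1, fun t ht => (h1 t ht).2⟩
  · rintro ⟨h1, h2⟩ p ⟨hp1, hp2⟩
    exact ⟨h1 hp1, hp2.trans (h2 hp1)⟩

theorem Curve.graph_subset_iff_pathIn {a b : EReal} {γ : Curve a b} {S : Set Point} :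
    Curve.graph γ ⊆ S ↔ PathIn S (timeDom a b) γ.fn := by
  rw [Curve.graph_eq]
  exact ⟨fun h => ⟨γ.continuousOn_fn, fun t ht => h (mk_mem_seg ht)⟩, fun h => h.seg_subset⟩

/-! ### Edges, paths and simple cells in towers -/

namespace TimeLikeGraph

variable {A B : EReal}

/-- Interiors of different edges are disjoint, and the ends of `e'` are vertices, which are in no
interior. -/
theorem not_mem_graph_of_mem_inner (G : TimeLikeGraph A B) {e e' : Edge} (he : e ∈ G.edges)
    (he' : e' ∈ G.edges) (hne : e ≠ e') {p : Point} (hp : p ∈ Curve.inner e.curve) :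
    p ∉ Curve.graph e'.curve := by
  intro hp'
  by_cases h : e'.lo < (p.1 : EReal) ∧ (p.1 : EReal) < e'.hi
  · exact disjoint_left.1 (G.edges_disjoint e he e' he' hne) hp ⟨hp', h⟩
  · obtain ⟨t, rfl⟩ := hp'
    refine G.verts_not_inner e he _ (G.edge_ends e' he' t ?_) hp
    by_contra hend
    unfold IsEndTime at hend
    rw [not_or] at hend
    exact h ⟨lt_of_le_of_ne t.2.1 (Ne.symm hend.1), lt_of_le_of_ne t.2.2 hend.2⟩

theorem mem_verts_of_time (G : TimeLikeGraph A B) {p : Point} (hp : p ∈ G.points)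
    (h : (p.1 : EReal) = A ∨ (p.1 : EReal) = B) : p ∈ G.verts := by
  unfold points at hp
  simp only [mem_iUnion] at hp
  obtain ⟨e, he, t, rfl⟩ := hp
  refine G.edge_ends e he t ?_
  have h1 := G.edge_time e he
  rcases h with h | h
  · exact Or.inl (le_antisymm (h.le.trans h1.1) t.2.1)
  · exact Or.inr (le_antisymm t.2.2 (h1.2.trans h.ge))

theorem exists_inner_time (e : Edge) : ∃ t : ℝ, e.lo < (t : EReal) ∧ (t : EReal) < e.hi :=
  EReal.lt_iff_exists_real_btwn.1 e.lo_lt_hi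

/-- The function that describes a full time-path. -/
noncomputable def FullPath.fn {G : TimeLikeGraph A B} (σ : G.FullPath) : ℝ → ℝ × ℝ := σ.curve.fn

theorem FullPath.pathIn {G : TimeLikeGraph A B} (σ : G.FullPath) :
    PathIn G.points (timeDom A B) σ.fn :=
  Curve.graph_subset_iff_pathIn.1 σ.isTimePath.2.1

theorem FullPath.pt_eq {G : TimeLikeGraph A B} (σ : G.FullPath) (t : timeDom A B) :
    Curve.pt σ.curve t = ((t : ℝ), σ.fn t) :=
  Prod.ext rfl (σ.curve.fn_coe t).symm

theorem FullPath.ext_fn {G : TimeLikeGraph A B} {σ τ : G.FullPath}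
    (h : EqOn σ.fn τ.fn (timeDom A B)) : σ = τ := by
  obtain ⟨σ, hσ⟩ := σ
  obtain ⟨τ, hτ⟩ := τ
  have : σ = τ := by
    ext1 t
    rw [← Curve.fn_coe, ← Curve.fn_coe]
    exact h t.2
  subst this
  rfl

theorem exists_fullPath (G : TimeLikeGraph A B) (hAB : A < B) {f : ℝ → ℝ × ℝ}
    (hf : PathIn G.points (timeDom A B) f) : ∃ σ : G.FullPath, EqOn σ.fn f (timeDom A B) := by
  have h1 := Curve.fn_ofFn f hf.cont
  refine ⟨⟨Curve.ofFn f hf.cont, hAB, ?_, fun t ht => ?_⟩, h1⟩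
  · exact Curve.graph_subset_iff_pathIn.2 (hf.congr h1)
  · refine G.mem_verts_of_time ?_ ht
    exact hf.mem t t.2

theorem points_eq_of_addVertex {G G' : TimeLikeGraph A B} (h : G.AddVertex G') :
    G'.points = G.points := by
  obtain ⟨e, he, v, -, e₁, e₂, -, -, -, -, h1, -, h2⟩ := h
  unfold points
  rw [h2, biUnion_union, biUnion_pair, h1]
  conv_rhs => rw [← sdiff_union_of_subset (singleton_subset_iff.2 he), biUnion_union,
    biUnion_singleton]

/-- The interior of the new edge is nonempty and disjoint from the old edges. This will contradict
the decrease of the edges at infinite times. -/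
theorem not_inner_subset_of_addEdge {G G' : TimeLikeGraph A B} {e e' : Edge}
    (he : G.AddEdge G' e) (he' : e' ∈ G.edges) :
    ¬ Curve.inner e.curve ⊆ Curve.inner e'.curve := by
  intro hsub
  obtain ⟨t, ht⟩ := exists_inner_time e
  have hp : (t, e.curve.fn t) ∈ Curve.inner e.curve := by
    rw [Curve.inner_eq]; exact mk_mem_seg ht
  have h1 : e ∈ G'.edges := by rw [he.2.2.2]; exact Or.inl rfl
  have h2 : e' ∈ G'.edges := by rw [he.2.2.2]; exact Or.inr he'
  refine G'.not_mem_graph_of_mem_inner h1 h2 ?_ hp (hsub hp).1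
  rintro rfl
  exact he.2.1 he'

namespace IsTower

variable {T : ℕ → TimeLikeGraph A B} {G : TimeLikeGraph A B}

theorem lt (h : IsTower T G) : A < B := by
  obtain ⟨e, -, h1, h2, -⟩ := h.minimal
  rw [← h1, ← h2]; exact e.lo_lt_hi

theorem exists_edge_lo (h : IsTower T G) (n : ℕ) : ∃ e ∈ (T n).edges, e.lo = A := by
  induction n with
  | zero =>
    obtain ⟨e, h0, h1, -, -⟩ := h.minimal
    exact ⟨e, by rw [h0]; rfl, h1⟩
  | succ n ih =>
    obtain ⟨e, he, h1⟩ := ih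
    rcases h.step n with ⟨e', he', v, -, e₁, e₂, h2, -, -, -, -, -, h3⟩ | ⟨e', h2⟩
    · rw [h3]
      by_cases hee : e = e'
      · exact ⟨e₁, Or.inr (Or.inl rfl), h2.trans (hee ▸ h1)⟩
      · exact ⟨e, Or.inl ⟨he, hee⟩, h1⟩
    · exact ⟨e, by rw [h2.2.2.2]; exact Or.inr he, h1⟩

theorem exists_edge_hi (h : IsTower T G) (n : ℕ) : ∃ e ∈ (T n).edges, e.hi = B := by
  induction n with
  | zero =>
    obtain ⟨e, h0, -, h1, -⟩ := h.minimal
    exact ⟨e, by rw [h0]; rfl, h1⟩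
  | succ n ih =>
    obtain ⟨e, he, h1⟩ := ih
    rcases h.step n with ⟨e', he', v, -, e₁, e₂, -, -, -, h2, -, -, h3⟩ | ⟨e', h2⟩
    · rw [h3]
      by_cases hee : e = e'
      · exact ⟨e₂, Or.inr (Or.inr rfl), h2.trans (hee ▸ h1)⟩
      · exact ⟨e, Or.inl ⟨he, hee⟩, h1⟩
    · exact ⟨e, by rw [h2.2.2.2]; exact Or.inr he, h1⟩

/-- A new edge from time `-∞` would have to be contained in the old initial edge. Together with
`hi_ne_top` this puts every added edge over a compact interval. -/
theorem lo_ne_bot (h : IsTower T G) {n : ℕ} {e : Edge} (he : (T n).AddEdge (T (n + 1)) e) :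
    e.lo ≠ ⊥ := by
  intro hlo
  have h1 : e ∈ (T (n + 1)).edges := by rw [he.2.2.2]; exact Or.inl rfl
  obtain ⟨e', he', h2⟩ := h.exists_edge_lo n
  have h3 : A = ⊥ := le_bot_iff.1 (hlo ▸ ((T (n + 1)).edge_time e h1).1)
  exact not_inner_subset_of_addEdge he he'
    (h.initial_decreasing n (n + 1) n.lt_succ_self e' he' e h1 (h2.trans h3) hlo)

theorem hi_ne_top (h : IsTower T G) {n : ℕ} {e : Edge} (he : (T n).AddEdge (T (n + 1)) e) :
    e.hi ≠ ⊤ := by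
  intro hhi
  have h1 : e ∈ (T (n + 1)).edges := by rw [he.2.2.2]; exact Or.inl rfl
  obtain ⟨e', he', h2⟩ := h.exists_edge_hi n
  have h3 : B = ⊤ := top_le_iff.1 (hhi ▸ ((T (n + 1)).edge_time e h1).2)
  exact not_inner_subset_of_addEdge he he'
    (h.terminal_decreasing n (n + 1) n.lt_succ_self e' he' e h1 (h2.trans h3) hhi)

/-- An edge that is added in a tower is an ear. -/
theorem isEar (h : IsTower T G) {n : ℕ} {e : Edge} (he : (T n).AddEdge (T (n + 1)) e) :
    ∃ a b : ℝ, a ∈ timeDom A B ∧ b ∈ timeDom A B ∧ e.lo = (a : EReal) ∧ e.hi = (b : EReal) ∧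
      IsEar (T n).points a b e.curve.fn ∧
      (T (n + 1)).points = (T n).points ∪ seg e.curve.fn (Icc a b) := by
  have h1 : e ∈ (T (n + 1)).edges := by rw [he.2.2.2]; exact Or.inl rfl
  obtain ⟨a, ha⟩ : ∃ a : ℝ, e.lo = (a : EReal) :=
    ⟨e.lo.toReal, (EReal.coe_toReal (ne_top_of_lt e.lo_lt_hi) (h.lo_ne_bot he)).symm⟩
  obtain ⟨b, hb⟩ : ∃ b : ℝ, e.hi = (b : EReal) :=
    ⟨e.hi.toReal, (EReal.coe_toReal (h.hi_ne_top he) (ne_bot_of_gt e.lo_lt_hi)).symm⟩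
  have hab : a < b := by rw [← EReal.coe_lt_coe_iff, ← ha, ← hb]; exact e.lo_lt_hi
  have htime := (T (n + 1)).edge_time e h1
  have hdom : timeDom e.lo e.hi = Icc a b := by rw [ha, hb, timeDom_coe]
  have hgr : Curve.graph e.curve = seg e.curve.fn (Icc a b) := by rw [Curve.graph_eq, hdom]
  obtain ⟨⟨ρ, hρ, hco⟩, hnew, -, hedges⟩ := he
  have hρP := Curve.graph_subset_iff_pathIn.1 hρ.2.1
  have haI : a ∈ timeDom e.lo e.hi := by rw [hdom]; exact ⟨le_rfl, hab.le⟩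
  have hbI : b ∈ timeDom e.lo e.hi := by rw [hdom]; exact ⟨hab.le, le_rfl⟩
  have hρa : ρ.fn a = e.curve.fn a := by
    rw [Curve.fn_mk _ haI, Curve.fn_mk _ haI]; exact hco _ (Or.inl ha.symm)
  have hρb : ρ.fn b = e.curve.fn b := by
    rw [Curve.fn_mk _ hbI, Curve.fn_mk _ hbI]; exact hco _ (Or.inr hb.symm)
  have hcont := e.curve.continuousOn_fn
  rw [hdom] at hρP hcont
  refine ⟨a, b, ⟨ha ▸ htime.1, ?_⟩, ⟨?_, hb ▸ htime.2⟩, ha, hb, ⟨hab, hcont, ?_, ?_, ?_, ?_⟩, ?_⟩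
  · exact (EReal.coe_le_coe_iff.2 hab.le).trans (hb ▸ htime.2)
  · exact (ha ▸ htime.1).trans (EReal.coe_le_coe_iff.2 hab.le)
  · rw [← hρa]; exact hρP.mem a ⟨le_rfl, hab.le⟩
  · rw [← hρb]; exact hρP.mem b ⟨hab.le, le_rfl⟩
  · intro t ht hmem
    unfold points at hmem
    simp only [mem_iUnion] at hmem
    obtain ⟨e', he', hp⟩ := hmem
    refine (T (n + 1)).not_mem_graph_of_mem_inner h1 (e' := e') (by rw [hedges]; exact Or.inr he') ?_
      ?_ hp
    · rintro rfl; exact hnew he'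
    · rw [Curve.inner_eq]
      exact mk_mem_seg ⟨ha ▸ EReal.coe_lt_coe_iff.2 ht.1, hb ▸ EReal.coe_lt_coe_iff.2 ht.2⟩
  · exact ⟨ρ.fn, hρP, hρa, hρb⟩
  · rw [← hgr]
    unfold points
    rw [hedges, biUnion_insert, union_comm]

theorem isEarSeq (h : IsTower T G) : IsEarSeq (timeDom A B) fun n => (T n).points := by
  refine ⟨isClosed_timeDom A B, ordConnected_timeDom A B, ?_, fun n => ?_⟩
  · obtain ⟨e, h1, h2, h3, -⟩ := h.minimal
    refine ⟨e.curve.fn, ?_, ?_⟩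
    · rw [← h2, ← h3]; exact e.curve.continuousOn_fn
    · unfold points
      have h4 : timeDom e.lo e.hi = timeDom A B := by rw [h2, h3]
      rw [h1, biUnion_singleton, Curve.graph_eq, h4]
  · rcases h.step n with h1 | ⟨e, h1⟩
    · exact Or.inl (points_eq_of_addVertex h1)
    · obtain ⟨a, b, ha, hb, -, -, h2, h3⟩ := h.isEar h1
      exact Or.inr ⟨a, b, _, ha, hb, h2, h3⟩

theorem points_subset (h : IsTower T G) (n : ℕ) : (T n).points ⊆ G.points := by
  rw [← h.points_eq]; exact subset_iUnion (fun n => (T n).points) n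

theorem verts_subset (h : IsTower T G) (n : ℕ) : (T n).verts ⊆ G.verts := by
  rw [← h.verts_eq]; exact subset_iUnion (fun n => (T n).verts) n

/-- Each edge of the graph is contained in one of the graphs of the tower. -/
theorem exists_graph_subset (h : IsTower T G) {f : Edge} (hf : f ∈ G.edges) :
    ∃ n, Curve.graph f.curve ⊆ (T n).points := by
  obtain ⟨t₀, ht₀⟩ := exists_inner_time f
  have hfG : Curve.graph f.curve ⊆ G.points := subset_biUnion_of_mem (u := fun e : Edge =>
    Curve.graph e.curve) hf
  have hfG' := hfG
  rw [Curve.graph_eq] at hfG' ⊢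
  have hp : (t₀, f.curve.fn t₀) ∈ G.points := hfG' (mk_mem_seg ⟨ht₀.1.le, ht₀.2.le⟩)
  rw [← h.points_eq, mem_iUnion] at hp
  obtain ⟨n, hn⟩ := hp
  obtain ⟨-, σ, hσ, hσt⟩ := h.isEarSeq.exists_path n hn
  simp only at hσ hσt
  refine ⟨n, ?_⟩
  -- The union of all other edges is closed by local finiteness. A path through an interior point of
  -- `f` therefore cannot leave `f` at interior times, so the full path `σ` of the stage covers all
  -- of `f`.
  set O : Set Point := ⋃ e : {e : Edge // e ∈ G.edges ∧ e ≠ f}, Curve.graph e.1.curve with hO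
  have hOc : IsClosed O := by
    refine LocallyFinite.isClosed_iUnion ?_ fun e => ?_
    · intro x
      refine ⟨Metric.closedBall x 1, Metric.closedBall_mem_nhds x one_pos, ?_⟩
      refine ((G.locallyFinite _ (isCompact_closedBall x 1)).preimage
        Subtype.val_injective.injOn).subset fun e he => ?_
      exact ⟨e.2.1, he⟩
    · rw [Curve.graph_eq]
      exact isClosed_seg (isClosed_timeDom _ _) e.1.curve.continuousOn_fn
  set J : Set ℝ := {t : ℝ | f.lo < (t : EReal) ∧ (t : EReal) < f.hi} with hJ
  have hJo : J.OrdConnected :=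
    ⟨fun x hx y hy z hz => ⟨hx.1.trans_le (EReal.coe_le_coe_iff.2 hz.1),
      (EReal.coe_le_coe_iff.2 hz.2).trans_lt hy.2⟩⟩
  have htime := G.edge_time f hf
  have hID : timeDom f.lo f.hi ⊆ timeDom A B := fun t ht =>
    ⟨htime.1.trans ht.1, ht.2.trans htime.2⟩
  have hJI : J ⊆ timeDom f.lo f.hi := fun t ht => ⟨ht.1.le, ht.2.le⟩
  have hfc := f.curve.continuousOn_fn
  have heq : EqOn σ f.curve.fn J := by
    refine eqOn_of_eventually hJo.isPreconnected (hσ.cont.mono (hJI.trans hID)) (hfc.mono hJI)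
      ht₀ hσt ?_
    intro t ht hte
    have hc : Tendsto (fun s => (s, σ s)) (𝓝[J] t) (𝓝 (t, σ t)) :=
      (continuousWithinAt_id.prodMk ((hσ.cont.mono (hJI.trans hID)) t ht))
    have hn : (t, σ t) ∈ Oᶜ := by
      rw [hte]
      intro hmem
      rw [hO, mem_iUnion] at hmem
      obtain ⟨e, he⟩ := hmem
      refine G.not_mem_graph_of_mem_inner hf e.2.1 e.2.2.symm ?_ he
      rw [Curve.inner_eq]; exact mk_mem_seg ht
    filter_upwards [hc (hOc.isOpen_compl.mem_nhds hn), self_mem_nhdsWithin] with s hs hsJ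
    have h1 := h.points_subset n (hσ.mem s (hID (hJI hsJ)))
    unfold points at h1
    simp only [mem_iUnion] at h1
    obtain ⟨e, he, h1⟩ := h1
    by_cases hef : e = f
    · rw [hef, Curve.graph_eq] at h1
      exact h1.2
    · exact (hs (mem_iUnion.2 ⟨⟨e, he, hef⟩, h1⟩)).elim
  have heq' : EqOn σ f.curve.fn (timeDom f.lo f.hi) := by
    refine heq.of_subset_closure (hσ.cont.mono hID) hfc hJI ?_
    intro t ht
    rcases lt_trichotomy t t₀ with h1 | h1 | h1
    · have h3 : Ioo t t₀ ⊆ J := fun s hs =>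
        ⟨ht.1.trans_lt (EReal.coe_lt_coe_iff.2 hs.1), (EReal.coe_lt_coe_iff.2 hs.2).trans ht₀.2⟩
      refine closure_mono h3 ?_
      rw [closure_Ioo h1.ne]; exact ⟨le_rfl, h1.le⟩
    · subst h1; exact subset_closure ht₀
    · have h3 : Ioo t₀ t ⊆ J := fun s hs =>
        ⟨ht₀.1.trans (EReal.coe_lt_coe_iff.2 hs.1), (EReal.coe_lt_coe_iff.2 hs.2).trans_le ht.2⟩
      refine closure_mono h3 ?_
      rw [closure_Ioo h1.ne]; exact ⟨h1.le, le_rfl⟩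
  rintro ⟨t, x⟩ ⟨ht, hx⟩
  obtain rfl : x = f.curve.fn t := hx
  rw [← heq' ht]
  exact hσ.mem t (hID ht)

/-- A path of the graph over a bounded time interval runs in one of the graphs of the tower. -/
theorem exists_pathIn (h : IsTower T G) {c d : ℝ} {γ : ℝ → ℝ × ℝ}
    (hγ : PathIn G.points (Icc c d) γ) : ∃ n, PathIn (T n).points (Icc c d) γ := by
  have hK : IsCompact ((fun t => (t, γ t)) '' Icc c d) :=
    isCompact_Icc.image_of_continuousOn (continuousOn_id.prodMk hγ.cont)
  -- Only finitely many edges meet the compact image of the path, and the stages increase, so one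
  -- stage contains them all.
  have hfin := G.locallyFinite _ hK
  choose! N hN using fun f (hf : f ∈ G.edges) => h.exists_graph_subset hf
  obtain ⟨n, hn⟩ := (hfin.image N).bddAbove
  refine ⟨n, hγ.cont, fun t ht => ?_⟩
  have h1 := hγ.mem t ht
  unfold points at h1
  simp only [mem_iUnion] at h1
  obtain ⟨e, he, h1⟩ := h1
  exact h.isEarSeq.mono (hn ⟨e, ⟨he, _, h1, mem_image_of_mem _ ht⟩, rfl⟩) (hN e he h1)

/-- A new edge of a tower, and a path of the tower that is parallel to it, form a simple cell. -/
theorem isSimpleCell (h : IsTower T G) {n : ℕ} {e : Edge} (he : (T n).AddEdge (T (n + 1)) e)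
    {a b : ℝ} (ha : e.lo = (a : EReal)) (hb : e.hi = (b : EReal)) {π : ℝ → ℝ × ℝ}
    (hπ : PathIn (T n).points (Icc a b) π) (hπa : π a = e.curve.fn a) (hπb : π b = e.curve.fn b)
    {γ₁ γ₂ : Curve (a : EReal) (b : EReal)} (h₁ : EqOn γ₁.fn e.curve.fn (Icc a b))
    (h₂ : EqOn γ₂.fn π (Icc a b)) : G.IsSimpleCell γ₁ γ₂ := by
  obtain ⟨a', b', -, -, ha', hb', hear, hpts⟩ := h.isEar he
  obtain rfl : a = a' := EReal.coe_injective (ha.symm.trans ha')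
  obtain rfl : b = b' := EReal.coe_injective (hb.symm.trans hb')
  have hab := hear.lt
  have hseg : seg e.curve.fn (Icc a b) ⊆ (T (n + 1)).points := by
    rw [hpts]; exact subset_union_right
  have heP : PathIn (T (n + 1)).points (Icc a b) e.curve.fn :=
    ⟨hear.cont, fun t ht => hseg (mk_mem_seg ht)⟩
  have hπP : PathIn (T (n + 1)).points (Icc a b) π :=
    hπ.mono (by rw [hpts]; exact subset_union_left) Subset.rfl
  have hae : a ∈ Icc a b := ⟨le_rfl, hab.le⟩
  have hbe : b ∈ Icc a b := ⟨hab.le, le_rfl⟩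
  have hmemE : e ∈ (T (n + 1)).edges := by rw [he.2.2.2]; exact Or.inl rfl
  have hverts : ∀ t : ℝ, t = a ∨ t = b → (t, e.curve.fn t) ∈ G.verts := by
    intro t ht
    have htm : t ∈ timeDom e.lo e.hi := by
      rw [ha, hb, timeDom_coe]; rcases ht with rfl | rfl <;> assumption
    have h1 := (T (n + 1)).edge_ends e hmemE ⟨t, htm⟩ (by
      rcases ht with rfl | rfl
      · exact Or.inl ha.symm
      · exact Or.inr hb.symm)
    have h2 : Curve.pt e.curve ⟨t, htm⟩ = (t, e.curve.fn t) :=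
      Prod.ext rfl (e.curve.fn_mk htm).symm
    rw [← h2]
    exact h.verts_subset _ h1
  have hend : ∀ t : timeDom (a : EReal) (b : EReal), IsEndTime t → (t : ℝ) = a ∨ (t : ℝ) = b :=
    fun t ht => ht.imp (fun h => EReal.coe_injective h) (fun h => EReal.coe_injective h)
  have hπe : ∀ t : ℝ, t = a ∨ t = b → π t = e.curve.fn t := by
    rintro t (rfl | rfl) <;> assumption
  have hpath : ∀ (γ : Curve (a : EReal) (b : EReal)) (f : ℝ → ℝ × ℝ),
      EqOn γ.fn f (Icc a b) → PathIn (T (n + 1)).points (Icc a b) f →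
      (∀ t : ℝ, t = a ∨ t = b → f t = e.curve.fn t) → G.IsTimePath γ := by
    intro γ f hγ hf hfe
    refine ⟨EReal.coe_lt_coe_iff.2 hab, ?_, fun t ht => ?_⟩
    · rw [Curve.graph_subset_iff_pathIn, timeDom_coe]
      exact (hf.congr hγ).mono (h.points_subset _) Subset.rfl
    · have htm : (t : ℝ) ∈ Icc a b := by rw [← timeDom_coe]; exact t.2
      have h2 : Curve.pt γ t = ((t : ℝ), e.curve.fn t) :=
        Prod.ext rfl ((γ.fn_coe t).symm.trans ((hγ htm).trans (hfe _ (hend t ht))))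
      rw [h2]
      exact hverts _ (hend t ht)
  have hin₁ : Curve.inner γ₁ = seg e.curve.fn (Ioo a b) := by
    have : {t : ℝ | (a : EReal) < (t : EReal) ∧ (t : EReal) < (b : EReal)} = Ioo a b := by
      ext; simp
    rw [Curve.inner_eq, this]
    exact seg_congr (h₁.mono Ioo_subset_Icc_self)
  have hin₂ : Curve.inner γ₂ = seg π (Ioo a b) := by
    have : {t : ℝ | (a : EReal) < (t : EReal) ∧ (t : EReal) < (b : EReal)} = Ioo a b := by
      ext; simp
    rw [Curve.inner_eq, this]
    exact seg_congr (h₂.mono Ioo_subset_Icc_self)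
  have hmeet : ∀ t ∈ Ioo a b, e.curve.fn t ≠ π t := fun t ht heq =>
    hear.not_mem t ht (heq ▸ hπ.mem t (Ioo_subset_Icc_self ht))
  -- no path joins an interior point of the edge and an interior point of `π`
  have hno : ∀ (c d : ℝ) (γ : ℝ → ℝ × ℝ), PathIn G.points (Icc c d) γ → ∀ s ∈ Icc c d,
      ∀ t ∈ Icc c d, (s, γ s) ∈ seg e.curve.fn (Ioo a b) → (t, γ t) ∉ seg π (Ioo a b) := by
    rintro c d γ hγ s hs t ht ⟨hs1, hs2⟩ ⟨ht1, ht2⟩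
    obtain ⟨k, hk⟩ := h.exists_pathIn hγ
    -- Retracting the connecting path to stage `n + 1` fixes its two given points. At that stage a
    -- path through the interior of the new edge stays on it during `[a, b]`, and the edge does not
    -- meet `π` in between.
    obtain ⟨r, hr⟩ := (h.isEarSeq.isTimeRetract (le_max_right k (n + 1))).exists_retraction
    have hk' := hk.mono (h.isEarSeq.mono (le_max_left k (n + 1))) Subset.rfl
    have hγ' := hr.pathIn hk'
    simp only at hs1 hs2 ht1 ht2 hγ'
    have h3 : mapPath r γ s = e.curve.fn s := by
      rw [hr.mapPath_eq (by rw [hs2]; exact heP.mem s (Ioo_subset_Icc_self hs1)), hs2]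
    have h4 : mapPath r γ t = π t := by
      rw [hr.mapPath_eq (by rw [ht2]; exact hπP.mem t (Ioo_subset_Icc_self ht1)), ht2]
    rw [hpts] at hγ'
    have h5 := (hear.isStrand (h.isEarSeq.isClosed n)).eqOn ordConnected_Icc hγ' hs hs1 h3
      ⟨ht, Ioo_subset_Icc_self ht1⟩
    exact hmeet t ht1 (h5.symm.trans h4)
  refine ⟨hpath γ₁ _ h₁ heP (fun _ _ => rfl), hpath γ₂ _ h₂ hπP hπe, fun t ht => ?_, ?_, ?_⟩
  · have htm : (t : ℝ) ∈ Icc a b := by rw [← timeDom_coe]; exact t.2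
    rw [← Curve.fn_coe, ← Curve.fn_coe, h₁ htm, h₂ htm, hπe _ (hend t ht)]
  · rw [hin₁, hin₂, disjoint_left]
    rintro p ⟨h3, h4⟩ ⟨-, h5⟩
    exact hmeet _ h3 (h4.symm.trans h5)
  · rintro c d ρ hρ ⟨x, hxc⟩ ⟨y, hyc⟩ hx hy
    simp only at hx hy
    subst hx hy
    have hρP := Curve.graph_subset_iff_pathIn.1 hρ.2.1
    rw [timeDom_coe] at hρP
    have hxm : x ∈ Icc x y := by rw [← timeDom_coe]; exact hxc
    have hym : y ∈ Icc x y := by rw [← timeDom_coe]; exact hyc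
    have hxp : Curve.pt ρ ⟨x, hxc⟩ = (x, ρ.fn x) := Prod.ext rfl (ρ.fn_mk hxc).symm
    have hyp : Curve.pt ρ ⟨y, hyc⟩ = (y, ρ.fn y) := Prod.ext rfl (ρ.fn_mk hyc).symm
    rw [hxp, hyp, hin₁, hin₂]
    exact ⟨fun h3 => hno _ _ _ hρP _ hxm _ hym h3.1 h3.2,
      fun h3 => hno _ _ _ hρP _ hym _ hxm h3.2 h3.1⟩

end IsTower

end TimeLikeGraph

/-! ### Conditional distributions given by a kernel -/

section Kernels

variable {Ω Ω' 𝓩 𝓦 𝓥 : Type*} [MeasurableSpace 𝓩] [MeasurableSpace 𝓦] [MeasurableSpace 𝓥]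

/-- Given `Z`, the random element `W` has the conditional distribution `κ V`. -/
def HasKernel [MeasurableSpace Ω] (P : Measure Ω) (Z : Ω → 𝓩) (W : Ω → 𝓦) (V : Ω → 𝓥)
    (κ : Kernel 𝓥 𝓦) : Prop :=
  ∀ C D, MeasurableSet C → MeasurableSet D →
    P (Z ⁻¹' C ∩ W ⁻¹' D) = ∫⁻ ω in Z ⁻¹' C, κ (V ω) D ∂P

theorem sigmaOf_le [MeasurableSpace Ω] {Z : Ω → 𝓩} (hZ : Measurable Z) :
    sigmaOf Z ≤ ‹MeasurableSpace Ω› := hZ.comap_le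

theorem sigmaOf_comp_le {Z : Ω → 𝓩} {f : 𝓩 → 𝓦} (hf : Measurable f) :
    sigmaOf (fun ω => f (Z ω)) ≤ sigmaOf Z := by
  rintro _ ⟨s, hs, rfl⟩
  exact ⟨f ⁻¹' s, hf hs, rfl⟩

variable [MeasurableSpace Ω] [MeasurableSpace Ω'] {P : Measure Ω} {P' : Measure Ω'}
  {Z : Ω → 𝓩} {W : Ω → 𝓦} {V : Ω → 𝓥} {κ : Kernel 𝓥 𝓦}

/-- Passes from almost sure equalities to integrals over rectangles. The latter depend on joint laws
only and can be compared between different probability spaces. -/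
theorem IsCondDistribGiven.hasKernel [IsProbabilityMeasure P] [IsMarkovKernel κ]
    (hZ : Measurable Z) (hW : Measurable W) (hV : Measurable V)
    (h : IsCondDistribGiven P W Z fun ω => κ (V ω)) : HasKernel P Z W V κ := by
  intro C D hC hD
  have hκ : Measurable fun ω => κ (V ω) D := (κ.measurable_coe hD).comp hV
  have h1 : P.real (Z ⁻¹' C ∩ W ⁻¹' D) = ∫ ω in Z ⁻¹' C, (κ (V ω)).real D ∂P := by
    have e1 := setIntegral_condExp (sigmaOf_le hZ)
      (integrable_indicator_one P (hW hD)) (s := Z ⁻¹' C) ⟨C, hC, rfl⟩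
    rw [setIntegral_congr_ae (hZ hC) ((h D hD).mono fun ω hω _ => hω)] at e1
    rw [e1, setIntegral_indicator (hW hD), setIntegral_const]
    simp
  have h2 : ∫ ω in Z ⁻¹' C, (κ (V ω)).real D ∂P
      = (∫⁻ ω in Z ⁻¹' C, κ (V ω) D ∂P).toReal :=
    integral_toReal hκ.aemeasurable (ae_of_all _ fun ω => measure_lt_top _ _)
  have h3 : ∫⁻ ω in Z ⁻¹' C, κ (V ω) D ∂P ≠ ⊤ := by
    refine ne_top_of_le_ne_top (measure_ne_top P univ) ?_
    refine (setLIntegral_le_lintegral _ _).trans ((lintegral_mono fun ω => prob_le_one).trans ?_)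
    simp
  exact (ENNReal.toReal_eq_toReal_iff' (measure_ne_top _ _) h3).1 (h1.trans h2)

theorem HasKernel.isCondDistribGiven [IsProbabilityMeasure P] [IsMarkovKernel κ]
    (hW : Measurable W) (hV : Measurable V)
    (h : HasKernel P V W V κ) : IsCondDistribGiven P W V fun ω => κ (V ω) := by
  intro D hD
  have hκV : Measurable[sigmaOf V] fun ω => κ (V ω) D :=
    (κ.measurable_coe hD).comp (comap_measurable V)
  have hκ : Measurable fun ω => κ (V ω) D := (κ.measurable_coe hD).comp hV
  have hint : Integrable (fun ω => (κ (V ω)).real D) P := by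
    refine Integrable.of_bound hκ.ennreal_toReal.aestronglyMeasurable 1 (ae_of_all _ fun ω => ?_)
    rw [Real.norm_of_nonneg measureReal_nonneg]
    exact measureReal_le_one
  symm
  refine ae_eq_condExp_of_forall_setIntegral_eq (sigmaOf_le hV) (integrable_indicator_one P (hW hD))
    (fun s _ _ => hint.integrableOn) ?_ ?_
  · rintro _ ⟨C, hC, rfl⟩ _
    rw [setIntegral_indicator (hW hD), setIntegral_const]
    have h2 : ∫ ω in V ⁻¹' C, (κ (V ω)).real D ∂P
        = (∫⁻ ω in V ⁻¹' C, κ (V ω) D ∂P).toReal :=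
      integral_toReal hκ.aemeasurable (ae_of_all _ fun ω => measure_lt_top _ _)
    rw [h2, ← h C D hC hD]
    simp [measureReal_def]
  · exact (hκV.ennreal_toReal.stronglyMeasurable).aestronglyMeasurable

/-- Conditional independence allows the larger `Z` to replace `V` as the condition without a change
of the kernel. -/
theorem HasKernel.of_condIndepOf [IsProbabilityMeasure P] [IsMarkovKernel κ]
    (hZ : Measurable Z) (hW : Measurable W) (hV : Measurable V)
    (hVZ : sigmaOf V ≤ sigmaOf Z) (hci : CondIndepOf P (sigmaOf W) (sigmaOf Z) (sigmaOf V))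
    (h : HasKernel P V W V κ) : HasKernel P Z W V κ := by
  refine IsCondDistribGiven.hasKernel hZ hW hV fun D hD => ?_
  have h1 := hci (W ⁻¹' D) ⟨D, hD, rfl⟩
  rw [sup_of_le_right hVZ] at h1
  exact h1.trans (h.isCondDistribGiven hW hV D hD)

/-- A conditional probability given `Z` that is measurable for `V` is, by the tower property, also
the one given `V`. -/
theorem IsCondDistribGiven.condIndepOf [IsProbabilityMeasure P] [IsMarkovKernel κ]
    (hZ : Measurable Z) (hV : Measurable V)
    (hVZ : sigmaOf V ≤ sigmaOf Z)
    (h : IsCondDistribGiven P W Z fun ω => κ (V ω)) :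
    CondIndepOf P (sigmaOf W) (sigmaOf Z) (sigmaOf V) := by
  rintro _ ⟨D, hD, rfl⟩
  rw [sup_of_le_right hVZ]
  have hκV : Measurable[sigmaOf V] fun ω => κ (V ω) D :=
    (κ.measurable_coe hD).comp (comap_measurable V)
  have hκ : Measurable fun ω => κ (V ω) D := (κ.measurable_coe hD).comp hV
  have hint : Integrable (fun ω => (κ (V ω)).real D) P := by
    refine Integrable.of_bound hκ.ennreal_toReal.aestronglyMeasurable 1 (ae_of_all _ fun ω => ?_)
    rw [Real.norm_of_nonneg measureReal_nonneg]
    exact measureReal_le_one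
  have h1 := (condExp_condExp_of_le (μ := P) (f := (W ⁻¹' D).indicator fun _ => (1 : ℝ)) hVZ
    (sigmaOf_le hZ)).symm.trans (condExp_congr_ae (m := sigmaOf V) (h D hD))
  have h2 : P[fun ω => (κ (V ω)).real D | sigmaOf V] = fun ω => (κ (V ω)).real D :=
    condExp_of_stronglyMeasurable (sigmaOf_le hV) hκV.ennreal_toReal.stronglyMeasurable hint
  rw [h2] at h1
  exact (h D hD).trans h1.symm

theorem HasKernel.comp {𝓩' : Type*} [MeasurableSpace 𝓩'] (h : HasKernel P Z W V κ) {f : 𝓩 → 𝓩'}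
    (hf : Measurable f) : HasKernel P (fun ω => f (Z ω)) W V κ :=
  fun C D hC hD => h (f ⁻¹' C) D (hf hC) hD

/-- On rectangles both laws are integrals of the same function with respect to the common law of `Z`
and `Z'`. -/
theorem HasKernel.map_prod_eq [IsProbabilityMeasure P] {Z' : Ω' → 𝓩} {W' : Ω' → 𝓦} {v : 𝓩 → 𝓥} (hv : Measurable v)
    (hZ : Measurable Z) (hW : Measurable W) (hZ' : Measurable Z') (hW' : Measurable W')
    (h : HasKernel P Z W (fun ω => v (Z ω)) κ) (h' : HasKernel P' Z' W' (fun ω => v (Z' ω)) κ)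
    (hlaw : P.map Z = P'.map Z') :
    P.map (fun ω => (Z ω, W ω)) = P'.map (fun ω => (Z' ω, W' ω)) := by
  have := Measure.isProbabilityMeasure_map (μ := P) (hZ.prodMk hW).aemeasurable
  refine Measure.ext_prod fun {C D} hC hD => ?_
  have hκ : Measurable fun z => κ (v z) D := (κ.measurable_coe hD).comp hv
  rw [Measure.map_apply (hZ.prodMk hW) (hC.prod hD), Measure.map_apply (hZ'.prodMk hW') (hC.prod hD)]
  have h1 : (fun ω => (Z ω, W ω)) ⁻¹' (C ×ˢ D) = Z ⁻¹' C ∩ W ⁻¹' D := rfl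
  have h2 : (fun ω => (Z' ω, W' ω)) ⁻¹' (C ×ˢ D) = Z' ⁻¹' C ∩ W' ⁻¹' D := rfl
  rw [h1, h2, h C D hC hD, h' C D hC hD, ← setLIntegral_map hC hκ hZ, ← setLIntegral_map hC hκ hZ',
    hlaw]

theorem HasKernel.of_map_eq {W' : Ω' → 𝓦} {v : 𝓦 → 𝓥} (hv : Measurable v)
    (hW : Measurable W) (hW' : Measurable W') (hlaw : P.map W = P'.map W')
    (h : HasKernel P (fun ω => v (W ω)) W (fun ω => v (W ω)) κ) :
    HasKernel P' (fun ω => v (W' ω)) W' (fun ω => v (W' ω)) κ := by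
  intro C D hC hD
  have hκ : Measurable fun z => κ (v z) D := (κ.measurable_coe hD).comp hv
  have h1 : P (W ⁻¹' (v ⁻¹' C ∩ D)) = ∫⁻ ω in W ⁻¹' (v ⁻¹' C), κ (v (W ω)) D ∂P := h C D hC hD
  rw [← Measure.map_apply hW ((hv hC).inter hD), ← setLIntegral_map (hv hC) hκ hW, hlaw,
    Measure.map_apply hW' ((hv hC).inter hD), setLIntegral_map (hv hC) hκ hW'] at h1
  exact h1

theorem CondIndepGiven.condIndepOf [IsProbabilityMeasure P] {U : Ω → 𝓩} (hU : Measurable U) (hW : Measurable W)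
    (hV : Measurable V) (h : CondIndepGiven P U W V) :
    CondIndepOf P (sigmaOf U) (sigmaOf W) (sigmaOf V) := by
  refine .of_mul (sigmaOf_le hU) (sigmaOf_le hW) (sigmaOf_le hV) ?_
  rintro _ _ ⟨C, hC, rfl⟩ ⟨D, hD, rfl⟩
  exact h C D hC hD

end Kernels

/-! ### Transport of conditional independence and generated σ-algebras -/

theorem condExp_map_comp {Ω Ω' : Type*} {m : MeasurableSpace Ω'} [MeasurableSpace Ω]
    [m' : MeasurableSpace Ω'] {P : Measure Ω} [IsFiniteMeasure P] {X : Ω → Ω'} (hX : Measurable X)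
    (hm : m ≤ m') {f : Ω' → ℝ} (hf : Integrable f (P.map X)) :
    (fun ω => ((P.map X)[f | m]) (X ω)) =ᵐ[P] P[fun ω => f (X ω) | m.comap X] := by
  have hm' : m.comap X ≤ ‹MeasurableSpace Ω› :=
    (MeasurableSpace.comap_mono hm).trans hX.comap_le
  have hce : StronglyMeasurable[m] ((P.map X)[f | m]) := stronglyMeasurable_condExp
  have hint : Integrable (fun ω => ((P.map X)[f | m]) (X ω)) P :=
    (integrable_condExp (μ := P.map X) (f := f) (m := m)).comp_measurable hX
  refine ae_eq_condExp_of_forall_setIntegral_eq hm' (hf.comp_measurable hX)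
    (fun s _ _ => hint.integrableOn) ?_ ?_
  · rintro _ ⟨s, hs, rfl⟩ _
    rw [← setIntegral_map (hm s hs) integrable_condExp.aestronglyMeasurable hX.aemeasurable,
      ← setIntegral_map (hm s hs) hf.aestronglyMeasurable hX.aemeasurable,
      setIntegral_condExp hm hf hs]
  · exact (hce.comp_measurable (comap_measurable (m := m) X)).aestronglyMeasurable

theorem CondIndepGiven.comp {Ω Ω' 𝓤 𝓦 𝓩 : Type*} [MeasurableSpace Ω] [MeasurableSpace Ω']
    [MeasurableSpace 𝓤] [MeasurableSpace 𝓦] [MeasurableSpace 𝓩] {P : Measure Ω} [IsFiniteMeasure P]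
    {X : Ω → Ω'} (hX : Measurable X) {U : Ω' → 𝓤} {W : Ω' → 𝓦} {Z : Ω' → 𝓩} (hU : Measurable U)
    (hW : Measurable W) (hZ : Measurable Z) (h : CondIndepGiven (P.map X) U W Z) :
    CondIndepGiven P (fun ω => U (X ω)) (fun ω => W (X ω)) (fun ω => Z (X ω)) := by
  intro C D hC hD
  have e : sigmaOf (fun ω => Z (X ω)) = (sigmaOf Z).comap X := by
    rw [sigmaOf, sigmaOf, MeasurableSpace.comap_comp]; rfl
  have key : ∀ s : Set Ω', MeasurableSet s →
      P⟦X ⁻¹' s | sigmaOf (fun ω => Z (X ω))⟧ =ᵐ[P] fun ω => ((P.map X)⟦s | sigmaOf Z⟧) (X ω) := by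
    intro s hs
    rw [e]
    exact (condExp_map_comp hX (sigmaOf_le hZ) (integrable_indicator_one _ hs)).symm
  have h1 := ae_of_ae_map hX.aemeasurable (h C D hC hD)
  filter_upwards [h1, key _ ((hU hC).inter (hW hD)), key _ (hU hC), key _ (hW hD)]
    with ω a1 a2 a3 a4
  have e1 : (fun ω => U (X ω)) ⁻¹' C ∩ (fun ω => W (X ω)) ⁻¹' D = X ⁻¹' (U ⁻¹' C ∩ W ⁻¹' D) := rfl
  have e2 : (fun ω => U (X ω)) ⁻¹' C = X ⁻¹' (U ⁻¹' C) := rfl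
  have e3 : (fun ω => W (X ω)) ⁻¹' D = X ⁻¹' (W ⁻¹' D) := rfl
  rw [e1, e2, e3, a2, a3, a4, a1]

theorem sigmaOf_pi {Ω ι : Type*} (Z : ι → Ω → ℝ) :
    sigmaOf (fun ω i => Z i ω) = ⨆ i, MeasurableSpace.comap (Z i) inferInstance := by
  simp only [sigmaOf, MeasurableSpace.pi, MeasurableSpace.comap_iSup, MeasurableSpace.comap_comp]
  rfl

theorem sigmaOf_eq_sigmaOn {Ω ι : Type*} {Z : ι → Ω → ℝ} {Y : Point → Ω → ℝ} {p : ι → Point}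
    (h : ∀ i, Z i = Y (p i)) : sigmaOf (fun ω i => Z i ω) = sigmaOn Y (range p) := by
  rw [sigmaOf_pi, sigmaOn, iSup_range]
  exact iSup_congr fun i => by rw [h i]

theorem sigmaOf_prodMk {Ω : Type*} {Y : Point → Ω → ℝ} {p q : Point} :
    sigmaOf (fun ω => (Y p ω, Y q ω)) = sigmaOn Y {p, q} := by
  rw [sigmaOn, iSup_pair, sigmaOf]
  exact MeasurableSpace.comap_prodMk _ _

theorem measurable_setRestrict {ι : Type*} (J : Set ι) :
    Measurable (J.domRestrict : (ι → ℝ) → J → ℝ) :=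
  measurable_pi_lambda _ fun i => measurable_pi_apply i.1

/-- A function is a measurable function of its two restrictions; `J` and `K` may overlap. -/
theorem measure_eq_of_map_restrict_eq {ι : Type*} {J K : Set ι} (h : J ∪ K = univ)
    {ν₁ ν₂ : Measure (ι → ℝ)}
    (h' : ν₁.map (fun y => (J.domRestrict y, K.domRestrict y)) =
      ν₂.map (fun y => (J.domRestrict y, K.domRestrict y))) : ν₁ = ν₂ := by
  classical
  have hK : ∀ i, i ∉ J → i ∈ K := fun i hi => ((h ▸ mem_univ i : i ∈ J ∪ K)).resolve_left hi
  let f : (J → ℝ) × (K → ℝ) → ι → ℝ := fun u i =>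
    if hi : i ∈ J then u.1 ⟨i, hi⟩ else u.2 ⟨i, hK i hi⟩
  have hf : Measurable f := by
    refine measurable_pi_lambda _ fun i => ?_
    by_cases hi : i ∈ J
    · simp only [f, hi, dif_pos]
      exact (measurable_pi_apply _).comp measurable_fst
    · simp only [f, hi, dif_neg, not_false_eq_true]
      exact (measurable_pi_apply _).comp measurable_snd
  have hg : Measurable fun y : ι → ℝ => (J.domRestrict y, K.domRestrict y) :=
    (measurable_setRestrict J).prodMk (measurable_setRestrict K)
  have hid : f ∘ (fun y : ι → ℝ => (J.domRestrict y, K.domRestrict y)) = id := by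
    funext y i
    by_cases hi : i ∈ J <;> simp [f, hi, Set.domRestrict]
  have := congrArg (Measure.map f) h'
  rwa [Measure.map_map hf hg, Measure.map_map hf hg, hid, Measure.map_id, Measure.map_id] at this

/-! ### The law and the Markov property of a constructed process -/

namespace TimeLikeGraph

variable {A B : EReal} {G : TimeLikeGraph A B} {T : ℕ → TimeLikeGraph A B}
  {μ : G.FullPath → Measure (timeDom A B → ℝ)}

theorem IsThreeTFamily.isProbabilityMeasure (hμ : G.IsThreeTFamily μ) (σ : G.FullPath) :
    IsProbabilityMeasure (μ σ) := by
  obtain ⟨ρ, h1, h2⟩ := hμ.rcll σ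
  rw [← h2]
  exact Measure.isProbabilityMeasure_map measurable_subtype_coe.aemeasurable

theorem FullPath.curve_eq_iff {σ₁ σ₂ : G.FullPath} {t : timeDom A B} :
    σ₁.curve t = σ₂.curve t ↔ σ₁.fn t = σ₂.fn t := by
  unfold FullPath.fn
  rw [Curve.fn_coe, Curve.fn_coe]

/-- The distributions along two paths have the same restrictions to times at which the paths
agree. -/
theorem IsThreeTFamily.map_restrict_eq (hμ : G.IsThreeTFamily μ) {σ₁ σ₂ : G.FullPath}
    {J : Set (timeDom A B)} (h : ∀ t ∈ J, σ₁.fn t = σ₂.fn t) :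
    (μ σ₁).map J.domRestrict = (μ σ₂).map J.domRestrict := by
  have hJ : J ⊆ {t | σ₁.curve t = σ₂.curve t} := fun t ht => FullPath.curve_eq_iff.2 (h t ht)
  let f : (({t | σ₁.curve t = σ₂.curve t} : Set (timeDom A B)) → ℝ) → J → ℝ :=
    fun y i => y ⟨i.1, hJ i.2⟩
  have hf : Measurable f := measurable_pi_lambda _ fun i => measurable_pi_apply _
  have := congrArg (Measure.map f) (hμ.consistent σ₁ σ₂)
  rwa [Measure.map_map hf (measurable_setRestrict _),
    Measure.map_map hf (measurable_setRestrict _)] at this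

theorem timeDom_edge {e : Edge} {a b : ℝ} (ha : e.lo = (a : EReal)) (hb : e.hi = (b : EReal)) :
    timeDom e.lo e.hi = Icc a b := by
  rw [ha, hb, timeDom_coe]

section ProcessLaw

variable {Ω : Type*} [MeasurableSpace Ω] {P : Measure Ω} {X : G.points → Ω → ℝ}

open Classical in
/-- The process `X`, extended by `0` to all points of the space. -/
noncomputable def extend (X : G.points → Ω → ℝ) (p : Point) : Ω → ℝ :=
  if h : p ∈ G.points then X ⟨p, h⟩ else fun _ => 0

omit [MeasurableSpace Ω] in
theorem extend_coe (X : G.points → Ω → ℝ) (p : G.points) : X p = extend X p := by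
  unfold extend
  rw [dif_pos p.2]

theorem measurable_extend (hX : ∀ p, Measurable (X p)) (p : Point) : Measurable (extend X p) := by
  unfold extend
  split_ifs
  · exact hX _
  · exact measurable_const

omit [MeasurableSpace Ω] in
theorem extend_point (X : G.points → Ω → ℝ) (σ : G.FullPath) (t : timeDom A B) :
    X (σ.point t) = extend X ((t : ℝ), σ.fn t) := by
  rw [extend_coe X (σ.point t), ← σ.pt_eq]; rfl

omit [MeasurableSpace Ω] in
theorem alongPath_apply (X : G.points → Ω → ℝ) (σ : G.FullPath) (ω : Ω) (t : timeDom A B) :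
    alongPath X σ ω t = extend X ((t : ℝ), σ.fn t) ω :=
  congrFun (extend_point X σ t) ω

theorem measurable_alongPath (hX : ∀ p, Measurable (X p)) (σ : G.FullPath) :
    Measurable (alongPath X σ) :=
  measurable_pi_lambda _ fun _ => hX _

theorem measurable_restrictTo (hX : ∀ p, Measurable (X p)) (H : TimeLikeGraph A B) :
    Measurable (restrictTo X H) :=
  measurable_pi_lambda _ fun _ => hX _

omit [MeasurableSpace Ω] in
theorem restrict_alongPath_eq (X : G.points → Ω → ℝ) {σ τ : G.FullPath} {J : Set (timeDom A B)}
    (h : ∀ t ∈ J, σ.fn t = τ.fn t) (ω : Ω) :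
    J.domRestrict (alongPath X σ ω) = J.domRestrict (alongPath X τ ω) := by
  funext t
  simp only [Set.domRestrict, alongPath_apply, h t.1 t.2]

omit [MeasurableSpace Ω] in
theorem sigmaOf_restrict_alongPath (X : G.points → Ω → ℝ) (σ : G.FullPath)
    (J : Set (timeDom A B)) :
    sigmaOf (fun ω => J.domRestrict (alongPath X σ ω)) =
      sigmaOn (extend X) (seg σ.fn (Subtype.val '' J)) := by
  have h := sigmaOf_eq_sigmaOn (Z := fun (t : J) => X (σ.point t.1)) (Y := extend X)
    (p := fun t => ((t.1 : ℝ), σ.fn t.1)) (fun t => extend_point X σ t.1)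
  have h1 : range (fun t : J => (((t.1 : ℝ), σ.fn t.1) : Point)) =
      seg σ.fn (Subtype.val '' J) := by
    ext p
    constructor
    · rintro ⟨t, rfl⟩; exact ⟨⟨t.1, t.2, rfl⟩, rfl⟩
    · rintro ⟨⟨t, ht, h2⟩, h3⟩
      exact ⟨⟨t, ht⟩, Prod.ext h2 (by rw [h3, ← h2])⟩
  rw [h1] at h
  exact h

omit [MeasurableSpace Ω] in
theorem sigmaOf_restrictTo (X : G.points → Ω → ℝ) {H : TimeLikeGraph A B}
    (hH : H.points ⊆ G.points) :
    sigmaOf (restrictTo X H) = sigmaOn (extend X) H.points := by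
  have h := sigmaOf_eq_sigmaOn (Z := fun (p : {p : G.points | (p : Point) ∈ H.points}) => X p.1)
    (Y := extend X) (p := fun p => p.1.1) (fun p => extend_coe X p.1)
  have h1 : range (fun p : {p : G.points | (p : Point) ∈ H.points} => p.1.1) = H.points := by
    ext p
    constructor
    · rintro ⟨q, rfl⟩; exact q.2
    · intro hp; exact ⟨⟨⟨p, hH hp⟩, hp⟩, rfl⟩
  rw [h1] at h
  exact h

omit [MeasurableSpace Ω] in
theorem sigmaOf_alongPath_pair (X : G.points → Ω → ℝ) (σ : G.FullPath) (a b : timeDom A B) :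
    sigmaOf (fun ω => (alongPath X σ ω a, alongPath X σ ω b)) =
      sigmaOn (extend X) {((a : ℝ), σ.fn a), ((b : ℝ), σ.fn b)} := by
  rw [← sigmaOf_prodMk]
  congr 1
  funext ω
  rw [alongPath_apply, alongPath_apply]

theorem image_val_Icc (a b : timeDom A B) :
    (Subtype.val '' Icc a b : Set ℝ) = Icc (a : ℝ) b := by
  ext t
  constructor
  · rintro ⟨s, hs, rfl⟩; exact hs
  · intro ht; exact ⟨⟨t, (ordConnected_timeDom A B).out a.2 b.2 ht⟩, ht, rfl⟩

theorem image_val_compl (a b : timeDom A B) :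
    (Subtype.val '' (Iic a ∪ Ici b) : Set ℝ) = timeDom A B \ Ioo (a : ℝ) b := by
  ext t
  constructor
  · rintro ⟨s, hs, rfl⟩
    refine ⟨s.2, fun h => ?_⟩
    rcases hs with hs | hs
    · exact not_lt.2 hs h.1
    · exact not_lt.2 hs h.2
  · rintro ⟨ht, hn⟩
    refine ⟨⟨t, ht⟩, ?_, rfl⟩
    by_contra hc
    rw [mem_union, not_or] at hc
    exact hn ⟨not_le.1 hc.1, not_le.1 hc.2⟩

/-- If `e` is a new edge of the tower, then the 3T property holds along each full path that contains
`e` or a path that is parallel to `e` in the tower. -/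
theorem IsTower.condIndepGiven (hT : IsTower T G) (hμ : G.IsThreeTFamily μ) {n : ℕ} {e : Edge}
    (he : (T n).AddEdge (T (n + 1)) e) {a b : timeDom A B} (ha : e.lo = ((a : ℝ) : EReal))
    (hb : e.hi = ((b : ℝ) : EReal)) {π : ℝ → ℝ × ℝ} (hπ : PathIn (T n).points (Icc (a : ℝ) b) π)
    (hπa : π a = e.curve.fn a) (hπb : π b = e.curve.fn b) (σ : G.FullPath)
    (hσ : EqOn σ.fn e.curve.fn (Icc (a : ℝ) b) ∨ EqOn σ.fn π (Icc (a : ℝ) b)) :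
    CondIndepGiven (μ σ) (Iic a ∪ Ici b).domRestrict (Icc a b).domRestrict
      (fun y => (y a, y b)) := by
  have hec : ContinuousOn e.curve.fn (timeDom ((a : ℝ) : EReal) ((b : ℝ) : EReal)) := by
    rw [← ha, ← hb]; exact e.curve.continuousOn_fn
  have hπc : ContinuousOn π (timeDom ((a : ℝ) : EReal) ((b : ℝ) : EReal)) := by
    rw [timeDom_coe]; exact hπ.cont
  have h1 : EqOn (Curve.ofFn e.curve.fn hec).fn e.curve.fn (Icc (a : ℝ) b) := by
    rw [← timeDom_coe]; exact Curve.fn_ofFn _ hec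
  have h2 : EqOn (Curve.ofFn π hπc).fn π (Icc (a : ℝ) b) := by
    rw [← timeDom_coe]; exact Curve.fn_ofFn _ hπc
  have hsub : timeDom ((a : ℝ) : EReal) ((b : ℝ) : EReal) ⊆ timeDom A B := by
    rw [timeDom_coe]; exact (ordConnected_timeDom A B).out a.2 b.2
  refine hμ.cell a b (Curve.ofFn e.curve.fn hec) (Curve.ofFn π hπc)
    (hT.isSimpleCell he ha hb hπ hπa hπb h1 h2) σ ?_
  rcases hσ with h3 | h3
  · refine Or.inl (Curve.graph_subset_iff.2 ⟨hsub, ?_⟩)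
    rw [timeDom_coe]
    exact h1.trans h3.symm
  · refine Or.inr (Curve.graph_subset_iff.2 ⟨hsub, ?_⟩)
    rw [timeDom_coe]
    exact h2.trans h3.symm

theorem measurable_pair {ι : Type*} (a b : ι) : Measurable fun y : ι → ℝ => (y a, y b) :=
  (measurable_pi_apply a).prodMk (measurable_pi_apply b)

/-- The conditional distribution between the times `a` and `b` depends on the distribution on
`[a, b]` only. -/
theorem hasKernel_of_map_restrict_eq {ν ν' : Measure (timeDom A B → ℝ)} [IsProbabilityMeasure ν]
    {a b : timeDom A B} (hab : a ≤ b) {κ : Kernel (ℝ × ℝ) (Icc a b → ℝ)} [IsMarkovKernel κ]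
    (h : IsCondDistribGiven ν (Icc a b).domRestrict (fun y => (y a, y b)) fun y => κ (y a, y b))
    (hlaw : ν.map (Icc a b).domRestrict = ν'.map (Icc a b).domRestrict) :
    HasKernel ν' (fun y => (y a, y b)) (Icc a b).domRestrict (fun y => (y a, y b)) κ := by
  have h1 : HasKernel ν (fun y => (y a, y b)) (Icc a b).domRestrict (fun y => (y a, y b)) κ :=
    h.hasKernel (measurable_pair a b) (measurable_setRestrict _) (measurable_pair a b)
  exact HasKernel.of_map_eq (v := fun w : Icc a b → ℝ => (w ⟨a, le_rfl, hab⟩, w ⟨b, hab, le_rfl⟩))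
    (measurable_pair _ _) (measurable_setRestrict _) (measurable_setRestrict _) hlaw h1

variable [IsProbabilityMeasure P]

/-- Along each full path of a graph of the tower, the process has the prescribed distribution. -/
theorem IsConstructedOn.map_alongPath (hT : IsTower T G) (hμ : G.IsThreeTFamily μ)
    (hX : G.IsConstructedOn T μ P X) (n : ℕ) {σ : G.FullPath}
    (hσ : PathIn (T n).points (timeDom A B) σ.fn) : P.map (alongPath X σ) = μ σ := by
  induction n generalizing σ with
  | zero =>
    obtain ⟨τ, h1, h2⟩ := hX.base
    have h3 : σ = τ := by
      refine FullPath.ext_fn fun t ht => ?_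
      have h4 := hσ.mem t ht
      rw [← h1, Curve.graph_eq] at h4
      exact h4.2
    rw [h3, h2]
  | succ n ih =>
    rcases hT.step n with h0 | ⟨e, he⟩
    · rw [points_eq_of_addVertex h0] at hσ
      exact ih hσ
    by_cases hall : ∀ t ∈ timeDom A B, (t, σ.fn t) ∈ (T n).points
    · exact ih ⟨hσ.cont, hall⟩
    push Not at hall
    obtain ⟨t₀, ht₀, hn⟩ := hall
    obtain ⟨a', b', ha', hb', hlo, hhi, hear, hpts⟩ := hT.isEar he
    obtain ⟨a, rfl⟩ : ∃ a : timeDom A B, (a : ℝ) = a' := ⟨⟨a', ha'⟩, rfl⟩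
    obtain ⟨b, rfl⟩ : ∃ b : timeDom A B, (b : ℝ) = b' := ⟨⟨b', hb'⟩, rfl⟩
    have hab : a ≤ b := hear.lt.le
    have habD : Icc (a : ℝ) b ⊆ timeDom A B := (ordConnected_timeDom A B).out a.2 b.2
    have hcl := hT.isEarSeq.isClosed n
    obtain ⟨r, hr⟩ := (hT.isEarSeq.isTimeRetract_succ n).exists_retraction
    -- the path contains the new edge
    have hσe : EqOn σ.fn e.curve.fn (Icc (a : ℝ) b) := by
      rw [hpts] at hσ
      have h1 : (t₀, σ.fn t₀) ∈ seg e.curve.fn (Icc (a : ℝ) b) := (hσ.mem t₀ ht₀).resolve_left hn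
      have h2 : σ.fn t₀ = e.curve.fn t₀ := h1.2
      have h3 := (hear.isStrand hcl).eqOn (ordConnected_timeDom A B) hσ ht₀
        (mem_Ioo_of_not_mem hear h1.1 (by rw [← h2]; exact hn)) h2
      exact fun s hs => h3 ⟨habD hs, hs⟩
    have hτ := hr.pathIn hσ
    -- The full path `τ` of the previous stage differs from `σ` only during `(a, b)`. It gives the
    -- law of `σ` at the other times, by the induction hypothesis and consistency, and its part over
    -- `[a, b]` is the second side of a simple cell with `e`.
    obtain ⟨τ, hτr⟩ := G.exists_fullPath hT.lt (hτ.mono (hT.points_subset n) Subset.rfl)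
    have hτS : PathIn (T n).points (timeDom A B) τ.fn := hτ.congr hτr
    have hout : ∀ t ∈ timeDom A B, t ∉ Ioo (a : ℝ) b → (t, σ.fn t) ∈ (T n).points := by
      intro t ht hnt
      have h1 := hσ.mem t ht
      simp only [hpts] at h1
      rcases h1 with h1 | h1
      · exact h1
      by_contra hc
      have h2 : σ.fn t = e.curve.fn t := h1.2
      exact hnt (mem_Ioo_of_not_mem hear h1.1 (by rw [← h2]; exact hc))
    have hτσ : ∀ t ∈ timeDom A B, t ∉ Ioo (a : ℝ) b → σ.fn t = τ.fn t := by
      intro t ht hnt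
      rw [hτr ht, hr.mapPath_eq (hout t ht hnt)]
    have hJ : ∀ t ∈ Iic a ∪ Ici b, σ.fn t = τ.fn t := by
      intro t ht
      have h1 : (t : ℝ) ∈ (Subtype.val '' (Iic a ∪ Ici b) : Set ℝ) := ⟨t, ht, rfl⟩
      rw [image_val_compl] at h1
      exact hτσ t h1.1 h1.2
    have hπ : PathIn (T n).points (Icc (a : ℝ) b) τ.fn := hτS.mono Subset.rfl habD
    have hae : (a : ℝ) ∈ Icc (a : ℝ) b := ⟨le_rfl, hab⟩
    have hbe : (b : ℝ) ∈ Icc (a : ℝ) b := ⟨hab, le_rfl⟩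
    have hτa : τ.fn a = e.curve.fn a := by
      rw [← hτσ a a.2 (fun h => lt_irrefl _ h.1), hσe hae]
    have hτb : τ.fn b = e.curve.fn b := by
      rw [← hτσ b b.2 (fun h => lt_irrefl _ h.2), hσe hbe]
    have hcell := hT.condIndepGiven hμ he hlo hhi hπ hτa hτb σ (Or.inl hσe)
    obtain ⟨σ₁, hσ₁, κ, hκ, hc1, hc2⟩ := hX.edge n e he a b hlo hhi
    have hσ₁e : EqOn e.curve.fn σ₁.fn (Icc (a : ℝ) b) :=
      (Curve.graph_subset_iff.1 hσ₁).2.mono (timeDom_edge hlo hhi).ge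
    have hI : ∀ t ∈ Icc a b, σ₁.fn t = σ.fn t := fun t ht =>
      ((hσe (x := (t : ℝ)) ht).trans (hσ₁e (x := (t : ℝ)) ht)).symm
    have := hμ.isProbabilityMeasure σ
    have := hμ.isProbabilityMeasure σ₁
    have hXm := hX.measurable
    have hσm := measurable_alongPath hXm σ
    have hout_m := measurable_setRestrict (Iic a ∪ Ici b)
    have hin_m := measurable_setRestrict (Icc a b)
    let v : ((Iic a ∪ Ici b : Set (timeDom A B)) → ℝ) → ℝ × ℝ :=
      fun w => (w ⟨a, Or.inl (mem_Iic.2 le_rfl)⟩, w ⟨b, Or.inr (mem_Ici.2 le_rfl)⟩)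
    have hv : Measurable v := measurable_pair _ _
    -- the kernel for the prescribed distribution
    have hk1 : HasKernel (μ σ) (Iic a ∪ Ici b).domRestrict (Icc a b).domRestrict
        (fun y => v ((Iic a ∪ Ici b).domRestrict y)) κ := by
      refine HasKernel.of_condIndepOf hout_m hin_m (measurable_pair a b) ?_ ?_
        (hasKernel_of_map_restrict_eq hab hc1 (hμ.map_restrict_eq hI))
      · exact sigmaOf_comp_le hv
      · exact (hcell.condIndepOf hout_m hin_m (measurable_pair a b)).symm (sigmaOf_le hout_m)
          (sigmaOf_le hin_m) (sigmaOf_le (measurable_pair a b))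
    -- the kernel for the process
    have hk2 : HasKernel P (fun ω => (Iic a ∪ Ici b).domRestrict (alongPath X σ ω))
        (fun ω => (Icc a b).domRestrict (alongPath X σ ω))
        (fun ω => v ((Iic a ∪ Ici b).domRestrict (alongPath X σ ω))) κ := by
      have e1 : (fun ω => (Icc a b).domRestrict (alongPath X σ₁ ω)) =
          fun ω => (Icc a b).domRestrict (alongPath X σ ω) :=
        funext (restrict_alongPath_eq X hI)
      have e2 : ∀ ω, (alongPath X σ₁ ω a, alongPath X σ₁ ω b) =
          (alongPath X σ ω a, alongPath X σ ω b) := fun ω => by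
        simp only [alongPath_apply]
        rw [hI a ⟨le_rfl, hab⟩, hI b ⟨hab, le_rfl⟩]
      rw [e1] at hc2
      simp only [e2] at hc2
      have h1 := hc2.hasKernel (V := fun ω => (alongPath X σ ω a, alongPath X σ ω b))
        (measurable_restrictTo hXm (T n)) (hin_m.comp hσm) ((measurable_pair a b).comp hσm)
      have hmem : ∀ t : (Iic a ∪ Ici b : Set (timeDom A B)),
          ((σ.point t.1 : G.points) : Point) ∈ (T n).points := by
        intro t
        have h2 : ((t.1 : timeDom A B) : ℝ) ∈ (Subtype.val '' (Iic a ∪ Ici b) : Set ℝ) :=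
          ⟨t.1, t.2, rfl⟩
        rw [image_val_compl] at h2
        have h3 := hout _ h2.1 h2.2
        rw [← σ.pt_eq] at h3
        exact h3
      exact h1.comp (f := fun q (t : (Iic a ∪ Ici b : Set (timeDom A B))) => q ⟨σ.point t.1, hmem t⟩)
        (measurable_pi_lambda _ fun t => measurable_pi_apply _)
    have hlaw : P.map (fun ω => (Iic a ∪ Ici b).domRestrict (alongPath X σ ω)) =
        (μ σ).map (Iic a ∪ Ici b).domRestrict := by
      have e1 : (fun ω => (Iic a ∪ Ici b).domRestrict (alongPath X σ ω)) =
          (Iic a ∪ Ici b).domRestrict ∘ alongPath X τ :=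
        funext (restrict_alongPath_eq X hJ)
      rw [e1, ← Measure.map_map hout_m (measurable_alongPath hXm τ), ih hτS]
      exact (hμ.map_restrict_eq hJ).symm
    have hfin := hk2.map_prod_eq hv (hout_m.comp hσm) (hin_m.comp hσm) hout_m hin_m hk1 hlaw
    refine measure_eq_of_map_restrict_eq (J := Iic a ∪ Ici b) (K := Icc a b) ?_ ?_
    · refine eq_univ_of_forall fun t => ?_
      rcases le_total t a with h1 | h1
      · exact Or.inl (Or.inl h1)
      rcases le_total b t with h2 | h2
      · exact Or.inl (Or.inr h2)
      · exact Or.inr ⟨h1, h2⟩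
    · rw [Measure.map_map (hout_m.prodMk hin_m) hσm]
      exact hfin

/-- Along a full path of a stage the process has the law `μ σ`, so an independence property of `μ σ`
becomes one of the process itself. -/
theorem IsConstructedOn.ind_cell (hT : IsTower T G) (hμ : G.IsThreeTFamily μ)
    (hX : G.IsConstructedOn T μ P X) {m : ℕ} {σ : G.FullPath}
    (hσ : PathIn (T m).points (timeDom A B) σ.fn) {a b : timeDom A B}
    (h : CondIndepGiven (μ σ) (Iic a ∪ Ici b).domRestrict (Icc a b).domRestrict
      (fun y => (y a, y b))) :
    Ind P (extend X) (seg σ.fn (Icc (a : ℝ) b)) (seg σ.fn (timeDom A B \ Ioo (a : ℝ) b))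
      {((a : ℝ), σ.fn a), ((b : ℝ), σ.fn b)} := by
  have hXm := hX.measurable
  have hσm := measurable_alongPath hXm σ
  have hout_m := measurable_setRestrict (Iic a ∪ Ici b)
  have hin_m := measurable_setRestrict (Icc a b)
  rw [← hX.map_alongPath hT hμ m hσ] at h
  have h1 : CondIndepOf P (sigmaOf fun ω => (Iic a ∪ Ici b).domRestrict (alongPath X σ ω))
      (sigmaOf fun ω => (Icc a b).domRestrict (alongPath X σ ω))
      (sigmaOf fun ω => (alongPath X σ ω a, alongPath X σ ω b)) :=
    (h.comp hσm hout_m hin_m (measurable_pair a b)).condIndepOf (hout_m.comp hσm)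
    (hin_m.comp hσm) ((measurable_pair a b).comp hσm)
  rw [sigmaOf_restrict_alongPath, sigmaOf_restrict_alongPath, sigmaOf_alongPath_pair,
    image_val_Icc, image_val_compl] at h1
  exact Ind.symm (measurable_extend hXm) h1

/-- The Markov property of strands holds in each time retract of each graph of the tower. -/
theorem IsConstructedOn.strandMarkov (hT : IsTower T G) (hμ : G.IsThreeTFamily μ)
    (hX : G.IsConstructedOn T μ P X) (n : ℕ) {L : Set Point}
    (hL : IsTimeRetract (T n).points L) : StrandMarkov P (extend X) (timeDom A B) L := by
  have hXm := hX.measurable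
  refine hT.isEarSeq.strandMarkov (measurable_extend hXm) (fun n => ?_) n hL
  rcases hT.step n with h0 | ⟨e, he⟩
  · exact Or.inl (points_eq_of_addVertex h0)
  obtain ⟨a', b', ha', hb', hlo, hhi, hear, hpts⟩ := hT.isEar he
  refine Or.inr ⟨a', b', e.curve.fn, ha', hb', hear, hpts, ?_, ?_⟩
  · obtain ⟨a, rfl⟩ : ∃ a : timeDom A B, (a : ℝ) = a' := ⟨⟨a', ha'⟩, rfl⟩
    obtain ⟨b, rfl⟩ : ∃ b : timeDom A B, (b : ℝ) = b' := ⟨⟨b', hb'⟩, rfl⟩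
    obtain ⟨σ, hσ, κ, hκ, -, hc⟩ := hX.edge n e he a b hlo hhi
    have hσe : EqOn e.curve.fn σ.fn (Icc (a : ℝ) b) :=
      (Curve.graph_subset_iff.1 hσ).2.mono (timeDom_edge hlo hhi).ge
    have hσm := measurable_alongPath hXm σ
    have hV := sigmaOf_alongPath_pair X σ a b
    have hZ := sigmaOf_restrictTo X (hT.points_subset n)
    have hW := sigmaOf_restrict_alongPath X σ (Icc a b)
    have e1 : e.curve.fn a = σ.fn a := hσe ⟨le_rfl, hear.lt.le⟩
    have e2 : e.curve.fn b = σ.fn b := hσe ⟨hear.lt.le, le_rfl⟩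
    have hVZ : sigmaOf (fun ω => (alongPath X σ ω a, alongPath X σ ω b)) ≤
        sigmaOf (restrictTo X (T n)) := by
      rw [hV, hZ]
      refine sigmaOn_mono _ ?_
      rintro p (rfl | rfl)
      · rw [← e1]; exact hear.left_mem
      · rw [← e2]; exact hear.right_mem
    have h1 := IsCondDistribGiven.condIndepOf
      (V := fun ω => (alongPath X σ ω a, alongPath X σ ω b)) (measurable_restrictTo hXm (T n))
      ((measurable_pair a b).comp hσm) hVZ hc
    rw [hV, hZ, hW, image_val_Icc] at h1
    unfold Ind
    rw [seg_congr hσe, e1, e2]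
    exact h1
  -- A path parallel to the new edge is the other side of a simple cell, so the cell condition
  -- applies along `σ'` as well.
  · intro σ' hσ' h1 h2
    obtain ⟨σ, hσ⟩ := G.exists_fullPath hT.lt (hσ'.mono (hT.points_subset n) Subset.rfl)
    have habD : Icc a' b' ⊆ timeDom A B := (ordConnected_timeDom A B).out ha' hb'
    have hπ : PathIn (T n).points (Icc a' b') σ' := hσ'.mono Subset.rfl habD
    have h3 := hT.condIndepGiven hμ he (a := ⟨a', ha'⟩) (b := ⟨b', hb'⟩) hlo hhi hπ h1 h2 σ
      (Or.inr (hσ.mono habD))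
    have h4 := hX.ind_cell hT hμ (hσ'.congr hσ) h3
    change Ind P (extend X) (seg σ.fn (Icc a' b')) (seg σ.fn (timeDom A B \ Ioo a' b'))
      {(a', σ.fn a'), (b', σ.fn b')} at h4
    rwa [seg_congr (hσ.mono habD), seg_congr (hσ.mono sdiff_subset), hσ ha', hσ hb', h1, h2] at h4

end ProcessLaw

end TimeLikeGraph

/-! ### Time windows and the process on subsets -/

/-- A retract of a part of `S` over the times in `[s₀, s₁]` can be extended by a path `τ` outside of
these times. -/
theorem IsTimeRetract.inter_union_seg {S Q K : Set Point} {D : Set ℝ} {s₀ s₁ : ℝ} {τ : ℝ → ℝ × ℝ}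
    (hS : IsClosed S) (hSQ : S ∩ {p | p.1 ∈ Icc s₀ s₁} ⊆ Q) (hQK : IsTimeRetract Q K)
    (hτ : PathIn S D τ) (hSD : ∀ p ∈ S, p.1 ∈ D)
    (hends : ∀ p ∈ K, p.1 = s₀ ∨ p.1 = s₁ → p.2 = τ p.1)
    (hτK : ∀ t ∈ Icc s₀ s₁, (t, τ t) ∈ K) (hKS : K ∩ {p | p.1 ∈ Icc s₀ s₁} ⊆ S) :
    IsTimeRetract S (K ∩ {p | p.1 ∈ Icc s₀ s₁} ∪ seg τ D) := by
  classical
  obtain ⟨r, hr⟩ := hQK.exists_retraction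
  -- Inside the window the given retraction, outside of it the projection to `τ`; at the times `s₀`
  -- and `s₁` the two agree by `hends`.
  let R : Point → Point := fun p => if p.1 ∈ Icc s₀ s₁ then r p else (p.1, τ p.1)
  have hin : ∀ p : Point, p.1 ∈ Icc s₀ s₁ → R p = r p := fun p hp => if_pos hp
  have hout : ∀ p : Point, p.1 ∉ Icc s₀ s₁ → R p = (p.1, τ p.1) := fun p hp => if_neg hp
  have hend : ∀ p ∈ S, p.1 ∉ Ioo s₀ s₁ → R p = (p.1, τ p.1) := by
    intro p hp hn
    by_cases h : p.1 ∈ Icc s₀ s₁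
    · have h1 : p.1 = s₀ ∨ p.1 = s₁ := by
        rcases h.1.lt_or_eq with h2 | h2
        · exact Or.inr (le_antisymm h.2 (not_lt.1 fun h3 => hn ⟨h2, h3⟩))
        · exact Or.inl h2.symm
      have h2 := hr.fst p (hSQ ⟨hp, h⟩)
      have h3 := hends _ (hr.mem p (hSQ ⟨hp, h⟩)) (by rw [h2]; exact h1)
      rw [hin p h]
      rw [h2] at h3
      exact Prod.ext h2 h3
    · exact hout p h
  have hc1 : IsClosed (S ∩ {p | p.1 ∈ Icc s₀ s₁}) :=
    hS.inter (isClosed_Icc.preimage continuous_fst)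
  have hc2 : IsClosed (S ∩ {p | p.1 ∈ (Ioo s₀ s₁)ᶜ}) :=
    hS.inter (isOpen_Ioo.isClosed_compl.preimage continuous_fst)
  refine ⟨union_subset hKS hτ.seg_subset, R, ?_, fun p hp => ?_, fun p hp => ?_, ?_⟩
  · have h1 : ContinuousOn R (S ∩ {p | p.1 ∈ Icc s₀ s₁}) :=
      (hr.cont.mono hSQ).congr fun p hp => hin p hp.2
    have h2 : ContinuousOn R (S ∩ {p | p.1 ∈ (Ioo s₀ s₁)ᶜ}) := by
      have h3 : ContinuousOn (fun p : Point => (p.1, τ p.1)) (S ∩ {p | p.1 ∈ (Ioo s₀ s₁)ᶜ}) :=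
        continuous_fst.continuousOn.prodMk
          (hτ.cont.comp continuous_fst.continuousOn fun p hp => hSD p hp.1)
      exact h3.congr fun p hp => hend p hp.1 hp.2
    refine (h1.union_of_isClosed h2 hc1 hc2).mono fun p hp => ?_
    by_cases h : p.1 ∈ Icc s₀ s₁
    · exact Or.inl ⟨hp, h⟩
    · exact Or.inr ⟨hp, fun h3 => h (Ioo_subset_Icc_self h3)⟩
  · by_cases h : p.1 ∈ Icc s₀ s₁
    · rw [hin p h]
      refine Or.inl ⟨hr.mem p (hSQ ⟨hp, h⟩), ?_⟩
      change (r p).1 ∈ Icc s₀ s₁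
      rw [hr.fst p (hSQ ⟨hp, h⟩)]; exact h
    · rw [hout p h]; exact Or.inr (mk_mem_seg (hSD p hp))
  · by_cases h : p.1 ∈ Icc s₀ s₁
    · rw [hin p h, hr.fst p (hSQ ⟨hp, h⟩)]
    · rw [hout p h]
  · rintro p (hp | hp)
    · rw [hin p hp.2, hr.eq p hp.1]
    · have hp' : (p.1, τ p.1) = p := Prod.ext rfl hp.2.symm
      by_cases h : p.1 ∈ Icc s₀ s₁
      · rw [hin p h, hr.eq p (by rw [← hp']; exact hτK _ h)]
      · rw [hout p h, hp']

/-- The restriction of the process `Y` to the set `K`. -/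
def onSet {Ω : Type*} (Y : Point → Ω → ℝ) (K : Set Point) (ω : Ω) : K → ℝ := fun p => Y p ω

/-- The process `Y` along `e`, at the times in `J`. -/
def onSeg {Ω : Type*} {D : Set ℝ} (Y : Point → Ω → ℝ) (e : ℝ → ℝ × ℝ) (J : Set D) (ω : Ω) : J → ℝ :=
  fun t => Y ((t : ℝ), e t) ω

theorem measurable_onSet {Ω : Type*} [MeasurableSpace Ω] {Y : Point → Ω → ℝ}
    (hY : ∀ p, Measurable (Y p)) (K : Set Point) : Measurable (onSet Y K) :=
  measurable_pi_lambda _ fun _ => hY _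

theorem measurable_onSeg {Ω : Type*} {D : Set ℝ} [MeasurableSpace Ω] {Y : Point → Ω → ℝ}
    (hY : ∀ p, Measurable (Y p)) (e : ℝ → ℝ × ℝ) (J : Set D) : Measurable (onSeg Y e J) :=
  measurable_pi_lambda _ fun _ => hY _

theorem sigmaOf_onSet {Ω : Type*} (Y : Point → Ω → ℝ) (K : Set Point) :
    sigmaOf (onSet Y K) = sigmaOn Y K := by
  have h := sigmaOf_eq_sigmaOn (Z := fun p : K => Y p) (Y := Y) (p := Subtype.val) fun _ => rfl
  rw [Subtype.range_val] at h
  exact h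

theorem sigmaOf_onSeg {Ω : Type*} {D : Set ℝ} (Y : Point → Ω → ℝ) (e : ℝ → ℝ × ℝ) (J : Set D) :
    sigmaOf (onSeg Y e J) = sigmaOn Y (seg e (Subtype.val '' J)) := by
  have h := sigmaOf_eq_sigmaOn (Z := fun t : J => Y ((t : ℝ), e t)) (Y := Y)
    (p := fun t => ((t : ℝ), e t)) fun _ => rfl
  have h1 : range (fun t : J => (((t : ℝ), e t) : Point)) = seg e (Subtype.val '' J) := by
    ext p
    constructor
    · rintro ⟨t, rfl⟩; exact ⟨⟨t.1, t.2, rfl⟩, rfl⟩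
    · rintro ⟨⟨t, ht, h2⟩, h3⟩
      exact ⟨⟨t, ht⟩, Prod.ext h2 (by rw [h3, ← h2])⟩
  rw [h1] at h
  exact h

/-- The distribution on `K ∪ e` is determined by the joint distribution of the process on `K` and
along `e`. -/
theorem map_onSet_union_eq {Ω Ω' : Type*} {D : Set ℝ} [MeasurableSpace Ω] [MeasurableSpace Ω']
    {P : Measure Ω} {P' : Measure Ω'} {Y : Point → Ω → ℝ} {Y' : Point → Ω' → ℝ}
    (hY : ∀ p, Measurable (Y p)) (hY' : ∀ p, Measurable (Y' p)) {K : Set Point} {e : ℝ → ℝ × ℝ}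
    {J : Set D} (hJ : J.Nonempty)
    (h : P.map (fun ω => (onSet Y K ω, onSeg Y e J ω)) =
      P'.map (fun ω => (onSet Y' K ω, onSeg Y' e J ω))) :
    P.map (onSet Y (K ∪ seg e (Subtype.val '' J))) =
      P'.map (onSet Y' (K ∪ seg e (Subtype.val '' J))) := by
  classical
  have : Nonempty J := hJ.to_subtype
  have hD : ∀ p : Point, p ∈ K ∪ seg e (Subtype.val '' J) → p ∉ K → ∃ t : J, ((t : ℝ), e t) = p := by
    rintro p (hp | ⟨⟨t, ht, h1⟩, h2⟩) hn
    · exact (hn hp).elim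
    · exact ⟨⟨t, ht⟩, Prod.ext h1 (by rw [h2, ← h1])⟩
  choose! τ hτ using hD
  let f : (K → ℝ) × (J → ℝ) → (K ∪ seg e (Subtype.val '' J) : Set Point) → ℝ := fun u p =>
    if hp : p.1 ∈ K then u.1 ⟨p.1, hp⟩ else u.2 (τ p.1)
  have hf : Measurable f := by
    refine measurable_pi_lambda _ fun p => ?_
    by_cases hp : p.1 ∈ K
    · simp only [f, hp, dif_pos]
      exact (measurable_pi_apply _).comp measurable_fst
    · simp only [f, hp, dif_neg, not_false_eq_true]
      exact (measurable_pi_apply _).comp measurable_snd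
  have hid : ∀ z : Point → ℝ, f (fun p => z p, fun t => z ((t : ℝ), e t)) = fun p => z p.1 := by
    intro z
    funext p
    by_cases hp : p.1 ∈ K
    · simp [f, hp]
    · simp only [f, hp, dif_neg, not_false_eq_true]
      rw [hτ p.1 p.2 hp]
  have := congrArg (Measure.map f) h
  rwa [Measure.map_map hf ((measurable_onSet hY K).prodMk (measurable_onSeg hY e J)),
    Measure.map_map hf ((measurable_onSet hY' K).prodMk (measurable_onSeg hY' e J)),
    show f ∘ (fun ω => (onSet Y K ω, onSeg Y e J ω)) = onSet Y _ from
      funext fun ω => hid fun p => Y p ω,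
    show f ∘ (fun ω => (onSet Y' K ω, onSeg Y' e J ω)) = onSet Y' _ from
      funext fun ω => hid fun p => Y' p ω] at this

namespace IsEarSeq

/-- Up to time `s₀` and from time `s₁` on, the set `S l` is not larger than `S 0`. -/
theorem exists_window {D : Set ℝ} {S : ℕ → Set Point} (h : IsEarSeq D S) (l : ℕ) {F : Set ℝ}
    (hF : F.Finite) (hF' : F.Nonempty) (hFD : F ⊆ D) :
    ∃ s₀ ∈ D, ∃ s₁ ∈ D, F ⊆ Icc s₀ s₁ ∧ ∀ p ∈ S l, p ∉ S 0 → p.1 ∈ Ioo s₀ s₁ := by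
  induction l with
  | zero =>
    obtain ⟨s₀, h0, h1⟩ := F.exists_min_image id hF hF'
    obtain ⟨s₁, h2, h3⟩ := F.exists_max_image id hF hF'
    exact ⟨s₀, hFD h0, s₁, hFD h2, fun t ht => ⟨h1 t ht, h3 t ht⟩, fun p hp hn => (hn hp).elim⟩
  | succ l ih =>
    obtain ⟨s₀, h0, s₁, h1, h2, h3⟩ := ih
    rcases h.step l with h4 | ⟨a, b, e, ha, hb, he, h4⟩
    · rw [h4]; exact ⟨s₀, h0, s₁, h1, h2, h3⟩
    refine ⟨min s₀ a, ?_, max s₁ b, ?_, h2.trans (Icc_subset_Icc (min_le_left _ _)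
      (le_max_left _ _)), fun p hp hn => ?_⟩
    · rcases min_choice s₀ a with h5 | h5 <;> rw [h5] <;> assumption
    · rcases max_choice s₁ b with h5 | h5 <;> rw [h5] <;> assumption
    by_cases hpl : p ∈ S l
    · exact Ioo_subset_Ioo (min_le_left _ _) (le_max_left _ _) (h3 p hpl hn)
    · rw [h4] at hp
      have hp' := hp.resolve_left hpl
      have hpe : (p.1, e p.1) = p := Prod.ext rfl hp'.2.symm
      exact Ioo_subset_Ioo (min_le_right _ _) (le_max_right _ _)
        (mem_Ioo_of_not_mem he hp'.1 (by rwa [hpe]))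

end IsEarSeq

/-! ### Comparison of two towers -/

namespace TimeLikeGraph

variable {A B : EReal} {G : TimeLikeGraph A B} {T T' : ℕ → TimeLikeGraph A B}
  {μ : G.FullPath → Measure (timeDom A B → ℝ)}

/-- Over a compact time interval, each graph of a tower is contained in a graph of any other tower
that constructs the same graph. -/
theorem IsTower.exists_inter_subset (hT : IsTower T G) (hT' : IsTower T' G) {s₀ s₁ : ℝ}
    (h₀ : s₀ ∈ timeDom A B) (h₁ : s₁ ∈ timeDom A B) (n : ℕ) :
    ∃ k, (T n).points ∩ {p | p.1 ∈ Icc s₀ s₁} ⊆ (T' k).points := by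
  have hw : Icc s₀ s₁ ⊆ timeDom A B := (ordConnected_timeDom A B).out h₀ h₁
  induction n with
  | zero =>
    obtain ⟨σ, hσ, h0⟩ := hT.isEarSeq.base
    have h1 : PathIn G.points (timeDom A B) σ :=
      (pathIn_seg hσ).mono (h0 ▸ hT.points_subset 0) Subset.rfl
    obtain ⟨k, hk⟩ := hT'.exists_pathIn (h1.mono Subset.rfl hw)
    refine ⟨k, ?_⟩
    rw [h0]
    rintro p ⟨hp, hpw⟩
    exact hk.seg_subset ⟨hpw, hp.2⟩
  | succ n ih =>
    obtain ⟨k, hk⟩ := ih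
    rcases hT.isEarSeq.step n with h1 | ⟨a, b, e, ha, hb, he, h1⟩
    · rw [h1]; exact ⟨k, hk⟩
    have h2 : PathIn G.points (Icc a b) e :=
      (pathIn_seg he.cont).mono ((subset_union_right.trans h1.ge).trans (hT.points_subset _))
        Subset.rfl
    obtain ⟨m, hm⟩ := hT'.exists_pathIn h2
    refine ⟨max k m, ?_⟩
    rw [h1]
    rintro p ⟨hp | hp, hpw⟩
    · exact hT'.isEarSeq.mono (le_max_left k m) (hk ⟨hp, hpw⟩)
    · exact hT'.isEarSeq.mono (le_max_right k m) (hm.seg_subset hp)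

section ProcessLaw

variable {Ω : Type*} [MeasurableSpace Ω] {P : Measure Ω} {X : G.points → Ω → ℝ}
  [IsProbabilityMeasure P]

/-- The conditional distribution along an ear `e` of a set `K` such that `K ∪ e` is a time retract
of a graph of the tower. -/
theorem IsConstructedOn.hasKernel_onSet (hT : IsTower T G) (hμ : G.IsThreeTFamily μ)
    (hX : G.IsConstructedOn T μ P X) {M : ℕ} {K : Set Point} (hK : IsClosed K)
    {a b : timeDom A B} {e : ℝ → ℝ × ℝ} (hear : IsEar K a b e)
    (hret : IsTimeRetract (T M).points (K ∪ seg e (Icc (a : ℝ) b)))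
    (hcell : ∀ τ : G.FullPath, EqOn τ.fn e (Icc (a : ℝ) b) → CondIndepGiven (μ τ)
      (Iic a ∪ Ici b).domRestrict (Icc a b).domRestrict (fun y => (y a, y b)))
    {σ₁ : G.FullPath} (hσ₁ : EqOn e σ₁.fn (Icc (a : ℝ) b)) {κ : Kernel (ℝ × ℝ) (Icc a b → ℝ)}
    [IsMarkovKernel κ]
    (hκ : IsCondDistribGiven (μ σ₁) (Icc a b).domRestrict (fun y => (y a, y b))
      fun y => κ (y a, y b)) :
    HasKernel P (onSet (extend X) K) (onSeg (extend X) e (Icc a b))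
      (fun ω => (extend X (a, e a) ω, extend X (b, e b) ω)) κ := by
  have hXm := hX.measurable
  have hY := measurable_extend hXm
  have hab : a ≤ b := hear.lt.le
  have habD : Icc (a : ℝ) b ⊆ timeDom A B := (ordConnected_timeDom A B).out a.2 b.2
  have haI : (a : ℝ) ∈ Icc (a : ℝ) b := ⟨le_rfl, hab⟩
  have hbI : (b : ℝ) ∈ Icc (a : ℝ) b := ⟨hab, le_rfl⟩
  have haO : (a : ℝ) ∈ timeDom A B \ Ioo (a : ℝ) b := ⟨a.2, fun h => lt_irrefl _ h.1⟩
  have hbO : (b : ℝ) ∈ timeDom A B \ Ioo (a : ℝ) b := ⟨b.2, fun h => lt_irrefl _ h.2⟩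
  obtain ⟨σ, hσ, hσe, hind⟩ := hX.strandMarkov hT hμ M hret a b e a.2 b.2 (hear.isStrand hK)
  have hσM : PathIn (T M).points (timeDom A B) σ := hσ.mono hret.1 Subset.rfl
  obtain ⟨τ, hτ⟩ := G.exists_fullPath hT.lt (hσM.mono (hT.points_subset M) Subset.rfl)
  have hτe : EqOn τ.fn e (Icc (a : ℝ) b) := (hτ.mono habD).trans hσe
  have hτM := hσM.congr hτ
  have := hμ.isProbabilityMeasure τ
  have := hμ.isProbabilityMeasure σ₁
  have h1 := hX.ind_cell hT hμ hτM (hcell τ hτe)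
  rw [seg_congr hτe, seg_congr (hτ.mono sdiff_subset), hτe haI, hτe hbI] at h1
  have hends : {((a : ℝ), e a), ((b : ℝ), e b)} ⊆ seg σ (timeDom A B \ Ioo (a : ℝ) b) := by
    rintro p (rfl | rfl)
    · exact ⟨haO, (hσe haI).symm⟩
    · exact ⟨hbO, (hσe hbI).symm⟩
  -- The condition is written as the ends together with the rest of the path, the form required for
  -- the contraction with `h1`.
  rw [← union_eq_self_of_subset_left hends] at hind
  have hKL : K ⊆ (K ∪ seg e (Icc (a : ℝ) b)) \ seg e (Ioo (a : ℝ) b) := by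
    refine fun p hp => ⟨Or.inl hp, fun h => hear.not_mem p.1 h.1 ?_⟩
    have hpe : (p.1, e p.1) = p := Prod.ext rfl h.2.symm
    rwa [hpe]
  have h2 : Ind P (extend X) (seg e (Icc (a : ℝ) b)) K {((a : ℝ), e a), ((b : ℝ), e b)} :=
    (h1.contraction hind).right hY Subset.rfl subset_union_left
      ((hKL.trans subset_union_right).trans subset_union_right)
  have hV : Measurable fun ω => (extend X (a, e a) ω, extend X (b, e b) ω) :=
    (hY _).prodMk (hY _)
  refine HasKernel.of_condIndepOf (measurable_onSet hY K) (measurable_onSeg hY e _) hV ?_ ?_ ?_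
  · rw [sigmaOf_onSet, sigmaOf_prodMk]
    refine sigmaOn_mono _ ?_
    rintro p (rfl | rfl)
    · exact hear.left_mem
    · exact hear.right_mem
  · rw [sigmaOf_onSet, sigmaOf_prodMk, sigmaOf_onSeg, image_val_Icc]
    exact h2
  · have hin_m := measurable_setRestrict (Icc a b)
    have hτm := measurable_alongPath hXm τ
    have h3 : HasKernel (μ τ) (fun y => (y a, y b)) (Icc a b).domRestrict (fun y => (y a, y b)) κ :=
      -- The paths `τ` and `σ₁` both contain `e`, so by consistency the kernel of one serves for the
      -- other.
      hasKernel_of_map_restrict_eq hab hκ (hμ.map_restrict_eq fun t ht =>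
        ((hτe (x := (t : ℝ)) ht).trans (hσ₁ (x := (t : ℝ)) ht)).symm)
    have h4 : (μ τ).map (Icc a b).domRestrict =
        P.map (fun ω => (Icc a b).domRestrict (alongPath X τ ω)) := by
      rw [← hX.map_alongPath hT hμ M hτM, Measure.map_map hin_m hτm]
      rfl
    have h5 := HasKernel.of_map_eq
      (v := fun w : Icc a b → ℝ => (w ⟨a, le_rfl, hab⟩, w ⟨b, hab, le_rfl⟩))
      (measurable_pair _ _) hin_m (hin_m.comp hτm) h4 h3
    have e1 : ∀ ω, (Icc a b).domRestrict (alongPath X τ ω) = onSeg (extend X) e (Icc a b) ω := by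
      intro ω
      funext t
      have ht := hτe (x := (t : ℝ)) t.2
      simp only [Set.domRestrict, alongPath_apply, onSeg, ht]
    simp only [Function.comp_def, e1] at h5
    exact h5

/-- The conditional distribution along a new edge. -/
theorem IsConstructedOn.exists_hasKernel (hT : IsTower T G)
    (hX : G.IsConstructedOn T μ P X)
    {n : ℕ} {e : Edge} (he : (T n).AddEdge (T (n + 1)) e) {a b : timeDom A B}
    (ha : e.lo = ((a : ℝ) : EReal)) (hb : e.hi = ((b : ℝ) : EReal)) {W : Set Point}
    (hW : W ⊆ (T n).points) :
    ∃ σ : G.FullPath, EqOn e.curve.fn σ.fn (Icc (a : ℝ) b) ∧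
      ∃ κ : Kernel (ℝ × ℝ) (Icc a b → ℝ), IsMarkovKernel κ ∧
        IsCondDistribGiven (μ σ) (Icc a b).domRestrict (fun y => (y a, y b))
          (fun y => κ (y a, y b)) ∧
        HasKernel P (onSet (extend X) W) (onSeg (extend X) e.curve.fn (Icc a b))
          (fun ω => (extend X (a, e.curve.fn a) ω, extend X (b, e.curve.fn b) ω)) κ := by
  have hXm := hX.measurable
  have hab : a ≤ b := by
    have := e.lo_lt_hi
    rw [ha, hb, EReal.coe_lt_coe_iff] at this
    exact this.le
  obtain ⟨σ, hσ, κ, hκ, h1, h2⟩ := hX.edge n e he a b ha hb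
  have hσe : EqOn e.curve.fn σ.fn (Icc (a : ℝ) b) :=
    (Curve.graph_subset_iff.1 hσ).2.mono (timeDom_edge ha hb).ge
  refine ⟨σ, hσe, κ, hκ, h1, ?_⟩
  have hσm := measurable_alongPath hXm σ
  have h3 := h2.hasKernel (V := fun ω => (alongPath X σ ω a, alongPath X σ ω b))
    (measurable_restrictTo hXm (T n)) ((measurable_setRestrict _).comp hσm)
    ((measurable_pair a b).comp hσm)
  have hG := hT.points_subset n
  have h4 := h3.comp (f := fun q (p : W) => q ⟨⟨p.1, hG (hW p.2)⟩, hW p.2⟩)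
    (measurable_pi_lambda _ fun t => measurable_pi_apply _)
  have e1 : (Icc a b).domRestrict ∘ alongPath X σ = onSeg (extend X) e.curve.fn (Icc a b) := by
    funext ω t
    have ht := hσe (x := (t : ℝ)) t.2
    simp only [Function.comp, Set.domRestrict, alongPath_apply, onSeg, ht]
  have e2 : (fun ω (p : W) => restrictTo X (T n) ω ⟨⟨p.1, hG (hW p.2)⟩, hW p.2⟩) =
      onSet (extend X) W := by
    funext ω p
    exact congrFun (extend_coe X ⟨p.1, hG (hW p.2)⟩) ω
  rw [e2] at h4
  change HasKernel P _ ((Icc a b).domRestrict ∘ alongPath X σ) _ κ at h4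
  rw [e1] at h4
  simp only [alongPath_apply, ← hσe (x := (a : ℝ)) ⟨le_rfl, hab⟩,
    ← hσe (x := (b : ℝ)) ⟨hab, le_rfl⟩] at h4
  exact h4

end ProcessLaw

end TimeLikeGraph

namespace TimeLikeGraph

variable {A B : EReal} {G : TimeLikeGraph A B} {T T' : ℕ → TimeLikeGraph A B}
  {μ : G.FullPath → Measure (timeDom A B → ℝ)}

/-- A path that agrees on `[s₀, s₁]` with the given one and that runs in `(T M).points`. -/
theorem IsTower.exists_extension (hT : IsTower T G) {M : ℕ} {s₀ s₁ : ℝ} (hs : s₀ ≤ s₁)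
    {σ : ℝ → ℝ × ℝ} (hσ : PathIn (T M).points (Icc s₀ s₁) σ) :
    ∃ τ, PathIn (T M).points (timeDom A B) τ ∧ EqOn τ σ (Icc s₀ s₁) := by
  obtain ⟨-, σa, ha, ha'⟩ := hT.isEarSeq.exists_path M (hσ.mem s₀ ⟨le_rfl, hs⟩)
  obtain ⟨-, σb, hb, hb'⟩ := hT.isEarSeq.exists_path M (hσ.mem s₁ ⟨hs, le_rfl⟩)
  have h1 : σa s₀ = glue s₁ σ σb s₀ := by rw [glue_le _ _ hs]; exact ha'
  refine ⟨glue s₀ σa (glue s₁ σ σb), ?_, fun t ht => ?_⟩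
  · refine PathIn.glue (ha.mono Subset.rfl inter_subset_left) (PathIn.glue ?_ ?_ hb'.symm) h1
    · exact hσ.mono Subset.rfl fun t ht => ⟨ht.1.2, ht.2⟩
    · exact hb.mono Subset.rfl fun t ht => ht.1.1
  · rw [glue_ge h1 ht.1, glue_le _ _ ht.2]

section ProcessLaw

variable {Ω Ω' : Type*} [MeasurableSpace Ω] [MeasurableSpace Ω'] {P : Measure Ω}
  {P' : Measure Ω'} {X : G.points → Ω → ℝ} {X' : G.points → Ω' → ℝ}
  [IsProbabilityMeasure P] [IsProbabilityMeasure P']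

/-- Two processes that are constructed using different towers have the same distribution on the part
over a suitable compact time interval of a graph of the second tower. -/
theorem map_onSet_window_eq (hT : IsTower T G) (hT' : IsTower T' G) (hμ : G.IsThreeTFamily μ)
    (hX : G.IsConstructedOn T μ P X) (hX' : G.IsConstructedOn T' μ P' X') {s₀ s₁ : ℝ}
    (h₀ : s₀ ∈ timeDom A B) (h₁ : s₁ ∈ timeDom A B) (hs : s₀ ≤ s₁) {l : ℕ}
    (hw : ∀ p ∈ (T' l).points, p ∉ (T' 0).points → p.1 ∈ Ioo s₀ s₁) :
    P.map (onSet (extend X) ((T' l).points ∩ {p | p.1 ∈ Icc s₀ s₁})) =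
      P'.map (onSet (extend X') ((T' l).points ∩ {p | p.1 ∈ Icc s₀ s₁})) := by
  have hXm := hX.measurable
  have hXm' := hX'.measurable
  have hY := measurable_extend hXm
  have hY' := measurable_extend hXm'
  have hwD : Icc s₀ s₁ ⊆ timeDom A B := (ordConnected_timeDom A B).out h₀ h₁
  obtain ⟨σ, hσ0, hσlaw⟩ := hX'.base
  rw [Curve.graph_eq] at hσ0
  change seg σ.fn (timeDom A B) = _ at hσ0
  -- Over the window, stage `l` of the second tower is in stage `M` of the first one, which is in
  -- stage `k` of the second one. The sandwich makes the stages of the second tower retracts of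
  -- stage `M`.
  obtain ⟨M, hM⟩ := hT'.exists_inter_subset hT h₀ h₁ l
  obtain ⟨k, hk⟩ := hT.exists_inter_subset hT' h₀ h₁ M
  have hmono : ∀ {i j : ℕ}, i ≤ j → (T' i).points ⊆ (T' j).points := fun h => hT'.isEarSeq.mono h
  have hσM : PathIn (T M).points (Icc s₀ s₁) σ.fn := by
    refine ⟨σ.pathIn.cont.mono hwD, fun t ht => hM ⟨hmono l.zero_le ?_, ht⟩⟩
    rw [← hσ0]
    exact mk_mem_seg (hwD ht)
  -- The base path of the second tower may leave stage `M` outside the window, so it is continued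
  -- there by paths of stage `M`.
  obtain ⟨τ, hτ, hτσ⟩ := hT.exists_extension hs hσM
  have hτ0 : ∀ t ∈ Icc s₀ s₁, (t, τ t) ∈ (T' 0).points := fun t ht => by
    rw [← hσ0]; exact ⟨hwD ht, hτσ ht⟩
  have hret : ∀ i ≤ l, IsTimeRetract (T M).points
      ((T' i).points ∩ {p | p.1 ∈ Icc s₀ s₁} ∪ seg τ (timeDom A B)) := by
    intro i hi
    refine IsTimeRetract.inter_union_seg (hT.isEarSeq.isClosed M)
      (hk.trans (hmono (le_max_left k i))) (hT'.isEarSeq.isTimeRetract (le_max_right k i)) hτ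
      (fun p hp => (hT.isEarSeq.exists_path M hp).1) ?_ (fun t ht => hmono i.zero_le (hτ0 t ht))
      ((inter_subset_inter_left _ (hmono hi)).trans hM)
    -- At the two boundary times of the window stage `i` has only points of the base path, where `τ`
    -- runs.
    intro p hp hpt
    have h1 : p ∈ (T' 0).points := by
      by_contra hn
      have h2 := hw p (hmono hi hp) hn
      rcases hpt with h3 | h3
      · exact h2.1.ne h3.symm
      · exact h2.2.ne h3
    rw [← hσ0] at h1
    have h4 : p.1 ∈ Icc s₀ s₁ := by
      rcases hpt with h3 | h3 <;> rw [h3]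
      · exact ⟨le_rfl, hs⟩
      · exact ⟨hs, le_rfl⟩
    exact h1.2.trans (hτσ h4).symm
  suffices h : ∀ i ≤ l, P.map (onSet (extend X) ((T' i).points ∩ {p | p.1 ∈ Icc s₀ s₁})) =
      P'.map (onSet (extend X') ((T' i).points ∩ {p | p.1 ∈ Icc s₀ s₁})) from h l le_rfl
  intro i hi
  induction i with
  | zero =>
    obtain ⟨τ', hτ'⟩ := G.exists_fullPath hT.lt (hτ.mono (hT.points_subset M) Subset.rfl)
    let J : Set (timeDom A B) := {t | (t : ℝ) ∈ Icc s₀ s₁}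
    have hJ_m := measurable_setRestrict J
    have h1 : ∀ t ∈ J, τ'.fn t = σ.fn t := fun t ht => (hτ' t.2).trans (hτσ ht)
    have h2 : P.map (J.domRestrict ∘ alongPath X τ') = P'.map (J.domRestrict ∘ alongPath X' σ) := by
      have h3 := hμ.map_restrict_eq h1
      rw [← hσlaw, ← hX.map_alongPath hT hμ M (hτ.congr hτ'),
        Measure.map_map hJ_m (measurable_alongPath hXm τ'),
        Measure.map_map hJ_m (measurable_alongPath hXm' σ)] at h3
      exact h3
    have hp : ∀ p : ((T' 0).points ∩ {p | p.1 ∈ Icc s₀ s₁} : Set Point), p.1.2 = σ.fn p.1.1 := by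
      intro p
      exact (hσ0.symm.subset p.2.1).2
    let f : (J → ℝ) → ((T' 0).points ∩ {p | p.1 ∈ Icc s₀ s₁} : Set Point) → ℝ :=
      fun u p => u ⟨⟨p.1.1, hwD p.2.2⟩, p.2.2⟩
    have hf : Measurable f := measurable_pi_lambda _ fun p => measurable_pi_apply _
    have h3 := congrArg (Measure.map f) h2
    rw [Measure.map_map hf (hJ_m.comp (measurable_alongPath hXm τ')),
      Measure.map_map hf (hJ_m.comp (measurable_alongPath hXm' σ))] at h3
    convert h3 using 2
    · funext ω p
      have h4 : p.1 = (p.1.1, τ'.fn p.1.1) :=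
        Prod.ext rfl ((hp p).trans (h1 ⟨p.1.1, hwD p.2.2⟩ p.2.2).symm)
      simp only [f, onSet, Function.comp, Set.domRestrict, alongPath_apply]
      rw [← h4]
    · funext ω p
      have h4 : p.1 = (p.1.1, σ.fn p.1.1) := Prod.ext rfl (hp p)
      simp only [f, onSet, Function.comp, Set.domRestrict, alongPath_apply]
      rw [← h4]
  | succ i ih =>
    have ih' := ih (Nat.le_of_succ_le hi)
    have hreti := hret i (Nat.le_of_succ_le hi)
    rcases hT'.step i with h0 | ⟨e, he⟩
    · rw [points_eq_of_addVertex h0]; exact ih'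
    obtain ⟨a', b', ha', hb', hlo, hhi, hear, hpts⟩ := hT'.isEar he
    obtain ⟨a, rfl⟩ : ∃ a : timeDom A B, (a : ℝ) = a' := ⟨⟨a', ha'⟩, rfl⟩
    obtain ⟨b, rfl⟩ : ∃ b : timeDom A B, (b : ℝ) = b' := ⟨⟨b', hb'⟩, rfl⟩
    have hab : a ≤ b := hear.lt.le
    have hsub : Icc (a : ℝ) b ⊆ Icc s₀ s₁ := by
      rw [← closure_Ioo hear.lt.ne]
      refine closure_minimal (fun t ht => ?_) isClosed_Icc
      refine Ioo_subset_Icc_self (hw (t, e.curve.fn t) (hmono hi ?_) fun h => ?_)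
      · rw [hpts]; exact Or.inr (mk_mem_seg (Ioo_subset_Icc_self ht))
      · exact hear.not_mem t ht (hmono i.zero_le h)
    have hW : (T' (i + 1)).points ∩ {p | p.1 ∈ Icc s₀ s₁} =
        (T' i).points ∩ {p | p.1 ∈ Icc s₀ s₁} ∪ seg e.curve.fn (Icc (a : ℝ) b) := by
      have h1 : seg e.curve.fn (Icc (a : ℝ) b) ⊆ {p : Point | p.1 ∈ Icc s₀ s₁} :=
        fun p hp => hsub hp.1
      rw [hpts, union_inter_distrib_right, inter_eq_self_of_subset_left h1]
    have haI : (a : ℝ) ∈ Icc (a : ℝ) b := ⟨le_rfl, hab⟩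
    have hbI : (b : ℝ) ∈ Icc (a : ℝ) b := ⟨hab, le_rfl⟩
    obtain ⟨ρ, hρ, hρa, hρb⟩ := hear.joined
    obtain ⟨σ₁, hσ₁, κ, hκ, hc, hk2⟩ := hX'.exists_hasKernel hT' he hlo hhi
      (W := (T' i).points ∩ {p | p.1 ∈ Icc s₀ s₁}) inter_subset_left
    have hearK : IsEar ((T' i).points ∩ {p | p.1 ∈ Icc s₀ s₁} ∪ seg τ (timeDom A B)) a b
        e.curve.fn := by
      refine ⟨hear.lt, hear.cont, Or.inl ⟨hear.left_mem, hsub haI⟩,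
        Or.inl ⟨hear.right_mem, hsub hbI⟩, fun t ht => ?_, ρ, ⟨hρ.cont, fun t ht =>
          Or.inl ⟨hρ.mem t ht, hsub ht⟩⟩, hρa, hρb⟩
      rintro (h | h)
      · exact hear.not_mem t ht h.1
      · have h1 : e.curve.fn t = τ t := h.2
        refine hear.not_mem t ht (hmono i.zero_le ?_)
        rw [h1]
        exact hτ0 t (hsub (Ioo_subset_Icc_self ht))
    -- The edge `e` is new in the second tower, which supplies the simple cell. Simplicity refers to
    -- `G` alone, so the cell condition is available for the process of the first tower too, with
    -- the same kernel `κ`.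
    have hk1 := hX.hasKernel_onSet hT hμ (M := M) (hreti.isClosed (hT.isEarSeq.isClosed M)) hearK
      (by rw [union_right_comm, ← hW]; exact hret _ hi)
      (fun τ' hτ' => hT'.condIndepGiven hμ he hlo hhi hρ hρa hρb τ' (Or.inl hτ')) hσ₁ hc
    have hk1' := hk1.comp
      (f := fun q (p : ((T' i).points ∩ {p | p.1 ∈ Icc s₀ s₁} : Set Point)) => q ⟨p.1, Or.inl p.2⟩)
      (measurable_pi_lambda _ fun t => measurable_pi_apply _)
    have h1 := HasKernel.map_prod_eq (κ := κ)
      (v := fun q : ((T' i).points ∩ {p | p.1 ∈ Icc s₀ s₁} : Set Point) → ℝ =>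
        (q ⟨((a : ℝ), e.curve.fn a), hear.left_mem, hsub haI⟩,
          q ⟨((b : ℝ), e.curve.fn b), hear.right_mem, hsub hbI⟩))
      (measurable_pair _ _) (measurable_onSet hY _) (measurable_onSeg hY _ _)
      (measurable_onSet hY' _) (measurable_onSeg hY' _ _) hk1' hk2 ih'
    have h2 := map_onSet_union_eq hY hY' (nonempty_Icc.2 hab) h1
    rw [image_val_Icc, ← hW] at h2
    exact h2

end ProcessLaw

end TimeLikeGraph

theorem mainTheorem2 {A B : EReal} (G : TimeLikeGraph A B) (hG : G.verts.Infinite)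
    (T₁ T₂ : ℕ → TimeLikeGraph A B)
    (hT₁ : TimeLikeGraph.IsTower T₁ G) (hT₂ : TimeLikeGraph.IsTower T₂ G)
    (μ : G.FullPath → Measure (timeDom A B → ℝ)) (hμ : G.IsThreeTFamily μ)
    {Ω₁ Ω₂ : Type*} [MeasurableSpace Ω₁] [MeasurableSpace Ω₂]
    (P₁ : Measure Ω₁) (P₂ : Measure Ω₂) [IsProbabilityMeasure P₁] [IsProbabilityMeasure P₂]
    (X₁ : G.points → Ω₁ → ℝ) (X₂ : G.points → Ω₂ → ℝ)
    (hX₁ : G.IsConstructedOn T₁ μ P₁ X₁) (hX₂ : G.IsConstructedOn T₂ μ P₂ X₂) :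
    P₁.map (fun ω p => X₁ p ω) = P₂.map (fun ω p => X₂ p ω) := by
  have hm₁ : Measurable fun ω p => X₁ p ω := measurable_pi_lambda _ hX₁.measurable
  have hm₂ : Measurable fun ω p => X₂ p ω := measurable_pi_lambda _ hX₂.measurable
  have := Measure.isProbabilityMeasure_map (μ := P₂) hm₂.aemeasurable
  -- A law on the product space is determined by its finite-dimensional marginals.
  refine IsProjectiveLimit.unique (P := fun I => (P₂.map fun ω p => X₂ p ω).map I.restrict)
    (fun I => ?_) fun I => rfl
  obtain ⟨l, hl⟩ : ∃ l, ∀ p ∈ I, (p : Point) ∈ (T₂ l).points := by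
    have h1 : ∀ p : G.points, ∃ n, (p : Point) ∈ (T₂ n).points := fun p =>
      mem_iUnion.1 (hT₂.points_eq.symm.subset p.2)
    choose N hN using h1
    exact ⟨I.sup N, fun p hp => hT₂.isEarSeq.mono (Finset.le_sup hp) (hN p)⟩
  obtain ⟨t₀, ht₀⟩ : ∃ t₀ : ℝ, t₀ ∈ timeDom A B := by
    obtain ⟨t, h1, h2⟩ := EReal.lt_iff_exists_real_btwn.1 hT₂.lt
    exact ⟨t, h1.le, h2.le⟩
  -- The window is to contain the times of the given points; `t₀` is inserted only to cover the case
  -- that there are none.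
  obtain ⟨s₀, h₀, s₁, h₁, hF, hw⟩ := hT₂.isEarSeq.exists_window l
    (F := insert t₀ ((fun p : G.points => p.1.1) '' I)) ((I.finite_toSet.image _).insert _)
    (insert_nonempty _ _) (by
      refine insert_subset ht₀ ?_
      rintro _ ⟨p, hp, rfl⟩
      exact (hT₂.isEarSeq.exists_path l (hl p hp)).1)
  have hs := hF (mem_insert _ _)
  have h := TimeLikeGraph.map_onSet_window_eq hT₁ hT₂ hμ hX₁ hX₂ h₀ h₁ (hs.1.trans hs.2) hw
  let f : (((T₂ l).points ∩ {p | p.1 ∈ Icc s₀ s₁} : Set Point) → ℝ) → I → ℝ :=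
    fun u p => u ⟨p.1, hl p.1 p.2, hF (mem_insert_of_mem _ ⟨p.1, p.2, rfl⟩)⟩
  have hf : Measurable f := measurable_pi_lambda _ fun p => measurable_pi_apply _
  have h2 := congrArg (Measure.map f) h
  rw [Measure.map_map hf (measurable_onSet (TimeLikeGraph.measurable_extend hX₁.measurable) _),
    Measure.map_map hf (measurable_onSet (TimeLikeGraph.measurable_extend hX₂.measurable) _)] at h2
  change _ = (P₂.map fun ω p => X₂ p ω).map I.restrict
  rw [Measure.map_map (Finset.measurable_restrict I) hm₁,
    Measure.map_map (Finset.measurable_restrict I) hm₂]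
  convert h2 using 2
  · funext ω p
    exact congrFun (TimeLikeGraph.extend_coe X₁ p.1) ω
  · funext ω p
    exact congrFun (TimeLikeGraph.extend_coe X₂ p.1) ω
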